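/- **Theorem 2.4.** Let $\mathbb F$ be a finite field with $q$ elements, $q$ odd, let $\nu\ge 2$, and let $z\in\mathbb F$ be a non-square such that $1-z$ is also a non-square. Put $\Delta=\begin{pmatrix}1&0\\0&-z\end{pmatrix}$ and $$S=\begin{pmatrix}0&I^{(\nu)}&0\\ I^{(\nu)}&0&0\\ 0&0&\Delta\end{pmatrix},\qquad O=\{T\in GL_{2\nu+2}(\mathbb F): TST^t=S\},$$ where $O$ acts on the row space $\mathbb F^{2\nu+2}$ by right multiplication. The orthogonal dual polar graph $\Gamma$ has as vertices the maximal totally isotropic subspaces $P$ of $\mathbb F^{2\nu+2}$ (those maximal under inclusion among subspaces with $uSv^t=0$ for all $u,v\in P$), two distinct vertices $P,Q$ being adjacent when $\dim(P\cap Q)=\nu-1$. A matrix with $\nu$ rows is identified with its row space. Let $P_0=(I^{(\nu)}\ 0\ 0)$, let $P_1=(0\ I^{(\nu)}\ 0)$, let $\Lambda$ be the set of vertices at distance $\nu$ from $P_0$ in $\Gamma$, let $G_0$ be the stabilizer of $P_0$ in $O$, and let $G_{01}$ be the stabilizer of $P_1$ in $G_0$. Let $\Omega\subseteq\mathbb F^*$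 be such that $\mathbb F^*$ is the disjoint union of $\Omega$ and $-\Omega$. Write $[X_1,\dots,X_t]$ for the block diagonal matrix with diagonal blocks $X_1,\dots,X_t$, $0^{(m)}$ for the $m\times m$ zero matrix, $E_i$ for the $i$-th unit column vector of length $\nu$, $\mathcal A_2=\begin{pmatrix}0&1\\-1&0\end{pmatrix}$, $\mathcal A_{2r}=[\mathcal A_2,\dots,\mathcal A_2]$ ($r$ blocks), and $$\mathcal K=\begin{pmatrix}0&I^{(2)}\\-I^{(2)}&0\end{pmatrix},\qquad Y=\begin{pmatrix}0&0&1\\0&0&1\\-1&-1&0\end{pmatrix}.$$ Consider the following subspaces, where $a\in\{0,1\}$ and $b\in\Omega$: - $\varphi_1(r)=([\mathcal A_{2r},0^{(\nu-2r)}]\ \ I^{(\nu)}\ \ 0)$, for $1\le r\le\lfloor\nu/2\rfloor$; - $\varphi_2(r,a)=([-\tfrac12(1-za^2),\mathcal A_{2r},0^{(\nu-2r-1)}]\ \ I^{(\nu)}\ \ (E_1\ aE_1))$, for $0\le r\le\lfloor(\nu-1)/2\rfloor$; - $\varphi_3(r,a)=([\mathcal A_{2r},0^{(\nu-2r)}]+[-\tfrac12(1-za^2),0^{(\nu-1)}]\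 \ I^{(\nu)}\ \ (E_1\ aE_1))$, for $1\le r\le\lfloor\nu/2\rfloor$; - $\varphi_4(r)=([0^{(1)},\mathcal A_{2r},0^{(\nu-1-2r)}]+[-\tfrac12\Delta,0^{(\nu-2)}]\ \ I^{(\nu)}\ \ (E_1\ E_2))$, for $0\le r\le\lfloor(\nu-1)/2\rfloor$; - $\varphi_5(r)=([Y,\mathcal A_{2r-2},0^{(\nu-1-2r)}]+[-\tfrac12\Delta,0^{(\nu-2)}]\ \ I^{(\nu)}\ \ (E_1\ E_2))$, for $1\le r\le\lfloor(\nu-1)/2\rfloor$; - $\varphi_6(r)=([-\tfrac12\Delta,\mathcal A_{2r},0^{(\nu-2r-2)}]\ \ I^{(\nu)}\ \ (E_1\ E_2))$, for $1\le r\le\lfloor(\nu-2)/2\rfloor$; - $\varphi_7(r,b)=([b\mathcal A_2-\tfrac12\Delta,\mathcal A_{2r-2},0^{(\nu-2r)}]\ \ I^{(\nu)}\ \ (E_1\ E_2))$, for $1\le r\le\lfloor\nu/2\rfloor$; - $\varphi_8(r)=([\mathcal K,\mathcal A_{2r-4},0^{(\nu-2r)}]+[-\tfrac12\Delta,0^{(\nu-2)}]\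 \ I^{(\nu)}\ \ (E_1\ E_2))$, for $2\le r\le\lfloor\nu/2\rfloor$. Then $P_1\in\Lambda$, all these subspaces belong to $\Lambda$, and they form a complete system of representatives of the orbits of $G_{01}$ on $\Lambda$ other than the trivial orbit $\{P_1\}$: assigning to each choice of the family and its parameters the $G_{01}$-orbit of the corresponding subspace is a bijection onto the set of these orbits. Moreover $G_0$ is transitive on $\Lambda$ and its rank there, that is, the number of orbits on $\Lambda$ of the stabilizer in $G_0$ of any $P\in\Lambda$, is $$\frac{q+7}{2}\Big\lfloor\frac{\nu}{2}\Big\rfloor+4\Big\lfloor\frac{\nu-1}{2}\Big\rfloor+\Big\lfloor\frac{\nu-2}{2}\Big\rfloor+3 .$$ -/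

import Mathlib

open Matrix
open scoped Pointwise

noncomputable section

namespace OrthDualPolar

variable {F : Type*} [Field F]

/-- Coordinates of `F ^ (2 ν + 2)`, in three consecutive blocks of sizes `ν`, `ν` and `2`. -/
abbrev Idx (ν : ℕ) : Type := Fin ν ⊕ (Fin ν ⊕ Fin 2)

/-- The row vector space `F ^ (2 ν + 2)`. -/
abbrev Vec (F : Type*) (ν : ℕ) : Type _ := Idx ν → F

/-- Subspaces of the row vector space. -/
abbrev Subsp (F : Type*) [Field F] (ν : ℕ) : Type _ := Submodule F (Vec F ν)

/-- The definite part `diag (1, -z)` of the form. -/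
def Delta (z : F) : Matrix (Fin 2) (Fin 2) F := !![1, 0; 0, -z]

/-- The Gram matrix with rows of blocks `(0 I 0)`, `(I 0 0)`, `(0 0 Δ)`. -/
def gramS (ν : ℕ) (z : F) : Matrix (Idx ν) (Idx ν) F :=
  fromBlocks 0 (fromCols 1 0) (fromRows 1 0) (fromBlocks 0 0 0 (Delta z))

/-- The orthogonal group: all invertible `T` with `T S Tᵀ = S`, for the Gram matrix `S`. -/
def orthogonalGroup (ν : ℕ) (z : F) : Subgroup (GL (Idx ν) F) where
  carrier := {T | (T : Matrix (Idx ν) (Idx ν) F) * gramS ν z *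
    (T : Matrix (Idx ν) (Idx ν) F)ᵀ = gramS ν z}
  one_mem' := by simp
  mul_mem' := by
    intro T U hT hU
    simp only [Set.mem_ofPred_eq, Units.val_mul, transpose_mul] at *
    calc (T.val * U.val) * gramS ν z * (U.valᵀ * T.valᵀ)
        = T.val * (U.val * gramS ν z * U.valᵀ) * T.valᵀ := by
          simp only [Matrix.mul_assoc]
      _ = gramS ν z := by rw [hU, hT]
  inv_mem' := by
    intro T hT
    simp only [Set.mem_ofPred_eq] at *
    have h1 : ((T⁻¹ : GL (Idx ν) F) : Matrix (Idx ν) (Idx ν) F) * T = 1 := T.inv_mul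
    have h2 : (T : Matrix (Idx ν) (Idx ν) F)ᵀ *
        ((T⁻¹ : GL (Idx ν) F) : Matrix (Idx ν) (Idx ν) F)ᵀ = 1 := by
      rw [← transpose_mul, h1, transpose_one]
    calc ((T⁻¹ : GL (Idx ν) F) : Matrix (Idx ν) (Idx ν) F) * gramS ν z *
          ((T⁻¹ : GL (Idx ν) F) : Matrix (Idx ν) (Idx ν) F)ᵀ
        = (((T⁻¹ : GL (Idx ν) F) : Matrix (Idx ν) (Idx ν) F) * T) * gramS ν z *
          ((T : Matrix (Idx ν) (Idx ν) F)ᵀ *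
            ((T⁻¹ : GL (Idx ν) F) : Matrix (Idx ν) (Idx ν) F)ᵀ) := by
          conv_lhs => rw [← hT]
          simp only [Matrix.mul_assoc]
      _ = gramS ν z := by rw [h1, h2, Matrix.one_mul, Matrix.mul_one]

/-! The right action of matrices on subspaces -/

/-- The subspace `P T = {v T | v ∈ P}`. -/
def mulRight {ν : ℕ} (P : Subsp F ν) (T : GL (Idx ν) F) : Subsp F ν :=
  P.map (T : Matrix (Idx ν) (Idx ν) F).vecMulLinear

theorem mulRight_one {ν : ℕ} (P : Subsp F ν) : mulRight P 1 = P := by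
  ext v
  simp [mulRight]

theorem mulRight_mul {ν : ℕ} (P : Subsp F ν) (T U : GL (Idx ν) F) :
    mulRight P (T * U) = mulRight (mulRight P T) U := by
  ext v
  simp [mulRight, vecMul_vecMul]

/-- The stabilizer of the subspace `P` in the group `H`. -/
def stab {ν : ℕ} (H : Subgroup (GL (Idx ν) F)) (P : Subsp F ν) : Subgroup (GL (Idx ν) F) where
  carrier := {T | T ∈ H ∧ mulRight P T = P}
  one_mem' := ⟨H.one_mem, mulRight_one P⟩
  mul_mem' := by
    rintro T U ⟨hT, hT'⟩ ⟨hU, hU'⟩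
    exact ⟨H.mul_mem hT hU, by rw [mulRight_mul, hT', hU']⟩
  inv_mem' := by
    rintro T ⟨hT, hT'⟩
    refine ⟨H.inv_mem hT, ?_⟩
    calc mulRight P T⁻¹ = mulRight (mulRight P T) T⁻¹ := by rw [hT']
      _ = P := by rw [← mulRight_mul, mul_inv_cancel, mulRight_one]

/-- The orbit of the subspace `P` under the group `H`. -/
def orbit {ν : ℕ} (H : Subgroup (GL (Idx ν) F)) (P : Subsp F ν) : Set (Subsp F ν) :=
  {Q | ∃ T ∈ H, mulRight P T = Q}

/-- The set of all orbits of `H` that meet `X`; for an invariant set `X` of subspaces these are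
the orbits of `H` on `X`. -/
def orbitsOn {ν : ℕ} (H : Subgroup (GL (Idx ν) F)) (X : Set (Subsp F ν)) :
    Set (Set (Subsp F ν)) :=
  orbit H '' X

/-- `H` acts transitively on the nonempty set `X` of subspaces, and for every `P ∈ X` the
stabilizer of `P` in `H` has exactly `n` orbits on `X`; that is, `H` has rank `n` on `X`. -/
def HasRank {ν : ℕ} (H : Subgroup (GL (Idx ν) F)) (X : Set (Subsp F ν)) (n : ℕ) : Prop :=
  X.Nonempty ∧ (∀ P ∈ X, orbit H P = X) ∧
    ∀ P ∈ X, (orbitsOn (stab H P) X).Finite ∧ (orbitsOn (stab H P) X).ncard = n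

/-! The dual polar graph and its last subconstituent -/

/-- `P` is totally isotropic: `u S vᵀ = 0` for all `u, v ∈ P`. -/
def IsTotallyIsotropic {ν : ℕ} (z : F) (P : Subsp F ν) : Prop :=
  ∀ u ∈ P, ∀ v ∈ P, u ⬝ᵥ (gramS ν z *ᵥ v) = 0

/-- Vertices of the dual polar graph: the totally isotropic subspaces that are maximal with
respect to inclusion. -/
abbrev Vertex (ν : ℕ) (z : F) : Type _ :=
  {P : Subsp F ν // Maximal (IsTotallyIsotropic z) P}

/-- The orthogonal dual polar graph: `P` and `Q` are adjacent when `dim (P ∩ Q) = ν - 1`. -/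
def dualPolarGraph (ν : ℕ) (z : F) : SimpleGraph (Vertex ν z) where
  Adj P Q := P ≠ Q ∧ Module.finrank F ↥(P.1 ⊓ Q.1) + 1 = ν
  symm := ⟨fun P Q h => ⟨h.1.symm, by rw [inf_comm]; exact h.2⟩⟩
  loopless := ⟨fun _ h => h.1 rfl⟩

/-- The set of vertices at distance `ν` (the diameter) from the vertex `P`. -/
def lastSubconstituent (ν : ℕ) (z : F) (P : Subsp F ν) : Set (Subsp F ν) :=
  {Q | ∃ (hP : Maximal (IsTotallyIsotropic z) P) (hQ : Maximal (IsTotallyIsotropic z) Q),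
    (dualPolarGraph ν z).edist ⟨P, hP⟩ ⟨Q, hQ⟩ = (ν : ℕ∞)}

/-- The row space of a matrix with `ν` rows. -/
def rowSpace {ν : ℕ} (M : Matrix (Fin ν) (Idx ν) F) : Subsp F ν :=
  Submodule.span F (Set.range M.row)

/-- The subspace `P₀ = (I 0 0)`. -/
def P0 (F : Type*) [Field F] (ν : ℕ) : Subsp F ν := rowSpace (fromCols 1 0)

/-- The subspace `(A I Z)`. -/
def affineSub {ν : ℕ} (A : Matrix (Fin ν) (Fin ν) F) (Z : Matrix (Fin ν) (Fin 2) F) :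
    Subsp F ν :=
  rowSpace (fromCols A (fromCols 1 Z))

/-- The subspace `P₁ = (0 I 0)`. -/
def P1 (F : Type*) [Field F] (ν : ℕ) : Subsp F ν := affineSub 0 0

/-- The last subconstituent `Λ` with respect to `P₀`. -/
def Lam (ν : ℕ) (z : F) : Set (Subsp F ν) := lastSubconstituent ν z (P0 F ν)

/-- The stabilizer of `P₀` in the orthogonal group. -/
def G0 (ν : ℕ) (z : F) : Subgroup (GL (Idx ν) F) := stab (orthogonalGroup ν z) (P0 F ν)

/-- The stabilizer of `P₀` and `P₁` in the orthogonal group. -/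
def G01 (ν : ℕ) (z : F) : Subgroup (GL (Idx ν) F) := stab (G0 ν z) (P1 F ν)

/-! The representatives -/

/-- The `ν × ν` matrix that has the block `M` on its diagonal, starting in row and column `s`
(counted from `0`), and zeros elsewhere; sums of such matrices with consecutive blocks are the
block diagonal matrices. -/
def place (ν s : ℕ) {m : ℕ} (M : Matrix (Fin m) (Fin m) F) : Matrix (Fin ν) (Fin ν) F :=
  of fun i j =>
    if h : (s ≤ (i : ℕ) ∧ (i : ℕ) < s + m) ∧ (s ≤ (j : ℕ) ∧ (j : ℕ) < s + m) then
      M ⟨i - s, by omega⟩ ⟨j - s, by omega⟩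
    else 0

/-- The `2 r × 2 r` block diagonal matrix with `r` diagonal blocks `!![0, 1; -1, 0]`. -/
def altA (F : Type*) [Field F] (r : ℕ) : Matrix (Fin (2 * r)) (Fin (2 * r)) F :=
  of fun i j =>
    if (i : ℕ) % 2 = 0 ∧ (j : ℕ) = i + 1 then 1
    else if (j : ℕ) % 2 = 0 ∧ (i : ℕ) = j + 1 then -1
    else 0

/-- The `4 × 4` matrix with rows of blocks `(0 I)`, `(-I 0)`. -/
def matK (F : Type*) [Field F] : Matrix (Fin 4) (Fin 4) F :=
  !![0, 0, 1, 0; 0, 0, 0, 1; -1, 0, 0, 0; 0, -1, 0, 0]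

/-- The `3 × 3` matrix `Y`. -/
def matY (F : Type*) [Field F] : Matrix (Fin 3) (Fin 3) F :=
  !![0, 0, 1; 0, 0, 1; -1, -1, 0]

/-- The column vector `E_k` of length `ν`, with `k` counted from `1`. -/
def colE (F : Type*) [Field F] (ν k : ℕ) : Fin ν → F :=
  fun i => if (i : ℕ) + 1 = k then 1 else 0

/-- The `ν × 2` matrix with columns `x` and `y`. -/
def twoCols {ν : ℕ} (x y : Fin ν → F) : Matrix (Fin ν) (Fin 2) F :=
  of fun i => ![x i, y i]

/-- The `1 × 1` matrix `-2⁻¹ (1 - z a²)`. -/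
def cornerOne (z a : F) : Matrix (Fin 1) (Fin 1) F := !![-(2 : F)⁻¹ * (1 - z * a ^ 2)]

/-- The `2 × 2` matrix `-2⁻¹ Δ`. -/
def cornerTwo (z : F) : Matrix (Fin 2) (Fin 2) F := -(2 : F)⁻¹ • Delta z

/-- Names of the representatives. -/
inductive Label (F : Type*)
  | phi1 (r : ℕ)
  | phi2 (r : ℕ) (a : F)
  | phi3 (r : ℕ) (a : F)
  | phi4 (r : ℕ)
  | phi5 (r : ℕ)
  | phi6 (r : ℕ)
  | phi7 (r : ℕ) (b : F)
  | phi8 (r : ℕ)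

/-- The ranges of the parameters. -/
def Label.Valid (ν : ℕ) (Ω : Set F) : Label F → Prop
  | .phi1 r => 1 ≤ r ∧ r ≤ ν / 2
  | .phi2 r a => r ≤ (ν - 1) / 2 ∧ (a = 0 ∨ a = 1)
  | .phi3 r a => (1 ≤ r ∧ r ≤ ν / 2) ∧ (a = 0 ∨ a = 1)
  | .phi4 r => r ≤ (ν - 1) / 2
  | .phi5 r => 1 ≤ r ∧ r ≤ (ν - 1) / 2
  | .phi6 r => 1 ≤ r ∧ r ≤ (ν - 2) / 2
  | .phi7 r b => (1 ≤ r ∧ r ≤ ν / 2) ∧ b ∈ Ω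
  | .phi8 r => 2 ≤ r ∧ r ≤ ν / 2

/-- The representatives, as subspaces `(A I Z)`. -/
def phi (ν : ℕ) (z : F) : Label F → Subsp F ν
  | .phi1 r => affineSub (place ν 0 (altA F r)) 0
  | .phi2 r a =>
      affineSub (place ν 0 (cornerOne z a) + place ν 1 (altA F r))
        (twoCols (colE F ν 1) (a • colE F ν 1))
  | .phi3 r a =>
      affineSub (place ν 0 (altA F r) + place ν 0 (cornerOne z a))
        (twoCols (colE F ν 1) (a • colE F ν 1))
  | .phi4 r =>
      affineSub (place ν 1 (altA F r) + place ν 0 (cornerTwo z))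
        (twoCols (colE F ν 1) (colE F ν 2))
  | .phi5 r =>
      affineSub (place ν 0 (matY F) + place ν 3 (altA F (r - 1)) + place ν 0 (cornerTwo z))
        (twoCols (colE F ν 1) (colE F ν 2))
  | .phi6 r =>
      affineSub (place ν 0 (cornerTwo z) + place ν 2 (altA F r))
        (twoCols (colE F ν 1) (colE F ν 2))
  | .phi7 r b =>
      affineSub (place ν 0 (b • altA F 1 + cornerTwo z) + place ν 2 (altA F (r - 1)))
        (twoCols (colE F ν 1) (colE F ν 2))
  | .phi8 r =>
      affineSub (place ν 0 (matK F) + place ν 4 (altA F (r - 2)) + place ν 0 (cornerTwo z))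
        (twoCols (colE F ν 1) (colE F ν 2))

end OrthDualPolar

end

/-!
The form is written as `form ν z`. The plane `Delta z` is anisotropic because `z` is not a square,
so `P₀` is a maximal totally isotropic subspace, and by the exchange property
`exists_orthogonal_of_finrank_lt` every maximal one has dimension `ν`. The distance in the dual
polar graph is then `ν - dim (P ∩ Q)`, so the last subconstituent consists of the totally isotropic
subspaces of dimension `ν` that meet `P₀` trivially. These are the subspaces `(A I Z)` with
`A + Aᵀ + Z Δ Zᵀ = 0`, which correspond to the pairs `(K, Z)` with `K` skew-symmetric and `Z`
arbitrary (`skewSub`, `exists_eq_skewSub`).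

Elements of `G₀₁` are block diagonal, with blocks `X`, the inverse transpose of `X`, and an isometry
`W` of the plane. Hence the orbits are the classes of pairs under `(K, Z) ↦ (Xᵀ K X, Xᵀ Z W)`
(`PairEquiv`, `orbit_skewSub_eq_iff`), that is, the isomorphism classes of an alternating form `ω`
together with a linear map `ζ` to the plane, considered up to isometries of the plane.

For such a pair let `R` be the radical of `ω`. The isometries of the plane have exactly two
orbits on lines, told apart by whether the nonzero norms on the line are squares; here the
assumption on `1 - z` makes `(1, 0)` and `(1, ±1)` representatives (`exists_isometry_line`). If `ζ`
vanishes, only the rank of `ω` matters. If its image is a line, one also has to know whether `ζ`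
vanishes on `R`. If `ζ` is onto, then `ζ R` can be the plane, a line of either type, or zero. In the
last case the coordinates of `ζ` are `ω · v₁` and `ω · v₂`, and `ω v₁ v₂` is a further invariant up
to sign, the determinant of an isometry being `±1`. In each case `ζ` and `ω` are determined on at
most four explicit vectors, whose span has an orthogonal complement inside `ker ζ`
(`hasBasis_of_core`), and the normal form of alternating forms (`exists_alternating_basis`) finishes
the construction of a basis. So every pair is congruent to a representative
(`exists_label_pairEquiv`), and the invariants just listed separate the representatives
(`label_injective`).

The group `G₀` is transitive by an explicit unipotent isometry (`exists_mem_G0_mulRight_P1`), and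
conjugation reduces the rank to the number of orbits of `G₀₁`, which is one more than the number of
labels (`ncard_valid`).
-/

namespace OrthDualPolar

/-! ### Totally isotropic subspaces and distances -/

section Polar

variable {F : Type*} [Field F] {ν : ℕ} {z : F}

/-- The symmetric bilinear form with Gram matrix `gramS ν z`. -/
noncomputable def form (ν : ℕ) (z : F) : Vec F ν →ₗ[F] Vec F ν →ₗ[F] F :=
  Matrix.toLinearMap₂' F (gramS ν z)

theorem form_apply (u v : Vec F ν) : form ν z u v = u ⬝ᵥ (gramS ν z *ᵥ v) :=
  Matrix.toLinearMap₂'_apply' _ _ _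

theorem form_eq (u v : Vec F ν) : form ν z u v =
    (∑ i, u (.inl i) * v (.inr (.inl i))) + (∑ i, u (.inr (.inl i)) * v (.inl i)) +
      (u (.inr (.inr 0)) * v (.inr (.inr 0)) - z * (u (.inr (.inr 1)) * v (.inr (.inr 1)))) := by
  simp [form_apply, gramS, Delta, dotProduct, mulVec, Matrix.one_apply, Fin.sum_univ_two]
  ring

theorem form_comm (u v : Vec F ν) : form ν z u v = form ν z v u := by
  simp only [form_eq, mul_comm]
  ring

theorem isTotallyIsotropic_iff {P : Subsp F ν} :
    IsTotallyIsotropic z P ↔ ∀ u ∈ P, ∀ v ∈ P, form ν z u v = 0 := by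
  simp only [IsTotallyIsotropic, form_apply]

theorem mem_rowSpace {M : Matrix (Fin ν) (Idx ν) F} {v : Vec F ν} :
    v ∈ rowSpace M ↔ ∃ c, c ᵥ* M = v := by
  rw [rowSpace, ← range_vecMulLinear]
  simp

theorem mem_P0 {v : Vec F ν} : v ∈ P0 F ν ↔ ∀ i, v (.inr i) = 0 := by
  rw [P0, mem_rowSpace]
  constructor
  · rintro ⟨c, rfl⟩ i
    simp [vecMul_fromCols]
  · intro h
    refine ⟨fun i => v (.inl i), ?_⟩
    ext (i | i) <;> simp [vecMul_fromCols, h]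

theorem P0_isTotallyIsotropic : IsTotallyIsotropic z (P0 F ν) := by
  rw [isTotallyIsotropic_iff]
  intro u hu v hv
  rw [mem_P0] at hu hv
  simp [form_eq, hu, hv]

/-- The form `x² - z y²` is anisotropic, because `z` is not a square. -/
theorem eq_zero_of_sq_sub_mul_sq (hz : ¬ IsSquare z) {x y : F}
    (h : x * x - z * (y * y) = 0) : x = 0 ∧ y = 0 := by
  have hy : y = 0 := by
    by_contra hy
    exact hz ⟨x / y, by field_simp; linear_combination -h⟩
  subst hy
  simpa using h

/-- An isotropic vector orthogonal to `P₀` lies in `P₀`. -/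
theorem mem_P0_of_orthogonal (hz : ¬ IsSquare z) {w : Vec F ν} (hw : form ν z w w = 0)
    (h : ∀ u ∈ P0 F ν, form ν z u w = 0) : w ∈ P0 F ν := by
  have h1 : ∀ i, w (.inr (.inl i)) = 0 := by
    intro i
    have := h (Pi.single (.inl i) 1) (mem_P0.2 (by simp))
    simpa [form_eq, Pi.single_apply] using this
  rw [form_eq] at hw
  have h2 := eq_zero_of_sq_sub_mul_sq hz (by simpa [h1] using hw)
  rw [mem_P0]
  rintro (i | i)
  · exact h1 i
  · fin_cases i
    exacts [h2.1, h2.2]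

theorem finrank_P0 : Module.finrank F (P0 F ν) = ν := by
  have hL : LinearIndependent F
      (fromCols 1 0 : Matrix (Fin ν) (Idx ν) F).row := by
    rw [Fintype.linearIndependent_iff]
    intro c hc i
    have := congrFun hc (.inl i)
    simpa [Finset.sum_apply, Matrix.row, Matrix.one_apply] using this
  rw [P0, rowSpace, finrank_span_eq_card hL, Fintype.card_fin]

/-- Adding to a totally isotropic subspace an isotropic vector orthogonal to it. -/
theorem IsTotallyIsotropic.sup_span {P : Subsp F ν} (hP : IsTotallyIsotropic z P) {w : Vec F ν}
    (hw : form ν z w w = 0) (h : ∀ u ∈ P, form ν z u w = 0) :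
    IsTotallyIsotropic z (P ⊔ Submodule.span F {w}) := by
  rw [isTotallyIsotropic_iff] at hP ⊢
  intro u hu v hv
  obtain ⟨u', hu', _, hs, rfl⟩ := Submodule.mem_sup.1 hu
  obtain ⟨v', hv', _, ht, rfl⟩ := Submodule.mem_sup.1 hv
  obtain ⟨s, rfl⟩ := Submodule.mem_span_singleton.1 hs
  obtain ⟨t, rfl⟩ := Submodule.mem_span_singleton.1 ht
  simp [hP u' hu' v' hv', hw, h u' hu', form_comm w v', h v' hv']

/-- The exchange property: a totally isotropic subspace that is larger than `P` contains a vector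
outside `P` that is orthogonal to `P`. -/
theorem exists_orthogonal_of_finrank_lt {P Q : Subsp F ν} (hQ : IsTotallyIsotropic z Q)
    (hlt : Module.finrank F P < Module.finrank F Q) :
    ∃ w ∈ Q, w ∉ P ∧ ∀ u ∈ P, form ν z u w = 0 := by
  rw [isTotallyIsotropic_iff] at hQ
  obtain ⟨C, hC⟩ := exists_isCompl ((P ⊓ Q).comap P.subtype)
  -- the vectors of `Q` orthogonal to a complement `C` of `P ⊓ Q` in `P`
  let φ : Q →ₗ[F] Module.Dual F C :=
    (form ν z).compl₁₂ Q.subtype (P.subtype ∘ₗ C.subtype)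
  have hφ : ∀ (w : Q) (c : C), φ w c = form ν z w.1 c.1.1 := fun w c => rfl
  have h1 := LinearMap.finrank_range_add_finrank_ker φ
  have h2 : Module.finrank F (LinearMap.range φ) ≤ Module.finrank F C :=
    (Submodule.finrank_le _).trans_eq (Subspace.dual_finrank_eq (K := F) (V := C))
  have h3 := Submodule.finrank_add_eq_of_isCompl hC
  have h4 : Module.finrank F ((P ⊓ Q).comap P.subtype) = Module.finrank F ↥(P ⊓ Q) :=
    LinearEquiv.finrank_eq (Submodule.comapSubtypeEquivOfLe inf_le_left)
  have h5 := Submodule.finrank_map_subtype_eq Q (LinearMap.ker φ)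
  have h6 : ¬ (LinearMap.ker φ).map Q.subtype ≤ P ⊓ Q := by
    intro hle
    have := Submodule.finrank_mono hle
    omega
  obtain ⟨_, ⟨w, hw, rfl⟩, hwP⟩ := SetLike.not_le_iff_exists.1 h6
  have hwP : w.1 ∉ P := fun h => hwP ⟨h, w.2⟩
  refine ⟨w, w.2, hwP, fun u hu => ?_⟩
  have hu' : (⟨u, hu⟩ : P) ∈ (P ⊓ Q).comap P.subtype ⊔ C := by rw [hC.sup_eq_top]; trivial
  obtain ⟨a, ha, c, hc, hac⟩ := Submodule.mem_sup.1 hu'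
  have hu : u = a.1 + c.1 := congrArg Subtype.val hac.symm
  have hc0 : form ν z w.1 c.1 = 0 := by
    rw [← hφ w ⟨c, hc⟩, LinearMap.mem_ker.1 hw]
    rfl
  have ha0 : form ν z a.1 w.1 = 0 := hQ a.1 ha.2 _ w.2
  rw [hu, map_add, LinearMap.add_apply, ha0, form_comm, hc0, add_zero]

theorem lt_sup_span_singleton {P : Subsp F ν} {w : Vec F ν} (hw : w ∉ P) :
    P < P ⊔ Submodule.span F {w} :=
  lt_of_le_of_ne le_sup_left fun h =>
    hw (h ▸ Submodule.mem_sup_right (Submodule.mem_span_singleton_self w))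

theorem Maximal.finrank_ge {P Q : Subsp F ν} (hP : Maximal (IsTotallyIsotropic z) P)
    (hQ : IsTotallyIsotropic z Q) : Module.finrank F Q ≤ Module.finrank F P := by
  by_contra! hlt
  obtain ⟨w, hwQ, hwP, hw⟩ := exists_orthogonal_of_finrank_lt hQ hlt
  have hlt := lt_sup_span_singleton hwP
  exact hlt.not_ge (hP.2 (hP.1.sup_span (isTotallyIsotropic_iff.1 hQ w hwQ w hwQ) hw) hlt.le)

theorem P0_maximal (hz : ¬ IsSquare z) : Maximal (IsTotallyIsotropic z) (P0 F ν) := by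
  refine ⟨P0_isTotallyIsotropic, fun Q hQ hle w hw => ?_⟩
  rw [isTotallyIsotropic_iff] at hQ
  exact mem_P0_of_orthogonal hz (hQ w hw w hw) fun u hu => hQ u (hle hu) w hw

/-- The maximal totally isotropic subspaces are the totally isotropic subspaces of dimension
`ν`. -/
theorem maximal_iff (hz : ¬ IsSquare z) {P : Subsp F ν} :
    Maximal (IsTotallyIsotropic z) P ↔ IsTotallyIsotropic z P ∧ Module.finrank F P = ν := by
  have h0 := P0_maximal (ν := ν) hz
  constructor
  · intro h
    refine ⟨h.1, le_antisymm ?_ ?_⟩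
    · exact (Maximal.finrank_ge h0 h.1).trans_eq finrank_P0
    · exact finrank_P0.symm.trans_le (Maximal.finrank_ge h h0.1)
  · rintro ⟨h, hd⟩
    refine ⟨h, fun Q hQ hle => ?_⟩
    refine (Submodule.eq_of_le_of_finrank_le hle ?_).ge
    rw [hd]
    exact (Maximal.finrank_ge h0 hQ).trans_eq finrank_P0

theorem finrank_le_inf_ker_add_one {V : Type*} [AddCommGroup V] [Module F V]
    [FiniteDimensional F V] (P : Submodule F V) (f : Module.Dual F V) :
    Module.finrank F P ≤ Module.finrank F ↥(P ⊓ LinearMap.ker f) + 1 := by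
  have h1 := LinearMap.finrank_range_add_finrank_ker (f.domRestrict P)
  have h2 : Module.finrank F (LinearMap.range (f.domRestrict P)) ≤ 1 :=
    (Submodule.finrank_le _).trans_eq (Module.finrank_self F)
  have h3 := Submodule.finrank_map_subtype_eq P (LinearMap.ker (f.domRestrict P))
  have h4 : (LinearMap.ker (f.domRestrict P)).map P.subtype ≤ P ⊓ LinearMap.ker f := by
    rintro _ ⟨w, hw, rfl⟩
    exact ⟨w.2, hw⟩
  have := Submodule.finrank_mono h4
  omega

/-- A vertex `P ≠ Q` has a neighbour that meets `Q` in a larger subspace than `P` does. -/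
theorem exists_adj_finrank_inf_lt (hz : ¬ IsSquare z) (P Q : Vertex ν z) (hne : P ≠ Q) :
    ∃ P' : Vertex ν z, (dualPolarGraph ν z).Adj P P' ∧
      Module.finrank F ↥(P.1 ⊓ Q.1) < Module.finrank F ↥(P'.1 ⊓ Q.1) := by
  obtain ⟨P, hP⟩ := P
  obtain ⟨Q, hQ⟩ := Q
  have hP' := (maximal_iff hz).1 hP
  have hQ' := isTotallyIsotropic_iff.1 hQ.1
  have hnle : ¬ Q ≤ P := fun h => hne (Subtype.ext (le_antisymm (hQ.2 hP.1 h) h))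
  obtain ⟨w, hwQ, hwP⟩ := SetLike.not_le_iff_exists.1 hnle
  -- the neighbour is spanned by `w` and the vectors of `P` orthogonal to `w`
  set H := P ⊓ LinearMap.ker (form ν z w) with hH
  set R := H ⊔ Submodule.span F {w} with hR
  have hwR : w ∈ R := Submodule.mem_sup_right (Submodule.mem_span_singleton_self w)
  have hHiso : IsTotallyIsotropic z H := fun u hu v hv => hP.1 u hu.1 v hv.1
  have hRiso : IsTotallyIsotropic z R :=
    hHiso.sup_span (hQ' w hwQ w hwQ) fun u hu => (form_comm u w).trans hu.2
  have h1 : ν ≤ Module.finrank F H + 1 :=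
    hP'.2.symm.trans_le (finrank_le_inf_ker_add_one P (form ν z w))
  have h2 : Module.finrank F H < Module.finrank F R :=
    Submodule.finrank_lt_finrank_of_lt (lt_sup_span_singleton fun h => hwP h.1)
  have h3 : Module.finrank F R ≤ Module.finrank F P := Maximal.finrank_ge hP hRiso
  have hRmax : Maximal (IsTotallyIsotropic z) R := (maximal_iff hz).2 ⟨hRiso, by omega⟩
  have hPR : P ≠ R := fun h => hwP (h ▸ hwR)
  have h4 : Module.finrank F H ≤ Module.finrank F ↥(P ⊓ R) :=
    Submodule.finrank_mono (le_inf inf_le_left le_sup_left)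
  have h5 : Module.finrank F ↥(P ⊓ R) < Module.finrank F P := by
    refine Submodule.finrank_lt_finrank_of_lt (lt_of_le_of_ne inf_le_left fun h => hPR ?_)
    exact le_antisymm (inf_eq_left.1 h) (hP.2 hRiso (inf_eq_left.1 h))
  refine ⟨⟨R, hRmax⟩, ⟨fun h => hPR (congrArg Subtype.val h), ?_⟩, ?_⟩
  · change Module.finrank F ↥(P ⊓ R) + 1 = ν
    omega
  · refine Submodule.finrank_lt_finrank_of_lt (lt_of_le_of_ne ?_ fun h => ?_)
    · intro u hu
      exact ⟨Submodule.mem_sup_left ⟨hu.1, hQ' w hwQ u hu.2⟩, hu.2⟩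
    · have : w ∈ R ⊓ Q := ⟨hwR, hwQ⟩
      change P ⊓ Q = R ⊓ Q at h
      rw [← h] at this
      exact hwP this.1

theorem edist_le (hz : ¬ IsSquare z) (Q : Vertex ν z) (n : ℕ) : ∀ P : Vertex ν z,
    ν ≤ Module.finrank F ↥(P.1 ⊓ Q.1) + n → (dualPolarGraph ν z).edist P Q ≤ n := by
  induction n with
  | zero =>
    intro P h
    have hPQ : P = Q := by
      by_contra hne
      obtain ⟨P', -, hlt⟩ := exists_adj_finrank_inf_lt hz P Q hne
      have h1 := Submodule.finrank_mono (inf_le_left : P'.1 ⊓ Q.1 ≤ P'.1)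
      rw [((maximal_iff hz).1 P'.2).2] at h1
      omega
    simp [hPQ]
  | succ n ih =>
    intro P h
    by_cases hne : P = Q
    · simp [hne]
    obtain ⟨P', hadj, hlt⟩ := exists_adj_finrank_inf_lt hz P Q hne
    have h1 := ih P' (by omega)
    have h2 : (dualPolarGraph ν z).edist P P' = 1 := SimpleGraph.edist_eq_one_iff_adj.2 hadj
    calc (dualPolarGraph ν z).edist P Q
        ≤ (dualPolarGraph ν z).edist P P' + (dualPolarGraph ν z).edist P' Q :=
          SimpleGraph.edist_triangle
      _ ≤ 1 + n := by rw [h2]; gcongr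
      _ = (n + 1 : ℕ) := by push_cast; exact add_comm _ _

theorem le_finrank_inf_add_length (hz : ¬ IsSquare z) {P Q : Vertex ν z}
    (p : (dualPolarGraph ν z).Walk P Q) :
    ν ≤ Module.finrank F ↥(P.1 ⊓ Q.1) + p.length := by
  induction p with
  | @nil P => rw [inf_idem, ((maximal_iff hz).1 P.2).2, SimpleGraph.Walk.length_nil]; rfl
  | @cons P R Q hadj p ih =>
    have h1 := Submodule.finrank_sup_add_finrank_inf_eq (R.1 ⊓ Q.1) (P.1 ⊓ R.1)
    have h2 : Module.finrank F ↥((R.1 ⊓ Q.1) ⊔ (P.1 ⊓ R.1)) ≤ Module.finrank F R.1 :=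
      Submodule.finrank_mono (sup_le inf_le_left inf_le_right)
    have h3 : Module.finrank F ↥((R.1 ⊓ Q.1) ⊓ (P.1 ⊓ R.1)) ≤
        Module.finrank F ↥(P.1 ⊓ Q.1) :=
      Submodule.finrank_mono fun u hu => ⟨hu.2.1, hu.1.2⟩
    have h4 := ((maximal_iff hz).1 R.2).2
    have h5 := hadj.2
    simp only [SimpleGraph.Walk.length_cons]
    omega

theorem edist_eq_iff (hz : ¬ IsSquare z) (hν : ν ≠ 0) (P Q : Vertex ν z) :
    (dualPolarGraph ν z).edist P Q = ν ↔ P.1 ⊓ Q.1 = ⊥ := by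
  rw [← Submodule.finrank_eq_zero (R := F)]
  constructor
  · intro h
    by_contra h0
    have h1 := edist_le hz Q (ν - 1) P (by omega)
    rw [h, Nat.cast_le] at h1
    omega
  · intro h
    refine le_antisymm (edist_le hz Q ν P (by omega)) (le_iInf fun p => ?_)
    have := le_finrank_inf_add_length hz p
    exact_mod_cast (by omega : ν ≤ p.length)

theorem mem_Lam_iff (hz : ¬ IsSquare z) (hν : ν ≠ 0) {Q : Subsp F ν} :
    Q ∈ Lam ν z ↔
      IsTotallyIsotropic z Q ∧ Module.finrank F Q = ν ∧ P0 F ν ⊓ Q = ⊥ := by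
  rw [← and_assoc, ← maximal_iff hz]
  constructor
  · rintro ⟨hP, hQ, h⟩
    exact ⟨hQ, (edist_eq_iff hz hν _ _).1 h⟩
  · rintro ⟨hQ, h⟩
    exact ⟨P0_maximal hz, hQ, (edist_eq_iff hz hν ⟨_, P0_maximal hz⟩ ⟨_, hQ⟩).2 h⟩

end Polar

/-! ### Matrix coordinates on the last subconstituent -/

section Coordinates

variable {F : Type*} [Field F] {ν : ℕ} {z : F}

theorem mem_affineSub {A : Matrix (Fin ν) (Fin ν) F} {Z : Matrix (Fin ν) (Fin 2) F}
    {v : Vec F ν} : v ∈ affineSub A Z ↔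
      (fun i => v (.inl i)) = (fun i => v (.inr (.inl i))) ᵥ* A ∧
      (fun i => v (.inr (.inr i))) = (fun i => v (.inr (.inl i))) ᵥ* Z := by
  rw [affineSub, mem_rowSpace]
  constructor
  · rintro ⟨c, rfl⟩
    simp [vecMul_fromCols]
  · rintro ⟨h1, h2⟩
    refine ⟨fun i => v (.inr (.inl i)), ?_⟩
    rw [vecMul_fromCols, vecMul_fromCols, ← h1, ← h2, vecMul_one]
    ext (i | i | i) <;> rfl

/-- The vector of `affineSub A Z` with the middle block `c`. -/
def affineVec (A : Matrix (Fin ν) (Fin ν) F) (Z : Matrix (Fin ν) (Fin 2) F) (c : Fin ν → F) :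
    Vec F ν :=
  Sum.elim (c ᵥ* A) (Sum.elim c (c ᵥ* Z))

theorem affineVec_mem (A : Matrix (Fin ν) (Fin ν) F) (Z : Matrix (Fin ν) (Fin 2) F)
    (c : Fin ν → F) : affineVec A Z c ∈ affineSub A Z := by
  rw [mem_affineSub]
  exact ⟨rfl, rfl⟩

theorem affineSub_injective {A A' : Matrix (Fin ν) (Fin ν) F} {Z Z' : Matrix (Fin ν) (Fin 2) F}
    (h : affineSub A Z = affineSub A' Z') : A = A' ∧ Z = Z' := by
  have key : ∀ c, c ᵥ* A = c ᵥ* A' ∧ c ᵥ* Z = c ᵥ* Z' := fun c =>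
    mem_affineSub.1 (h ▸ affineVec_mem A Z c)
  constructor
  · ext i j
    simpa using congrFun (key (Pi.single i 1)).1 j
  · ext i j
    simpa using congrFun (key (Pi.single i 1)).2 j

theorem form_affineVec (A : Matrix (Fin ν) (Fin ν) F) (Z : Matrix (Fin ν) (Fin 2) F)
    (c d : Fin ν → F) : form ν z (affineVec A Z c) (affineVec A Z d) =
      c ⬝ᵥ ((A + Aᵀ + Z * Delta z * Zᵀ) *ᵥ d) := by
  have h1 : form ν z (affineVec A Z c) (affineVec A Z d) =
      (c ᵥ* A) ⬝ᵥ d + c ⬝ᵥ (d ᵥ* A) + (c ᵥ* Z) ⬝ᵥ (Delta z *ᵥ (d ᵥ* Z)) := by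
    rw [form_eq]
    simp [affineVec, dotProduct, Delta, mulVec, Fin.sum_univ_two]
    ring
  rw [h1, add_mulVec, add_mulVec, dotProduct_add, dotProduct_add, ← dotProduct_mulVec,
    mulVec_transpose, ← mulVec_transpose Z d, ← dotProduct_mulVec]
  simp [Matrix.mulVec_mulVec, Matrix.mul_assoc]

theorem eq_affineVec {A : Matrix (Fin ν) (Fin ν) F} {Z : Matrix (Fin ν) (Fin 2) F}
    {v : Vec F ν} (hv : v ∈ affineSub A Z) :
    v = affineVec A Z fun i => v (.inr (.inl i)) := by
  rw [mem_affineSub] at hv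
  rw [affineVec, ← hv.1, ← hv.2]
  ext (i | i | i) <;> rfl

theorem affineSub_isTotallyIsotropic_iff {A : Matrix (Fin ν) (Fin ν) F}
    {Z : Matrix (Fin ν) (Fin 2) F} :
    IsTotallyIsotropic z (affineSub A Z) ↔ A + Aᵀ + Z * Delta z * Zᵀ = 0 := by
  rw [isTotallyIsotropic_iff]
  constructor
  · intro h
    ext i j
    have := h _ (affineVec_mem A Z (Pi.single i 1)) _ (affineVec_mem A Z (Pi.single j 1))
    rw [form_affineVec] at this
    simpa using this
  · intro h u hu v hv
    rw [eq_affineVec hu, eq_affineVec hv, form_affineVec, h]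
    simp

/-- The projection to the middle block. -/
def midProj (F : Type*) [Field F] (ν : ℕ) : Vec F ν →ₗ[F] (Fin ν → F) :=
  LinearMap.funLeft F F (fun i => Sum.inr (Sum.inl i))

theorem finrank_affineSub (A : Matrix (Fin ν) (Fin ν) F) (Z : Matrix (Fin ν) (Fin 2) F) :
    Module.finrank F (affineSub A Z) = ν := by
  have e : Function.Bijective ((midProj F ν).domRestrict (affineSub A Z)) := by
    constructor
    · rintro ⟨u, hu⟩ ⟨v, hv⟩ huv
      have huv : (fun i => u (.inr (.inl i))) = fun i => v (.inr (.inl i)) := huv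
      apply Subtype.ext
      change u = v
      rw [eq_affineVec hu, eq_affineVec hv, huv]
    · intro c
      exact ⟨⟨_, affineVec_mem A Z c⟩, rfl⟩
  simpa using (LinearEquiv.ofBijective _ e).finrank_eq

theorem P0_inf_affineSub (A : Matrix (Fin ν) (Fin ν) F) (Z : Matrix (Fin ν) (Fin 2) F) :
    P0 F ν ⊓ affineSub A Z = ⊥ := by
  rw [eq_bot_iff]
  rintro v ⟨hv0, hv⟩
  have h0 := mem_P0.1 hv0
  rw [eq_affineVec hv]
  have : (fun i => v (.inr (.inl i))) = 0 := funext fun i => h0 _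
  rw [this, Submodule.mem_bot]
  ext (i | i | i) <;> simp [affineVec]

theorem exists_eq_affineSub (hz : ¬ IsSquare z) {Q : Subsp F ν} (hQ : IsTotallyIsotropic z Q)
    (hd : Module.finrank F Q = ν) (h0 : P0 F ν ⊓ Q = ⊥) : ∃ A Z, Q = affineSub A Z := by
  rw [isTotallyIsotropic_iff] at hQ
  have hinj : Function.Injective ((midProj F ν).domRestrict Q) := by
    rw [← LinearMap.ker_eq_bot, eq_bot_iff]
    rintro ⟨v, hv⟩ hv0
    have hv0 : ∀ i, v (.inr (.inl i)) = 0 := fun i => congrFun hv0 i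
    have h1 : v ∈ P0 F ν := by
      refine mem_P0_of_orthogonal hz (hQ v hv v hv) fun u hu => ?_
      rw [mem_P0] at hu
      simp [form_eq, hu, hv0]
    have h2 : v ∈ P0 F ν ⊓ Q := ⟨h1, hv⟩
    rw [h0, Submodule.mem_bot] at h2
    exact Submodule.mem_bot F |>.2 (Subtype.ext h2)
  have hsurj : Function.Surjective ((midProj F ν).domRestrict Q) :=
    (LinearMap.injective_iff_surjective_of_finrank_eq_finrank (by simp [hd])).1 hinj
  let e := LinearEquiv.ofBijective _ ⟨hinj, hsurj⟩
  have he : ∀ q : Q, e q = fun i => q.1 (.inr (.inl i)) := fun q => rfl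
  -- the rows of the matrix are the vectors of `Q` over the unit vectors
  let M : (Fin ν → F) →ₗ[F] Vec F ν := Q.subtype ∘ₗ e.symm.toLinearMap
  refine ⟨of fun i j => M (Pi.single i 1) (.inl j),
    of fun i j => M (Pi.single i 1) (.inr (.inr j)), ?_⟩
  refine Submodule.eq_of_le_of_finrank_eq ?_ (by rw [hd, finrank_affineSub])
  intro v hv
  set c : Fin ν → F := fun i => v (.inr (.inl i)) with hc
  have h1 : M c = v := by
    have : e.symm c = ⟨v, hv⟩ := by rw [LinearEquiv.symm_apply_eq, he]
    exact congrArg Subtype.val this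
  have h2 : v = ∑ i, c i • M (Pi.single i 1) := by
    rw [← h1]
    conv_lhs => rw [pi_eq_sum_univ' c, map_sum]
    simp only [map_smul]
  rw [mem_affineSub]
  constructor
  · ext j
    conv_lhs => rw [h2]
    simp [vecMul, dotProduct, hc]
  · ext j
    conv_lhs => rw [h2]
    simp [vecMul, dotProduct, hc]

theorem mem_Lam_iff_exists (hz : ¬ IsSquare z) (hν : ν ≠ 0) {Q : Subsp F ν} :
    Q ∈ Lam ν z ↔ ∃ A Z, A + Aᵀ + Z * Delta z * Zᵀ = 0 ∧ Q = affineSub A Z := by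
  rw [mem_Lam_iff hz hν]
  constructor
  · rintro ⟨h1, h2, h3⟩
    obtain ⟨A, Z, rfl⟩ := exists_eq_affineSub hz h1 h2 h3
    exact ⟨A, Z, affineSub_isTotallyIsotropic_iff.1 h1, rfl⟩
  · rintro ⟨A, Z, h, rfl⟩
    exact ⟨affineSub_isTotallyIsotropic_iff.2 h, finrank_affineSub A Z, P0_inf_affineSub A Z⟩

/-- The member of the last subconstituent given by a skew-symmetric matrix `K` and an arbitrary
matrix `Z`; the symmetric part of the first block is determined by `Z`. -/
def skewSub (z : F) (K : Matrix (Fin ν) (Fin ν) F) (Z : Matrix (Fin ν) (Fin 2) F) : Subsp F ν :=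
  affineSub (K + -(2 : F)⁻¹ • (Z * Delta z * Zᵀ)) Z

theorem Delta_transpose (z : F) : (Delta z)ᵀ = Delta z := by
  ext i j
  fin_cases i <;> fin_cases j <;> rfl

theorem gram_transpose (Z : Matrix (Fin ν) (Fin 2) F) :
    (Z * Delta z * Zᵀ)ᵀ = Z * Delta z * Zᵀ := by
  simp [transpose_mul, Delta_transpose, Matrix.mul_assoc]

theorem skewSub_mem_Lam (h2 : (2 : F) ≠ 0) (hz : ¬ IsSquare z) (hν : ν ≠ 0)
    {K : Matrix (Fin ν) (Fin ν) F} (hK : Kᵀ = -K) (Z : Matrix (Fin ν) (Fin 2) F) :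
    skewSub z K Z ∈ Lam ν z := by
  refine (mem_Lam_iff_exists hz hν).2 ⟨_, Z, ?_, rfl⟩
  rw [transpose_add, transpose_smul, gram_transpose, hK]
  ext i j
  simp only [Matrix.add_apply, Matrix.smul_apply, Matrix.neg_apply, Matrix.zero_apply, smul_eq_mul]
  field_simp
  ring

theorem exists_eq_skewSub (h2 : (2 : F) ≠ 0) (hz : ¬ IsSquare z) (hν : ν ≠ 0) {Q : Subsp F ν}
    (hQ : Q ∈ Lam ν z) : ∃ K Z, Kᵀ = -K ∧ Q = skewSub z K Z := by
  obtain ⟨A, Z, h, rfl⟩ := (mem_Lam_iff_exists hz hν).1 hQ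
  refine ⟨A + (2 : F)⁻¹ • (Z * Delta z * Zᵀ), Z, ?_, ?_⟩
  · rw [transpose_add, transpose_smul, gram_transpose]
    ext i j
    have := Matrix.ext_iff.2 h i j
    simp only [Matrix.add_apply, Matrix.smul_apply, Matrix.neg_apply, Matrix.zero_apply,
      smul_eq_mul] at this ⊢
    field_simp
    linear_combination 2 * this
  · simp [skewSub]

/-- Congruence of pairs `(K, Z)` under a base change of `F ^ ν` and an isometry of the plane with
Gram matrix `Delta z`. -/
def PairEquiv (z : F) (K : Matrix (Fin ν) (Fin ν) F) (Z : Matrix (Fin ν) (Fin 2) F)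
    (K' : Matrix (Fin ν) (Fin ν) F) (Z' : Matrix (Fin ν) (Fin 2) F) : Prop :=
  ∃ X Y : Matrix (Fin ν) (Fin ν) F, ∃ W : Matrix (Fin 2) (Fin 2) F,
    X * Y = 1 ∧ W * Delta z * Wᵀ = Delta z ∧ K' = Xᵀ * K * X ∧ Z' = Xᵀ * Z * W

theorem gram_congr {X : Matrix (Fin ν) (Fin ν) F} {W : Matrix (Fin 2) (Fin 2) F}
    (hW : W * Delta z * Wᵀ = Delta z) (Z : Matrix (Fin ν) (Fin 2) F) :
    (Xᵀ * Z * W) * Delta z * (Xᵀ * Z * W)ᵀ = Xᵀ * (Z * Delta z * Zᵀ) * X := by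
  calc (Xᵀ * Z * W) * Delta z * (Xᵀ * Z * W)ᵀ
      = Xᵀ * Z * (W * Delta z * Wᵀ) * Zᵀ * X := by
        simp [transpose_mul, Matrix.mul_assoc]
    _ = _ := by rw [hW]; simp [Matrix.mul_assoc]

end Coordinates

/-! ### The groups acting on the last subconstituent -/

section Group

variable {F : Type*} [Field F] {ν : ℕ} {z : F}

theorem form_eq_dotProduct (u v : Vec F ν) : form ν z u v =
    (fun i => u (.inl i)) ⬝ᵥ (fun i => v (.inr (.inl i))) +
    (fun i => u (.inr (.inl i))) ⬝ᵥ (fun i => v (.inl i)) +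
    (fun i => u (.inr (.inr i))) ⬝ᵥ (Delta z *ᵥ fun i => v (.inr (.inr i))) := by
  rw [form_eq]
  simp [dotProduct, mulVec, Delta, Fin.sum_univ_two]
  ring

theorem form_vecMul (M : Matrix (Idx ν) (Idx ν) F) (u v : Vec F ν) :
    form ν z (u ᵥ* M) (v ᵥ* M) = u ⬝ᵥ ((M * gramS ν z * Mᵀ) *ᵥ v) := by
  rw [form_apply, ← mulVec_transpose M v, ← dotProduct_mulVec]
  simp [Matrix.mulVec_mulVec, Matrix.mul_assoc]

theorem isometry_iff (M : Matrix (Idx ν) (Idx ν) F) :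
    M * gramS ν z * Mᵀ = gramS ν z ↔
      ∀ u v : Vec F ν, form ν z (u ᵥ* M) (v ᵥ* M) = form ν z u v := by
  constructor
  · intro h u v
    rw [form_vecMul, h, form_apply]
  · intro h
    ext i j
    have := h (Pi.single i 1) (Pi.single j 1)
    rw [form_vecMul, form_apply] at this
    simpa using this

theorem form_of_mem {T : GL (Idx ν) F} (hT : T ∈ orthogonalGroup ν z) (u v : Vec F ν) :
    form ν z (u ᵥ* T.val) (v ᵥ* T.val) = form ν z u v :=
  (isometry_iff T.val).1 hT u v

theorem Delta_mul_Delta_inv (h0 : z ≠ 0) : Delta z * Delta z⁻¹ = 1 := by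
  simp [Delta, h0, Matrix.one_fin_two]

theorem gramS_mul_gramS_inv (h0 : z ≠ 0) : gramS ν z * gramS ν z⁻¹ = 1 := by
  simp [gramS, fromBlocks_multiply, Delta_mul_Delta_inv h0, fromCols_mul_fromRows,
    fromCols_mul_fromBlocks, fromBlocks_mul_fromRows]
  ext (i | i | i) (j | j | j) <;> simp [Matrix.one_apply]

/-- A matrix that preserves the form is invertible. -/
theorem exists_mem_orthogonalGroup (h0 : z ≠ 0) {M : Matrix (Idx ν) (Idx ν) F}
    (hM : ∀ u v : Vec F ν, form ν z (u ᵥ* M) (v ᵥ* M) = form ν z u v) :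
    ∃ T ∈ orthogonalGroup ν z, T.val = M := by
  have h := (isometry_iff M).2 hM
  have h1 : M * (gramS ν z * Mᵀ * gramS ν z⁻¹) = 1 := by
    rw [← gramS_mul_gramS_inv (ν := ν) h0]
    conv_rhs => rw [← h]
    simp only [Matrix.mul_assoc]
  exact ⟨⟨M, _, h1, mul_eq_one_comm.1 h1⟩, h, rfl⟩

theorem mem_mulRight {P : Subsp F ν} {T : GL (Idx ν) F} {v : Vec F ν} :
    v ∈ mulRight P T ↔ ∃ u ∈ P, u ᵥ* T.val = v := by
  simp [mulRight]

theorem vecMul_injective_of_unit (T : GL (Idx ν) F) :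
    Function.Injective fun v : Vec F ν => v ᵥ* T.val := fun u v h => by
  have := congrArg (fun w => w ᵥ* T⁻¹.val) h
  simpa [vecMul_vecMul] using this

theorem finrank_mulRight (P : Subsp F ν) (T : GL (Idx ν) F) :
    Module.finrank F (mulRight P T) = Module.finrank F P :=
  (Submodule.equivMapOfInjective _ (vecMul_injective_of_unit T) P).finrank_eq.symm

theorem mulRight_inf (P Q : Subsp F ν) (T : GL (Idx ν) F) :
    mulRight (P ⊓ Q) T = mulRight P T ⊓ mulRight Q T :=
  Submodule.map_inf _ (vecMul_injective_of_unit T)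

theorem mulRight_mem_Lam (hz : ¬ IsSquare z) (hν : ν ≠ 0) {T : GL (Idx ν) F} (hT : T ∈ G0 ν z)
    {P : Subsp F ν} (hP : P ∈ Lam ν z) : mulRight P T ∈ Lam ν z := by
  rw [mem_Lam_iff hz hν, isTotallyIsotropic_iff] at hP ⊢
  refine ⟨?_, (finrank_mulRight P T).trans hP.2.1, ?_⟩
  · intro u hu v hv
    obtain ⟨u', hu', rfl⟩ := mem_mulRight.1 hu
    obtain ⟨v', hv', rfl⟩ := mem_mulRight.1 hv
    rw [form_of_mem hT.1, hP.1 u' hu' v' hv']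
  · rw [← hT.2, ← mulRight_inf, hP.2.2]
    simp [mulRight]

theorem mulRight_eq_affineSub {P : Subsp F ν} (hP : Module.finrank F P = ν) {T : GL (Idx ν) F}
    {A : Matrix (Fin ν) (Fin ν) F} {Z : Matrix (Fin ν) (Fin 2) F}
    (h : ∀ v ∈ P, v ᵥ* T.val ∈ affineSub A Z) : mulRight P T = affineSub A Z := by
  refine Submodule.eq_of_le_of_finrank_eq ?_ ?_
  · intro v hv
    obtain ⟨u, hu, rfl⟩ := mem_mulRight.1 hv
    exact h u hu
  · rw [finrank_mulRight, hP, finrank_affineSub]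

theorem mulRight_P0_eq {T : GL (Idx ν) F} (h : ∀ v ∈ P0 F ν, v ᵥ* T.val ∈ P0 F ν) :
    mulRight (P0 F ν) T = P0 F ν := by
  refine Submodule.eq_of_le_of_finrank_eq ?_ (finrank_mulRight _ _)
  intro v hv
  obtain ⟨u, hu, rfl⟩ := mem_mulRight.1 hv
  exact h u hu

theorem mem_P1 {v : Vec F ν} :
    v ∈ P1 F ν ↔ (∀ i, v (.inl i) = 0) ∧ ∀ i, v (.inr (.inr i)) = 0 := by
  rw [P1, mem_affineSub]
  simp [funext_iff]

theorem P1_mem_Lam (hz : ¬ IsSquare z) (hν : ν ≠ 0) : P1 F ν ∈ Lam ν z :=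
  (mem_Lam_iff_exists hz hν).2 ⟨0, 0, by simp, rfl⟩

/-- Transitivity of `G₀`: the isometry with rows of blocks `(I 0 0)`, `(A I Z)`, `(-Δ Zᵀ 0 I)`
moves `P₁` to `(A I Z)`. -/
theorem exists_mem_G0_mulRight_P1 (hz : ¬ IsSquare z) (hν : ν ≠ 0) {Q : Subsp F ν}
    (hQ : Q ∈ Lam ν z) : ∃ T ∈ G0 ν z, mulRight (P1 F ν) T = Q := by
  have h0 : z ≠ 0 := fun h => hz (h ▸ IsSquare.zero)
  obtain ⟨A, Z, h, rfl⟩ := (mem_Lam_iff_exists hz hν).1 hQ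
  set M : Matrix (Idx ν) (Idx ν) F := fromBlocks 1 0 (fromRows A (-(Delta z * Zᵀ)))
    (fromBlocks 1 Z 0 1) with hM
  have h1 : ∀ v : Vec F ν, (fun i => (v ᵥ* M) (.inl i)) = (fun i => v (.inl i)) +
      (fun i => v (.inr (.inl i))) ᵥ* A - (fun i => v (.inr (.inr i))) ᵥ* (Delta z * Zᵀ) := by
    intro v
    ext i
    simp [hM, vecMul, dotProduct, Matrix.one_apply, Finset.sum_neg_distrib]
    ring
  have h2 : ∀ v : Vec F ν, (fun i => (v ᵥ* M) (.inr (.inl i))) =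
      (fun i => v (.inr (.inl i))) := by
    intro v
    ext i
    simp [hM, vecMul, dotProduct, Matrix.one_apply]
  have h3 : ∀ v : Vec F ν, (fun i => (v ᵥ* M) (.inr (.inr i))) =
      (fun i => v (.inr (.inl i))) ᵥ* Z + (fun i => v (.inr (.inr i))) := by
    intro v
    ext i
    simp [hM, vecMul, dotProduct, Matrix.one_apply]
  obtain ⟨T, hT, hTM⟩ := exists_mem_orthogonalGroup (z := z) h0 (M := M) (by
    intro u v
    rw [form_eq_dotProduct, form_eq_dotProduct, h1, h1, h2, h2, h3, h3]
    generalize (fun i => u (.inl i)) = u1, (fun i => u (.inr (.inl i))) = u2,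
      (fun i => u (.inr (.inr i))) = u3, (fun i => v (.inl i)) = v1,
      (fun i => v (.inr (.inl i))) = v2, (fun i => v (.inr (.inr i))) = v3
    have e : u2 ⬝ᵥ ((A + Aᵀ + Z * Delta z * Zᵀ) *ᵥ v2) = 0 := by rw [h]; simp
    have e1 : u2 ᵥ* A ⬝ᵥ v2 = u2 ⬝ᵥ (A *ᵥ v2) := (dotProduct_mulVec _ _ _).symm
    have e2 : u3 ᵥ* (Delta z * Zᵀ) ⬝ᵥ v2 = u3 ⬝ᵥ (Delta z *ᵥ (v2 ᵥ* Z)) := by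
      rw [← dotProduct_mulVec, ← mulVec_transpose Z, Matrix.mulVec_mulVec]
    have e3 : v3 ᵥ* (Delta z * Zᵀ) = Z *ᵥ (Delta z *ᵥ v3) := by
      rw [← mulVec_transpose, Matrix.mulVec_mulVec]
      simp [transpose_mul, Delta_transpose]
    have e4 : u2 ᵥ* Z ⬝ᵥ (Delta z *ᵥ v3) = u2 ⬝ᵥ (Z *ᵥ (Delta z *ᵥ v3)) :=
      (dotProduct_mulVec _ _ _).symm
    have e5 : u2 ᵥ* Z ⬝ᵥ (Delta z *ᵥ (v2 ᵥ* Z)) = u2 ⬝ᵥ ((Z * Delta z * Zᵀ) *ᵥ v2) := by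
      rw [← mulVec_transpose Z v2, ← dotProduct_mulVec]
      simp [Matrix.mulVec_mulVec, Matrix.mul_assoc]
    have e6 : v2 ᵥ* A = Aᵀ *ᵥ v2 := (mulVec_transpose _ _).symm
    rw [add_mulVec, add_mulVec, dotProduct_add, dotProduct_add] at e
    simp only [add_dotProduct, sub_dotProduct, dotProduct_add, dotProduct_sub, mulVec_add,
      e1, e2, e3, e4, e5, e6]
    linear_combination e)
  refine ⟨T, ⟨hT, mulRight_P0_eq fun v hv => ?_⟩, ?_⟩
  · rw [hTM, mem_P0] at *
    have hv2 : (fun i => v (.inr (.inl i))) = 0 := funext fun i => hv _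
    have hv3 : (fun i => v (.inr (.inr i))) = 0 := funext fun i => hv _
    rintro (i | i)
    · exact (congrFun (h2 v) i).trans (hv _)
    · exact (congrFun (h3 v) i).trans (by rw [hv2, hv3]; simp)
  · refine mulRight_eq_affineSub (finrank_affineSub 0 0) fun v hv => ?_
    change v ∈ P1 F ν at hv
    rw [mem_P1] at hv
    have hv1 : (fun i => v (.inl i)) = 0 := funext fun i => hv.1 _
    have hv3 : (fun i => v (.inr (.inr i))) = 0 := funext fun i => hv.2 _
    rw [hTM, mem_affineSub, h1, h2, h3, hv1, hv3]
    simp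

theorem mulRight_inv_cancel (P : Subsp F ν) (T : GL (Idx ν) F) :
    mulRight (mulRight P T) T⁻¹ = P := by
  rw [← mulRight_mul, mul_inv_cancel, mulRight_one]

theorem mulRight_injective (T : GL (Idx ν) F) :
    Function.Injective fun P : Subsp F ν => mulRight P T := fun P Q h => by
  rw [← mulRight_inv_cancel P T, ← mulRight_inv_cancel Q T]
  exact congrArg (fun R => mulRight R T⁻¹) h

theorem orbit_G0_eq (hz : ¬ IsSquare z) (hν : ν ≠ 0) {P : Subsp F ν} (hP : P ∈ Lam ν z) :
    orbit (G0 ν z) P = Lam ν z := by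
  ext Q
  constructor
  · rintro ⟨T, hT, rfl⟩
    exact mulRight_mem_Lam hz hν hT hP
  · intro hQ
    obtain ⟨T, hT, hTP⟩ := exists_mem_G0_mulRight_P1 hz hν hP
    obtain ⟨U, hU, rfl⟩ := exists_mem_G0_mulRight_P1 hz hν hQ
    refine ⟨T⁻¹ * U, (G0 ν z).mul_mem ((G0 ν z).inv_mem hT) hU, ?_⟩
    rw [mulRight_mul, ← hTP, mulRight_inv_cancel]

theorem self_mem_orbit (H : Subgroup (GL (Idx ν) F)) (P : Subsp F ν) : P ∈ orbit H P :=
  ⟨1, H.one_mem, mulRight_one P⟩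

theorem orbit_eq_iff {H : Subgroup (GL (Idx ν) F)} {P Q : Subsp F ν} :
    orbit H P = orbit H Q ↔ Q ∈ orbit H P := by
  constructor
  · intro h
    rw [h]
    exact self_mem_orbit H Q
  · rintro ⟨T, hT, rfl⟩
    ext R
    constructor
    · rintro ⟨U, hU, rfl⟩
      exact ⟨T⁻¹ * U, H.mul_mem (H.inv_mem hT) hU, by rw [mulRight_mul, mulRight_inv_cancel]⟩
    · rintro ⟨U, hU, rfl⟩
      exact ⟨T * U, H.mul_mem hT hU, mulRight_mul _ _ _⟩

/-- Stabilizers of points in one orbit are conjugate, and conjugation carries orbits to orbits. -/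
theorem orbit_stab_mulRight {H : Subgroup (GL (Idx ν) F)} {T : GL (Idx ν) F} (hT : T ∈ H)
    (P Q : Subsp F ν) :
    orbit (stab H (mulRight P T)) (mulRight Q T) =
      (fun R => mulRight R T) '' orbit (stab H P) Q := by
  ext R
  constructor
  · rintro ⟨U, ⟨hU, hUP⟩, rfl⟩
    refine ⟨mulRight Q (T * U * T⁻¹), ⟨_, ⟨?_, ?_⟩, rfl⟩, ?_⟩
    · exact H.mul_mem (H.mul_mem hT hU) (H.inv_mem hT)
    · rw [mulRight_mul, mulRight_mul, hUP, mulRight_inv_cancel]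
    · simp only [← mulRight_mul, inv_mul_cancel_right]
  · rintro ⟨_, ⟨U, ⟨hU, hUP⟩, rfl⟩, rfl⟩
    refine ⟨T⁻¹ * U * T, ⟨?_, ?_⟩, ?_⟩
    · exact H.mul_mem (H.mul_mem (H.inv_mem hT) hU) hT
    · rw [mulRight_mul, mulRight_mul, mulRight_inv_cancel, hUP]
    · simp only [← mulRight_mul]
      congr 1
      group

/-- The number of orbits of a point stabilizer can be computed for the point `P₁`. -/
theorem hasRank_G0 (hz : ¬ IsSquare z) (hν : ν ≠ 0) {n : ℕ}
    (hfin : (orbitsOn (G01 ν z) (Lam ν z)).Finite)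
    (hn : (orbitsOn (G01 ν z) (Lam ν z)).ncard = n) : HasRank (G0 ν z) (Lam ν z) n := by
  refine ⟨⟨_, P1_mem_Lam hz hν⟩, fun P hP => orbit_G0_eq hz hν hP, fun P hP => ?_⟩
  obtain ⟨T, hT, rfl⟩ := exists_mem_G0_mulRight_P1 hz hν hP
  have h : orbitsOn (stab (G0 ν z) (mulRight (P1 F ν) T)) (Lam ν z) =
      (Set.image fun R => mulRight R T) '' orbitsOn (G01 ν z) (Lam ν z) := by
    have hL : Lam ν z = (fun R => mulRight R T) '' Lam ν z := by
      ext Q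
      constructor
      · intro hQ
        refine ⟨mulRight Q T⁻¹, mulRight_mem_Lam hz hν ((G0 ν z).inv_mem hT) hQ, ?_⟩
        simp only [← mulRight_mul, inv_mul_cancel, mulRight_one]
      · rintro ⟨Q, hQ, rfl⟩
        exact mulRight_mem_Lam hz hν hT hQ
    conv_lhs => rw [hL]
    simp only [orbitsOn, Set.image_image]
    exact Set.image_congr fun Q _ => orbit_stab_mulRight hT _ _
  rw [h]
  exact ⟨hfin.image _,
    (Set.ncard_image_of_injective _ (mulRight_injective T).image_injective).trans hn⟩

/-- Elements of `G₀₁` are block diagonal. -/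
theorem exists_blocks_of_mem_G01 {T : GL (Idx ν) F} (hT : T ∈ G01 ν z) :
    ∃ X Y : Matrix (Fin ν) (Fin ν) F, ∃ W : Matrix (Fin 2) (Fin 2) F,
      X * Y = 1 ∧ W * Delta z * Wᵀ = Delta z ∧
      T.val = fromBlocks X 0 0 (fromBlocks Yᵀ 0 0 W) := by
  obtain ⟨⟨hO, h0⟩, h1⟩ := hT
  have hrow0 : ∀ i j, T.val (.inl i) (.inr j) = 0 := by
    intro i j
    have : Pi.single (.inl i) 1 ᵥ* T.val ∈ P0 F ν := by
      rw [← h0]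
      exact mem_mulRight.2 ⟨_, mem_P0.2 (by simp), rfl⟩
    simpa using mem_P0.1 this j
  have hrow1 : (∀ i j, T.val (.inr (.inl i)) (.inl j) = 0) ∧
      ∀ i j, T.val (.inr (.inl i)) (.inr (.inr j)) = 0 := by
    have : ∀ i, Pi.single (.inr (.inl i)) 1 ᵥ* T.val ∈ P1 F ν := by
      intro i
      rw [← h1]
      exact mem_mulRight.2 ⟨_, mem_P1.2 (by simp), rfl⟩
    exact ⟨fun i j => by simpa using (mem_P1.1 (this i)).1 j,
      fun i j => by simpa using (mem_P1.1 (this i)).2 j⟩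
  have hform : ∀ a b, form ν z (fun k => T.val a k) (fun k => T.val b k) =
      form ν z (Pi.single a 1) (Pi.single b 1) := by
    intro a b
    rw [← form_of_mem hO (Pi.single a 1), single_one_vecMul, single_one_vecMul]
    rfl
  set X : Matrix (Fin ν) (Fin ν) F := of fun i j => T.val (.inl i) (.inl j) with hX
  set Y : Matrix (Fin ν) (Fin ν) F := of fun i j => T.val (.inr (.inl j)) (.inr (.inl i)) with hY
  set W : Matrix (Fin 2) (Fin 2) F := of fun i j => T.val (.inr (.inr i)) (.inr (.inr j)) with hW
  set C : Matrix (Fin 2) (Fin ν) F := of fun i j => T.val (.inr (.inr i)) (.inl j) with hC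
  set D : Matrix (Fin ν) (Fin 2) F := of fun i j => T.val (.inr (.inr j)) (.inr (.inl i)) with hD
  have hXY : X * Y = 1 := by
    ext i j
    have := hform (.inl i) (.inr (.inl j))
    rw [form_eq, form_eq] at this
    simpa [hrow0, hrow1, Pi.single_apply, Matrix.mul_apply, hX, hY, Matrix.one_apply,
      eq_comm] using this
  have hYX : Y * X = 1 := mul_eq_one_comm.1 hXY
  have hXD : X * D = 0 := by
    ext i j
    have := hform (.inl i) (.inr (.inr j))
    rw [form_eq, form_eq] at this
    simpa [hrow0, hrow1, Pi.single_apply, Matrix.mul_apply, hX, hD] using this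
  have hCY : C * Y = 0 := by
    ext i j
    have := hform (.inr (.inr i)) (.inr (.inl j))
    rw [form_eq, form_eq] at this
    simpa [hrow0, hrow1, Pi.single_apply, Matrix.mul_apply, hC, hY] using this
  have hD0 : D = 0 := by rw [← Matrix.one_mul D, ← hYX, Matrix.mul_assoc, hXD, Matrix.mul_zero]
  have hC0 : C = 0 := by rw [← Matrix.mul_one C, ← hYX, ← Matrix.mul_assoc, hCY, Matrix.zero_mul]
  have hC0' : ∀ i j, T.val (.inr (.inr i)) (.inl j) = 0 := fun i j => Matrix.ext_iff.2 hC0 i j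
  have hD0' : ∀ i j, T.val (.inr (.inr j)) (.inr (.inl i)) = 0 :=
    fun i j => Matrix.ext_iff.2 hD0 i j
  refine ⟨X, Y, W, hXY, ?_, ?_⟩
  · ext i j
    have := hform (.inr (.inr i)) (.inr (.inr j))
    rw [form_eq, form_eq] at this
    simp only [hC0', hD0', mul_zero, Finset.sum_const_zero, zero_add] at this
    have h5 : (W * Delta z * Wᵀ) i j = W i 0 * W j 0 - z * (W i 1 * W j 1) := by
      simp [Matrix.mul_apply, Delta, Fin.sum_univ_two]
      ring
    rw [h5, hW]
    refine this.trans ?_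
    fin_cases i <;> fin_cases j <;> simp [Delta]
  · ext (i | i | i) (j | j | j) <;> simp [hrow0, hrow1, hC0', hD0', hX, hY, hW]

theorem vecMul_blocks (X Y : Matrix (Fin ν) (Fin ν) F) (W : Matrix (Fin 2) (Fin 2) F)
    (v : Vec F ν) : v ᵥ* fromBlocks X 0 0 (fromBlocks Yᵀ 0 0 W) =
      Sum.elim ((fun i => v (.inl i)) ᵥ* X) (Sum.elim ((fun i => v (.inr (.inl i))) ᵥ* Yᵀ)
        ((fun i => v (.inr (.inr i))) ᵥ* W)) := by
  ext (i | i | i) <;> simp [vecMul, dotProduct]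

theorem exists_mem_G01 (h0 : z ≠ 0) {X Y : Matrix (Fin ν) (Fin ν) F}
    {W : Matrix (Fin 2) (Fin 2) F} (hXY : X * Y = 1) (hW : W * Delta z * Wᵀ = Delta z) :
    ∃ T ∈ G01 ν z, T.val = fromBlocks X 0 0 (fromBlocks Yᵀ 0 0 W) := by
  obtain ⟨T, hT, hTM⟩ := exists_mem_orthogonalGroup (z := z) h0
    (M := fromBlocks X 0 0 (fromBlocks Yᵀ 0 0 W)) (by
      intro u v
      rw [vecMul_blocks, vecMul_blocks, form_eq_dotProduct, form_eq_dotProduct]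
      simp only [Sum.elim_inl, Sum.elim_inr]
      generalize (fun i => u (.inl i)) = u1, (fun i => u (.inr (.inl i))) = u2,
        (fun i => u (.inr (.inr i))) = u3, (fun i => v (.inl i)) = v1,
        (fun i => v (.inr (.inl i))) = v2, (fun i => v (.inr (.inr i))) = v3
      have e1 : u1 ᵥ* X ⬝ᵥ v2 ᵥ* Yᵀ = u1 ⬝ᵥ v2 := by
        rw [vecMul_transpose, ← dotProduct_mulVec, Matrix.mulVec_mulVec, hXY, one_mulVec]
      have e2 : u2 ᵥ* Yᵀ ⬝ᵥ v1 ᵥ* X = u2 ⬝ᵥ v1 := by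
        rw [← mulVec_transpose X, ← dotProduct_mulVec, Matrix.mulVec_mulVec, ← transpose_mul, hXY,
          transpose_one, one_mulVec]
      have e3 : u3 ᵥ* W ⬝ᵥ (Delta z *ᵥ (v3 ᵥ* W)) = u3 ⬝ᵥ (Delta z *ᵥ v3) := by
        rw [← mulVec_transpose W v3, ← dotProduct_mulVec]
        simp only [Matrix.mulVec_mulVec, ← Matrix.mul_assoc, hW]
      change u1 ᵥ* X ⬝ᵥ v2 ᵥ* Yᵀ + u2 ᵥ* Yᵀ ⬝ᵥ v1 ᵥ* X +
        u3 ᵥ* W ⬝ᵥ (Delta z *ᵥ (v3 ᵥ* W)) = _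
      rw [e1, e2, e3])
  refine ⟨T, ⟨⟨hT, mulRight_P0_eq fun v hv => ?_⟩, ?_⟩, hTM⟩
  · rw [mem_P0] at *
    rw [hTM, vecMul_blocks]
    rintro (i | i) <;> simp [vecMul, dotProduct, hv]
  · refine mulRight_eq_affineSub (finrank_affineSub 0 0) fun v hv => ?_
    change v ∈ P1 F ν at hv
    change _ ∈ P1 F ν
    rw [mem_P1] at *
    rw [hTM, vecMul_blocks]
    constructor <;> intro i <;> simp [vecMul, dotProduct, hv]

theorem mulRight_skewSub {X Y : Matrix (Fin ν) (Fin ν) F} {W : Matrix (Fin 2) (Fin 2) F}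
    (hXY : X * Y = 1) (hW : W * Delta z * Wᵀ = Delta z) {T : GL (Idx ν) F}
    (hT : T.val = fromBlocks X 0 0 (fromBlocks Yᵀ 0 0 W))
    (K : Matrix (Fin ν) (Fin ν) F) (Z : Matrix (Fin ν) (Fin 2) F) :
    mulRight (skewSub z K Z) T = skewSub z (Xᵀ * K * X) (Xᵀ * Z * W) := by
  have hA : Xᵀ * K * X + -(2 : F)⁻¹ • ((Xᵀ * Z * W) * Delta z * (Xᵀ * Z * W)ᵀ) =
      Xᵀ * (K + -(2 : F)⁻¹ • (Z * Delta z * Zᵀ)) * X := by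
    rw [gram_congr hW]
    simp [Matrix.mul_add, Matrix.add_mul]
  have hYX : Yᵀ * Xᵀ = 1 := by rw [← transpose_mul, hXY, transpose_one]
  rw [skewSub, skewSub, hA]
  refine mulRight_eq_affineSub (finrank_affineSub _ _) fun v hv => ?_
  rw [mem_affineSub] at hv ⊢
  rw [hT, vecMul_blocks]
  simp only [Sum.elim_inl, Sum.elim_inr]
  change (_ ᵥ* X = (_ ᵥ* Yᵀ) ᵥ* _) ∧ (_ ᵥ* W = (_ ᵥ* Yᵀ) ᵥ* _)
  rw [hv.1, hv.2]
  simp [vecMul_vecMul, ← Matrix.mul_assoc, hYX]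

/-- Orbits of `G₀₁` in the last subconstituent are congruence classes of pairs. -/
theorem orbit_skewSub_eq_iff (h0 : z ≠ 0) (K K' : Matrix (Fin ν) (Fin ν) F)
    (Z Z' : Matrix (Fin ν) (Fin 2) F) :
    orbit (G01 ν z) (skewSub z K Z) = orbit (G01 ν z) (skewSub z K' Z') ↔
      PairEquiv z K Z K' Z' := by
  rw [orbit_eq_iff]
  constructor
  · rintro ⟨T, hT, hTK⟩
    obtain ⟨X, Y, W, hXY, hW, hTb⟩ := exists_blocks_of_mem_G01 hT
    rw [mulRight_skewSub hXY hW hTb] at hTK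
    obtain ⟨hA, hZ⟩ := affineSub_injective hTK
    refine ⟨X, Y, W, hXY, hW, ?_, hZ.symm⟩
    rw [hZ] at hA
    exact (add_right_cancel hA).symm
  · rintro ⟨X, Y, W, hXY, hW, rfl, rfl⟩
    obtain ⟨T, hT, hTb⟩ := exists_mem_G01 h0 hXY hW
    exact ⟨T, hT, mulRight_skewSub hXY hW hTb K Z⟩

end Group

/-! ### Block diagonal matrices -/

section Place

variable {F : Type*} [Field F]

theorem place_apply_of_lt {n s m : ℕ} (M : Matrix (Fin m) (Fin m) F) {i j : Fin n} {a b : Fin m}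
    (hi : (i : ℕ) = s + a) (hj : (j : ℕ) = s + b) : place n s M i j = M a b := by
  have ha := a.2
  have hb := b.2
  rw [place, of_apply, dif_pos (by omega)]
  congr 1 <;> exact Fin.ext (by simp; omega)

theorem place_apply_of_not {n s m : ℕ} (M : Matrix (Fin m) (Fin m) F) {i j : Fin n}
    (h : ¬ ((s ≤ (i : ℕ) ∧ (i : ℕ) < s + m) ∧ (s ≤ (j : ℕ) ∧ (j : ℕ) < s + m))) :
    place n s M i j = 0 := by
  rw [place, of_apply, dif_neg h]

theorem place_add {n s m : ℕ} (M N : Matrix (Fin m) (Fin m) F) :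
    place n s (M + N) = place n s M + place n s N := by
  ext i j
  simp only [place, of_apply, Matrix.add_apply]
  split_ifs <;> simp

theorem place_transpose {n s m : ℕ} (M : Matrix (Fin m) (Fin m) F) :
    (place n s M)ᵀ = place n s Mᵀ := by
  ext i j
  simp only [place, of_apply, Matrix.transpose_apply]
  split_ifs <;> first | rfl | omega

theorem place_neg {n s m : ℕ} (M : Matrix (Fin m) (Fin m) F) :
    place n s (-M) = -place n s M := by
  ext i j
  simp only [place, of_apply, Matrix.neg_apply]
  split_ifs <;> simp

@[simp] theorem place_zero {n s m : ℕ} : place n s (0 : Matrix (Fin m) (Fin m) F) = 0 := by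
  ext i j
  simp [place]

/-- The entries of `altA`, in terms of positions. -/
def altEntry (F : Type*) [Field F] (i j : ℕ) : F :=
  if i % 2 = 0 ∧ j = i + 1 then 1 else if j % 2 = 0 ∧ i = j + 1 then -1 else 0

theorem place_altA_apply {n s r : ℕ} (i j : Fin n) : place n s (altA F r) i j =
    if (s ≤ (i : ℕ) ∧ (i : ℕ) < s + 2 * r) ∧ (s ≤ (j : ℕ) ∧ (j : ℕ) < s + 2 * r) then
      altEntry F (i - s) (j - s) else 0 := by
  simp only [place, altA, altEntry, of_apply]
  split_ifs <;> rfl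

theorem altA_transpose (r : ℕ) : (altA F r)ᵀ = -altA F r := by
  ext i j
  simp only [altA, Matrix.transpose_apply, Matrix.neg_apply, of_apply]
  split_ifs <;> first | omega | simp

/-- Splitting off the first hyperbolic plane. -/
theorem place_altA_succ (n s r : ℕ) : place n s (altA F (r + 1)) =
    place n s (altA F 1) + place n (s + 2) (altA F r) := by
  ext i j
  simp only [Matrix.add_apply, place_altA_apply, altEntry]
  split_ifs <;> first | omega | simp

end Place

/-! ### Normal forms of an alternating form with a linear map to the plane -/

section NormalForm

variable {F : Type*} [Field F] {V : Type*} [AddCommGroup V] [Module F V]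

theorem alternating_neg {ω : V →ₗ[F] V →ₗ[F] F} (hω : ∀ v, ω v v = 0) (u v : V) :
    ω v u = -ω u v := by
  have := hω (u + v)
  simp only [map_add, LinearMap.add_apply, hω, zero_add, add_zero] at this
  exact eq_neg_of_add_eq_zero_left this

/-- If `g` maps the vectors `c` to the unit vectors, then they span a complement of its kernel. -/
theorem exists_glue [FiniteDimensional F V] {n k m : ℕ} (hkm : n = k + m) (c : Fin k → V)
    (g : V →ₗ[F] (Fin k → F)) (hg : ∀ i, g (c i) = Pi.single i 1) (y : Fin m → V)
    (hy : LinearMap.ker g ≤ Submodule.span F (Set.range y)) :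
    ∃ x : Fin n → V, Submodule.span F (Set.range x) = ⊤ ∧
      (∀ (i : Fin n) (a : Fin k), (i : ℕ) = a → x i = c a) ∧
      (∀ (i : Fin n) (a : Fin m), (i : ℕ) = k + a → x i = y a) := by
  subst hkm
  refine ⟨Fin.append c y, ?_, ?_, ?_⟩
  · rw [eq_top_iff]
    intro v _
    have h1 : v - ∑ i, g v i • c i ∈ LinearMap.ker g := by
      rw [LinearMap.mem_ker, map_sub, map_sum, sub_eq_zero]
      conv_lhs => rw [pi_eq_sum_univ' (g v)]
      simp [hg]
    have h2 : v = (v - ∑ i, g v i • c i) + ∑ i, g v i • c i := by abel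
    rw [h2]
    refine Submodule.add_mem _ (Submodule.span_mono ?_ (hy h1))
      (Submodule.sum_mem _ fun i _ => Submodule.smul_mem _ _ (Submodule.subset_span ?_))
    · rintro _ ⟨a, rfl⟩
      exact ⟨Fin.natAdd k a, Fin.append_right _ _ _⟩
    · exact ⟨Fin.castAdd m i, Fin.append_left _ _ _⟩
  · intro i a h
    rw [show i = Fin.castAdd m a from Fin.ext h, Fin.append_left]
  · intro i a h
    rw [show i = Fin.natAdd k a from Fin.ext h, Fin.append_right]

theorem finrank_ker_of_dual_basis [FiniteDimensional F V] {k : ℕ} (c : Fin k → V)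
    (g : V →ₗ[F] (Fin k → F)) (hg : ∀ i, g (c i) = Pi.single i 1) :
    Module.finrank F V = k + Module.finrank F (LinearMap.ker g) := by
  have hs : LinearMap.range g = ⊤ := by
    rw [LinearMap.range_eq_top]
    intro w
    refine ⟨∑ i, w i • c i, ?_⟩
    conv_rhs => rw [pi_eq_sum_univ' w]
    simp [hg]
  have := LinearMap.finrank_range_add_finrank_ker g
  rw [hs, finrank_top, Module.finrank_fin_fun] at this
  exact this.symm

/-- Normal form of alternating forms: hyperbolic planes followed by the radical. -/
theorem exists_alternating_basis (n : ℕ) : ∀ (V : Type*) [AddCommGroup V] [Module F V]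
    [FiniteDimensional F V] (ω : V →ₗ[F] V →ₗ[F] F), (∀ v, ω v v = 0) →
    Module.finrank F V = n → ∃ s, 2 * s ≤ n ∧ ∃ x : Fin n → V,
      Submodule.span F (Set.range x) = ⊤ ∧ ∀ i j, ω (x i) (x j) = place n 0 (altA F s) i j := by
  induction n using Nat.strong_induction_on with
  | _ n ih =>
  intro V _ _ _ ω hω hn
  have hneg : ∀ u v, ω v u = -ω u v := alternating_neg hω
  by_cases h0 : ∀ u v, ω u v = 0
  · let b := Module.finBasisOfFinrankEq F V hn
    refine ⟨0, Nat.zero_le _, b, b.span_eq, fun i j => ?_⟩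
    rw [h0, place_altA_apply, if_neg (by omega)]
  · push Not at h0
    obtain ⟨e, f', hef'⟩ := h0
    obtain ⟨f, hef⟩ : ∃ f, ω e f = 1 := ⟨(ω e f')⁻¹ • f', by simp [hef']⟩
    have hfe : ω f e = -1 := by rw [hneg, hef]
    let c : Fin 2 → V := ![e, f]
    let g : V →ₗ[F] (Fin 2 → F) := LinearMap.pi ![-ω f, ω e]
    have hg : ∀ i, g (c i) = Pi.single i 1 := by
      intro i
      ext j
      fin_cases i <;> fin_cases j <;> simp [g, c, hef, hfe, hω]
    have hker : ∀ v ∈ LinearMap.ker g, ω e v = 0 ∧ ω f v = 0 := by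
      intro v hv
      have h1 := congrFun (LinearMap.mem_ker.1 hv) 0
      have h2 := congrFun (LinearMap.mem_ker.1 hv) 1
      simp [g] at h1 h2
      exact ⟨h2, h1⟩
    have hd := finrank_ker_of_dual_basis c g hg
    obtain ⟨s, hs, y, hy, hyω⟩ := ih (n - 2) (by omega) (LinearMap.ker g)
      (ω.compl₁₂ (LinearMap.ker g).subtype (LinearMap.ker g).subtype) (fun v => hω v) (by omega)
    have hyω : ∀ i j, ω (y i) (y j) = place (n - 2) 0 (altA F s) i j := hyω
    obtain ⟨x, hx, hx1, hx2⟩ := exists_glue (n := n) (m := n - 2) (by omega) c g hg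
      (fun i => (y i : V)) (by
        have := congrArg (Submodule.map (LinearMap.ker g).subtype) hy
        rw [Submodule.map_span, Submodule.map_top, Submodule.range_subtype, ← Set.range_comp]
          at this
        exact this.ge)
    refine ⟨s + 1, by omega, x, hx, fun i j => ?_⟩
    have hcase : ∀ i : Fin n, ((i : ℕ) = 0 ∧ x i = e) ∨ ((i : ℕ) = 1 ∧ x i = f) ∨
        ∃ a : Fin (n - 2), (i : ℕ) = 2 + a ∧ x i = y a := by
      intro i
      rcases Nat.lt_or_ge i 2 with h | h
      · have : (i : ℕ) = 0 ∨ (i : ℕ) = 1 := by omega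
        rcases this with h | h
        · exact Or.inl ⟨h, hx1 i 0 h⟩
        · exact Or.inr (Or.inl ⟨h, hx1 i 1 h⟩)
      · refine Or.inr (Or.inr ⟨⟨i - 2, by omega⟩, by simp; omega, hx2 _ _ (by simp; omega)⟩)
    have hneg' : ∀ a, ω (y a) e = 0 ∧ ω (y a) f = 0 := fun a => by
      rw [hneg, hneg f]
      simpa using hker _ (y a).2
    rw [place_altA_apply]
    rcases hcase i with ⟨hi, hi'⟩ | ⟨hi, hi'⟩ | ⟨a, hi, hi'⟩ <;>
    rcases hcase j with ⟨hj, hj'⟩ | ⟨hj, hj'⟩ | ⟨b, hj, hj'⟩ <;>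
    rw [hi', hj', hi, hj]
    · simp [hω, altEntry]
    · simp [hef, altEntry]; omega
    · simp [hker, altEntry]; omega
    · simp [hfe, altEntry]; omega
    · simp [hω, altEntry]
    · simp [hker, altEntry]
    · simp [hneg', altEntry]; omega
    · simp [hneg', altEntry]
    · rw [hyω, place_altA_apply]
      simp only [altEntry]
      split_ifs <;> first | omega | rfl

/-- In a suitable basis the bilinear form `ω` has Gram matrix `K` and the linear map `ζ` has the
rows of `Z` as values. -/
def HasBasis (ω : V →ₗ[F] V →ₗ[F] F) (ζ : V →ₗ[F] (Fin 2 → F)) {n : ℕ}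
    (K : Matrix (Fin n) (Fin n) F) (Z : Matrix (Fin n) (Fin 2) F) : Prop :=
  ∃ x : Fin n → V, Submodule.span F (Set.range x) = ⊤ ∧ (∀ i j, ω (x i) (x j) = K i j) ∧
    ∀ i j, ζ (x i) j = Z i j

variable {ω : V →ₗ[F] V →ₗ[F] F} {ζ : V →ₗ[F] (Fin 2 → F)} {n : ℕ}

theorem twoCols_apply_zero {F : Type*} (x y : Fin n → F) (i : Fin n) : twoCols x y i 0 = x i := rfl
theorem twoCols_apply_one {F : Type*} (x y : Fin n → F) (i : Fin n) : twoCols x y i 1 = y i := rfl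

theorem apply_twoCols {k : ℕ} (hk : 2 ≤ k) (c : Fin k → V)
    (h0 : ζ (c ⟨0, by omega⟩) = ![1, 0]) (h1 : ζ (c ⟨1, by omega⟩) = ![0, 1])
    (h2 : ∀ a : Fin k, 2 ≤ (a : ℕ) → ζ (c a) = 0) (i : Fin n) (j : Fin 2) :
    twoCols (colE F n 1) (colE F n 2) i j =
      if h : (i : ℕ) < k then ζ (c ⟨i, h⟩) j else 0 := by
  obtain ⟨i, hi⟩ := i
  rcases i with _ | _ | i
  · rw [dif_pos (by simp; omega), h0]
    fin_cases j <;> simp [twoCols_apply_zero, twoCols_apply_one, colE]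
  · rw [dif_pos (by simp; omega)]
    simp only [zero_add, h1]
    fin_cases j <;> simp [twoCols_apply_zero, twoCols_apply_one, colE]
  · have : twoCols (colE F n 1) (colE F n 2) ⟨i + 1 + 1, hi⟩ j = 0 := by
      fin_cases j <;> simp [twoCols_apply_zero, twoCols_apply_one, colE]
    rw [this]
    split_ifs with h
    · rw [h2 _ (by simp)]
      rfl
    · rfl

theorem eq_zero_of_apply {v : V} (h0 : ζ v 0 = 0) (h1 : ζ v 1 = 0) : ζ v = 0 := by
  ext j
  fin_cases j
  exacts [h0, h1]

variable [FiniteDimensional F V]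

/-- If finitely many vectors `c` span an orthogonal complement of a subspace `ker g` on which `ζ`
vanishes, then only `c` matters for the normal form, besides the rank. -/
theorem hasBasis_of_core (hω : ∀ v, ω v v = 0) {k : ℕ} (c : Fin k → V)
    (g : V →ₗ[F] (Fin k → F)) (hg : ∀ i, g (c i) = Pi.single i 1)
    (hζ : ∀ v, g v = 0 → ζ v = 0) (hc : ∀ v, g v = 0 → ∀ i, ω (c i) v = 0)
    (hn : Module.finrank F V = n) (M : Matrix (Fin k) (Fin k) F)
    (hM : ∀ a b, ω (c a) (c b) = M a b) (Z : Matrix (Fin n) (Fin 2) F)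
    (hZ : ∀ i j, Z i j = if h : (i : ℕ) < k then ζ (c ⟨i, h⟩) j else 0) :
    ∃ s, k + 2 * s ≤ n ∧ HasBasis ω ζ (place n 0 M + place n k (altA F s)) Z := by
  have hd := finrank_ker_of_dual_basis c g hg
  obtain ⟨s, hs, y, hy, hyω⟩ := exists_alternating_basis (n - k) (LinearMap.ker g)
    (ω.compl₁₂ (LinearMap.ker g).subtype (LinearMap.ker g).subtype) (fun v => hω v) (by omega)
  have hyω : ∀ i j, ω (y i) (y j) = place (n - k) 0 (altA F s) i j := hyω
  obtain ⟨x, hx, hx1, hx2⟩ := exists_glue (n := n) (m := n - k) (by omega) c g hg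
    (fun i => (y i : V)) (by
      have := congrArg (Submodule.map (LinearMap.ker g).subtype) hy
      rw [Submodule.map_span, Submodule.map_top, Submodule.range_subtype, ← Set.range_comp]
        at this
      exact this.ge)
  have hcase : ∀ i : Fin n, (∃ a : Fin k, (i : ℕ) = a ∧ x i = c a) ∨
      ∃ a : Fin (n - k), (i : ℕ) = k + a ∧ x i = y a := by
    intro i
    rcases Nat.lt_or_ge i k with h | h
    · exact Or.inl ⟨⟨i, h⟩, rfl, hx1 _ _ rfl⟩
    · exact Or.inr ⟨⟨i - k, by omega⟩, by simp; omega, hx2 _ _ (by simp; omega)⟩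
  have hyg : ∀ a, g (y a) = 0 := fun a => (y a).2
  refine ⟨s, by omega, x, hx, fun i j => ?_, fun i j => ?_⟩
  · rw [Matrix.add_apply]
    rcases hcase i with ⟨a, hi, hi'⟩ | ⟨a, hi, hi'⟩ <;>
    rcases hcase j with ⟨b, hj, hj'⟩ | ⟨b, hj, hj'⟩ <;>
    rw [hi', hj']
    · rw [place_apply_of_lt M (a := a) (b := b) (by omega) (by omega), hM,
        place_apply_of_not _ (by omega), add_zero]
    · rw [place_apply_of_not _ (by omega), place_apply_of_not _ (by omega), hc _ (hyg b), add_zero]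
    · rw [place_apply_of_not _ (by omega), place_apply_of_not _ (by omega),
        alternating_neg hω, hc _ (hyg a), add_zero, neg_zero]
    · rw [hyω, place_apply_of_not M (by omega), zero_add, place_altA_apply, place_altA_apply, hi,
        hj]
      simp only [altEntry]
      split_ifs <;> first | omega | rfl
  · rw [hZ]
    rcases hcase i with ⟨a, hi, hi'⟩ | ⟨a, hi, hi'⟩
    · rw [dif_pos (by omega), hi']
      exact congrArg (fun b => ζ (c b) j) (Fin.ext hi.symm)
    · rw [dif_neg (by omega), hi', hζ _ (hyg a)]
      rfl

/-- A linear functional that vanishes on the radical is represented by a vector. -/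
theorem exists_eq_apply (f : V →ₗ[F] F) (hf : ∀ ρ, ω ρ = 0 → f ρ = 0) :
    ∃ v, ∀ u, f u = ω u v := by
  have h1 : f ∈ (LinearMap.ker ω).dualAnnihilator := by
    rw [Submodule.mem_dualAnnihilator]
    exact hf
  rw [← LinearMap.range_dualMap_eq_dualAnnihilator_ker] at h1
  obtain ⟨φ, rfl⟩ := h1
  obtain ⟨v, rfl⟩ := (Module.evalEquiv F V).surjective φ
  exact ⟨v, fun u => rfl⟩

theorem hasBasis_of_zero (hω : ∀ v, ω v v = 0) (hn : Module.finrank F V = n)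
    (hζ : ∀ v, ζ v = 0) : ∃ s, 2 * s ≤ n ∧ HasBasis ω ζ (place n 0 (altA F s)) 0 := by
  obtain ⟨s, hs, x, hx, h⟩ := exists_alternating_basis n V ω hω hn
  exact ⟨s, hs, x, hx, h, fun i j => by simp [hζ]⟩

/-- The image of `ζ` is a line, and `ζ` does not vanish on the radical. -/
theorem hasBasis_line_radical (hω : ∀ v, ω v v = 0) (hn : Module.finrank F V = n) {a : F}
    (hζ : ∀ v, ζ v 1 = a * ζ v 0) {ρ : V} (hρ : ω ρ = 0) (hρ1 : ζ ρ 0 = 1) :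
    ∃ s, 1 + 2 * s ≤ n ∧
      HasBasis ω ζ (place n 1 (altA F s)) (twoCols (colE F n 1) (a • colE F n 1)) := by
  have := hasBasis_of_core (ζ := ζ) hω ![ρ] (LinearMap.pi ![LinearMap.proj 0 ∘ₗ ζ]) ?_ ?_ ?_ hn 0 ?_
    (twoCols (colE F n 1) (a • colE F n 1)) ?_
  · simpa using this
  · intro i; ext j; fin_cases i; fin_cases j; simp [hρ1]
  · intro v hv
    have h0 := congrFun hv 0
    ext j
    fin_cases j <;> simp_all
  · intro v hv i
    fin_cases i; simp [hρ]
  · intro a b; fin_cases a; simp [hρ]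
  · intro i j
    by_cases hi : (i : ℕ) = 0 <;> fin_cases j <;>
      simp [twoCols_apply_zero, twoCols_apply_one, colE, hi, hζ, hρ1]

/-- The image of `ζ` is a line, and `ζ` vanishes on the radical: the first coordinate of `ζ` is then
`ω · f`, and `f` completes `e` to a hyperbolic pair. -/
theorem hasBasis_line (hω : ∀ v, ω v v = 0) (hn : Module.finrank F V = n) {a : F}
    (hζ : ∀ v, ζ v 1 = a * ζ v 0) (hR : ∀ ρ, ω ρ = 0 → ζ ρ 0 = 0) {e : V} (he : ζ e 0 = 1) :
    ∃ s, 2 * (s + 1) ≤ n ∧ HasBasis ω ζ (place n 0 (altA F (s + 1)))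
      (twoCols (colE F n 1) (a • colE F n 1)) := by
  obtain ⟨f, hf⟩ := exists_eq_apply (LinearMap.proj 0 ∘ₗ ζ) hR
  have hf : ∀ u, ζ u 0 = ω u f := hf
  have hef : ω e f = 1 := by rw [← hf, he]
  have hfe : ω f e = -1 := by rw [alternating_neg hω, hef]
  have hf0 : ζ f 0 = 0 := by rw [hf, hω]
  have key := hasBasis_of_core (ζ := ζ) hω ![e, f]
    (LinearMap.pi ![LinearMap.proj 0 ∘ₗ ζ, ω e]) ?_ ?_ ?_ hn (altA F 1) ?_
    (twoCols (colE F n 1) (a • colE F n 1)) ?_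
  · obtain ⟨s, hs, h⟩ := key
    exact ⟨s, by omega, by rwa [place_altA_succ]⟩
  · intro i; ext j; fin_cases i <;> fin_cases j <;> simp [he, hef, hω, hf0]
  · intro v hv
    have h0 := congrFun hv 0
    ext j
    fin_cases j <;> simp_all
  · intro v hv i
    have h0 := congrFun hv 0
    have h1 := congrFun hv 1
    have h2 := alternating_neg hω v f
    simp only [LinearMap.pi_apply, Matrix.cons_val_zero, Matrix.cons_val_one,
      LinearMap.comp_apply, LinearMap.proj_apply, Pi.zero_apply] at h0 h1
    rw [← hf, h0, neg_zero] at h2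
    fin_cases i
    exacts [h1, h2]
  · intro a b; fin_cases a <;> fin_cases b <;> simp [hω, hef, hfe, altA]
  · intro i j
    by_cases hi : (i : ℕ) = 0
    · fin_cases j <;> simp [twoCols_apply_zero, twoCols_apply_one, colE, hi, hζ, he]
    · by_cases hi' : (i : ℕ) = 1
      · fin_cases j <;> simp [twoCols_apply_zero, twoCols_apply_one, colE, hi', hζ, hf0]
      · have : ¬ (i : ℕ) < 2 := by omega
        fin_cases j <;> simp [twoCols_apply_zero, twoCols_apply_one, colE, this, hi]

/-- The radical is mapped onto the plane. -/
theorem hasBasis_radical_onto (hω : ∀ v, ω v v = 0) (hn : Module.finrank F V = n) {ρ σ : V}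
    (hρ : ω ρ = 0) (hσ : ω σ = 0) (hρ1 : ζ ρ = ![1, 0]) (hσ1 : ζ σ = ![0, 1]) :
    ∃ s, 2 + 2 * s ≤ n ∧
      HasBasis ω ζ (place n 2 (altA F s)) (twoCols (colE F n 1) (colE F n 2)) := by
  have := hasBasis_of_core (ζ := ζ) hω ![ρ, σ] ζ ?_ (fun v hv => hv) ?_ hn 0 ?_
    (twoCols (colE F n 1) (colE F n 2)) (apply_twoCols le_rfl _ hρ1 hσ1 fun a ha => by omega)
  · simpa using this
  · intro i; ext j; fin_cases i <;> fin_cases j <;> simp [hρ1, hσ1]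
  · intro v hv i
    fin_cases i <;> simp [hρ, hσ]
  · intro a b; fin_cases a <;> simp [hρ, hσ]

theorem place_succ_one (s : ℕ) :
    place n 0 !![0, 0, 0; 0, 0, 1; 0, -1, 0] + place n 3 (altA F s) =
      place n 1 (altA F (s + 1)) := by
  rw [place_altA_succ]
  congr 1
  ext i j
  rw [place_altA_apply]
  simp only [altEntry, place, of_apply]
  obtain ⟨i, hi⟩ := i
  obtain ⟨j, hj⟩ := j
  rcases i with _ | _ | _ | i <;> rcases j with _ | _ | _ | j <;> simp

/-- The radical is mapped onto the line of `(1, 0)`, while `ζ` is onto. -/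
theorem hasBasis_radical_line_one (hω : ∀ v, ω v v = 0) (hn : Module.finrank F V = n) {ρ e : V}
    (hρ : ω ρ = 0) (hρ1 : ζ ρ = ![1, 0]) (he : ζ e = ![0, 1])
    (hR : ∀ ρ, ω ρ = 0 → ζ ρ 1 = 0) :
    ∃ s, 1 + 2 * (s + 1) ≤ n ∧
      HasBasis ω ζ (place n 1 (altA F (s + 1))) (twoCols (colE F n 1) (colE F n 2)) := by
  obtain ⟨f', hf'⟩ := exists_eq_apply (LinearMap.proj 1 ∘ₗ ζ) hR
  -- the representing vector is moved along the radical into the kernel of `ζ`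
  obtain ⟨f, hf, hf0⟩ : ∃ f, (∀ u, ζ u 1 = ω u f) ∧ ζ f 0 = 0 := by
    refine ⟨f' - ζ f' 0 • ρ, fun u => ?_, by simp [hρ1]⟩
    have : ω u ρ = 0 := by rw [alternating_neg hω, hρ]; simp
    rw [map_sub, map_smul, this, smul_zero, sub_zero]
    exact hf' u
  have hf1 : ζ f 1 = 0 := by rw [hf, hω]
  have hef : ω e f = 1 := by rw [← hf, he]; rfl
  have hfe : ω f e = -1 := by rw [alternating_neg hω, hef]
  have heρ : ω e ρ = 0 := by rw [alternating_neg hω, hρ]; simp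
  have hfρ : ω f ρ = 0 := by rw [alternating_neg hω, hρ]; simp
  have key := hasBasis_of_core (ζ := ζ) hω ![ρ, e, f]
    (LinearMap.pi ![LinearMap.proj 0 ∘ₗ ζ, LinearMap.proj 1 ∘ₗ ζ, ω e]) ?_ ?_ ?_ hn
    !![0, 0, 0; 0, 0, 1; 0, -1, 0] ?_
    (twoCols (colE F n 1) (colE F n 2))
    (apply_twoCols (by omega : 2 ≤ 3) _ (by exact hρ1) (by exact he) fun a ha => ?_)
  · obtain ⟨s, hs, h⟩ := key
    exact ⟨s, by omega, by rwa [place_succ_one] at h⟩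
  · intro i; ext j
    fin_cases i <;> fin_cases j <;> simp [hρ1, he, hf0, hf1, hω, heρ, hef]
  · intro v hv
    exact eq_zero_of_apply (congrFun hv 0) (congrFun hv 1)
  · intro v hv i
    have h1 : ζ v 1 = 0 := congrFun hv 1
    have h2 : ω e v = 0 := congrFun hv 2
    have h3 := alternating_neg hω v f
    rw [← hf, h1, neg_zero] at h3
    fin_cases i
    exacts [by simp [hρ], h2, h3]
  · intro a b; fin_cases a <;> fin_cases b <;> simp [hω, hef, hfe, hρ, heρ, hfρ]
  · have : a = 2 := Fin.ext (by simp; omega)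
    subst this
    exact eq_zero_of_apply hf0 hf1

/-- The radical is mapped onto the line of `(1, -1)`, while `ζ` is onto. -/
theorem hasBasis_radical_line_two (hω : ∀ v, ω v v = 0) (hn : Module.finrank F V = n) {ρ e : V}
    (hρ : ω ρ = 0) (hρ1 : ζ ρ = ![1, -1]) (he : ζ e = ![1, 0])
    (hR : ∀ ρ, ω ρ = 0 → ζ ρ 0 + ζ ρ 1 = 0) :
    ∃ s, 1 + 2 * (s + 1) ≤ n ∧
      HasBasis ω ζ (place n 0 (matY F) + place n 3 (altA F s))
        (twoCols (colE F n 1) (colE F n 2)) := by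
  obtain ⟨f', hf'⟩ := exists_eq_apply (LinearMap.proj 0 ∘ₗ ζ + LinearMap.proj 1 ∘ₗ ζ) hR
  have hf' : ∀ u, ζ u 0 + ζ u 1 = ω u f' := hf'
  -- the representing vector is moved along the radical into the kernel of `ζ`
  obtain ⟨f, hf, hf0⟩ : ∃ f, (∀ u, ζ u 0 + ζ u 1 = ω u f) ∧ ζ f 0 = 0 := by
    refine ⟨f' - ζ f' 0 • ρ, fun u => ?_, by simp [hρ1]⟩
    have : ω u ρ = 0 := by rw [alternating_neg hω, hρ]; simp
    rw [map_sub, map_smul, this, smul_zero, sub_zero]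
    exact hf' u
  have hf1 : ζ f 1 = 0 := by
    have := hf f
    rwa [hω, hf0, zero_add] at this
  obtain ⟨e', rfl⟩ : ∃ e', ρ = e - e' := ⟨e - ρ, by simp⟩
  have he' : ζ e' = ![0, 1] := by
    rw [map_sub, he] at hρ1
    ext j
    have := congrFun hρ1 j
    fin_cases j
    · simpa using this
    · simpa using this
  have hee : ω e' = ω e := by rw [map_sub, sub_eq_zero] at hρ; exact hρ.symm
  have hef : ω e f = 1 := by rw [← hf, he]; simp
  have hfe : ω f e = -1 := by rw [alternating_neg hω, hef]
  have hfe' : ω f e' = -1 := by rw [alternating_neg hω, hee, hef]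
  have hee' : ω e e' = 0 := by rw [← hee, hω]
  have key := hasBasis_of_core (ζ := ζ) hω ![e, e', f]
    (LinearMap.pi ![LinearMap.proj 0 ∘ₗ ζ, LinearMap.proj 1 ∘ₗ ζ, ω e]) ?_ ?_ ?_ hn
    (matY F) ?_ (twoCols (colE F n 1) (colE F n 2))
    (apply_twoCols (by omega : 2 ≤ 3) _ (by exact he) (by exact he') fun a ha => ?_)
  · obtain ⟨s, hs, h⟩ := key
    exact ⟨s, by omega, h⟩
  · intro i; ext j
    fin_cases i <;> fin_cases j <;> simp [he', he, hf0, hf1, hω, hef, hee']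
  · intro v hv
    exact eq_zero_of_apply (congrFun hv 0) (congrFun hv 1)
  · intro v hv i
    have h0 : ζ v 0 = 0 := congrFun hv 0
    have h1 : ζ v 1 = 0 := congrFun hv 1
    have h2 : ω e v = 0 := congrFun hv 2
    have h3 := alternating_neg hω v f
    rw [← hf, h0, h1, add_zero, neg_zero] at h3
    fin_cases i
    exacts [h2, by simpa [hee] using h2, h3]
  · intro a b; fin_cases a <;> fin_cases b <;> simp [hω, hef, hfe, hfe', hee, hee', matY]
  · have : a = 2 := Fin.ext (by simp; omega)
    subst this
    exact eq_zero_of_apply hf0 hf1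

/-- The map `ζ` is represented by two vectors that are not orthogonal; they span a hyperbolic plane,
rescaled here so that `ζ` takes the values `(1, 0)` and `(0, 1)`. -/
theorem hasBasis_ne_zero (hω : ∀ v, ω v v = 0) (hn : Module.finrank F V = n) {v₁ v₂ : V}
    (h₁ : ∀ u, ζ u 0 = ω u v₁) (h₂ : ∀ u, ζ u 1 = ω u v₂) (hc : ω v₁ v₂ ≠ 0) :
    ∃ s, 2 * (s + 1) ≤ n ∧
      HasBasis ω ζ (place n 0 ((ω v₁ v₂)⁻¹ • altA F 1) + place n 2 (altA F s))
        (twoCols (colE F n 1) (colE F n 2)) := by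
  have hc' : ω v₂ v₁ = -ω v₁ v₂ := alternating_neg hω _ _
  set c := ω v₁ v₂ with hcdef
  have he : ζ (-c⁻¹ • v₂) = ![1, 0] := by
    ext j
    fin_cases j
    · simp [h₁, hc', hc]
    · simp [h₂, hω]
  have he' : ζ (c⁻¹ • v₁) = ![0, 1] := by
    ext j
    fin_cases j
    · simp [h₁, hω]
    · simp [h₂, ← hcdef, hc]
  have key := hasBasis_of_core (ζ := ζ) hω ![-c⁻¹ • v₂, c⁻¹ • v₁] ζ ?_
    (fun v hv => hv) ?_ hn (c⁻¹ • altA F 1) ?_ (twoCols (colE F n 1) (colE F n 2))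
    (apply_twoCols le_rfl _ he he' fun a ha => by omega)
  · obtain ⟨s, hs, h⟩ := key
    exact ⟨s, by omega, h⟩
  · intro i; ext j; fin_cases i <;> fin_cases j <;> simp only [Fin.zero_eta, Fin.mk_one,
      Matrix.cons_val_zero, Matrix.cons_val_one, he, he'] <;> simp
  · intro v hv i
    have e1 : ω v₁ v = 0 := by rw [alternating_neg hω, ← h₁, hv]; simp
    have e2 : ω v₂ v = 0 := by rw [alternating_neg hω, ← h₂, hv]; simp
    fin_cases i <;> simp [e1, e2]
  · intro a b
    fin_cases a <;> fin_cases b <;> simp [hω, hc', ← hcdef, hc, altA]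

/-- The map `ζ` is onto and represented by two orthogonal vectors; they are completed to two
hyperbolic pairs. -/
theorem hasBasis_eq_zero (hω : ∀ v, ω v v = 0) (hn : Module.finrank F V = n) {v₁ v₂ : V}
    (h₁ : ∀ u, ζ u 0 = ω u v₁) (h₂ : ∀ u, ζ u 1 = ω u v₂) (hc : ω v₁ v₂ = 0)
    {e e₂ : V} (he : ζ e = ![1, 0]) (he₂ : ζ e₂ = ![0, 1]) :
    ∃ s, 2 * (s + 2) ≤ n ∧
      HasBasis ω ζ (place n 0 (matK F) + place n 4 (altA F s))
        (twoCols (colE F n 1) (colE F n 2)) := by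
  have hc' : ω v₂ v₁ = 0 := by rw [alternating_neg hω, hc, neg_zero]
  have hv₁ : ζ v₁ = 0 := eq_zero_of_apply (by rw [h₁, hω]) (by rw [h₂, hc])
  have hv₂ : ζ v₂ = 0 := eq_zero_of_apply (by rw [h₁, hc']) (by rw [h₂, hω])
  -- `e` is moved along `v₂` to become orthogonal to `e₂`
  obtain ⟨e₁, he₁, h12⟩ : ∃ e₁, ζ e₁ = ![1, 0] ∧ ω e₁ e₂ = 0 := by
    refine ⟨e + ω e e₂ • v₂, by simp [he, hv₂], ?_⟩
    have : ω v₂ e₂ = -1 := by rw [alternating_neg hω, ← h₂, he₂]; simp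
    simp [this]
  have h21 : ω e₂ e₁ = 0 := by rw [alternating_neg hω, h12, neg_zero]
  have a1 : ω e₁ v₁ = 1 := by rw [← h₁, he₁]; rfl
  have a2 : ω e₁ v₂ = 0 := by rw [← h₂, he₁]; rfl
  have a3 : ω e₂ v₁ = 0 := by rw [← h₁, he₂]; rfl
  have a4 : ω e₂ v₂ = 1 := by rw [← h₂, he₂]; rfl
  have b1 : ω v₁ e₁ = -1 := by rw [alternating_neg hω, a1]
  have b2 : ω v₂ e₁ = 0 := by rw [alternating_neg hω, a2, neg_zero]
  have b3 : ω v₁ e₂ = 0 := by rw [alternating_neg hω, a3, neg_zero]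
  have b4 : ω v₂ e₂ = -1 := by rw [alternating_neg hω, a4]
  have key := hasBasis_of_core (ζ := ζ) hω ![e₁, e₂, v₁, v₂]
    (LinearMap.pi ![LinearMap.proj 0 ∘ₗ ζ, LinearMap.proj 1 ∘ₗ ζ, ω e₁, ω e₂]) ?_ ?_ ?_ hn
    (matK F) ?_ (twoCols (colE F n 1) (colE F n 2))
    (apply_twoCols (by omega : 2 ≤ 4) _ (by exact he₁) (by exact he₂) fun a ha => ?_)
  · obtain ⟨s, hs, h⟩ := key
    exact ⟨s, by omega, h⟩
  · intro i; ext j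
    fin_cases i <;> fin_cases j <;>
      simp [he₁, he₂, hv₁, hv₂, hω, h12, h21, a1, a2, a3, a4]
  · intro v hv
    exact eq_zero_of_apply (congrFun hv 0) (congrFun hv 1)
  · intro v hv i
    have c0 : ζ v 0 = 0 := congrFun hv 0
    have c1 : ζ v 1 = 0 := congrFun hv 1
    have c2 : ω e₁ v = 0 := congrFun hv 2
    have c3 : ω e₂ v = 0 := congrFun hv 3
    have d1 : ω v₁ v = 0 := by rw [alternating_neg hω, ← h₁, c0, neg_zero]
    have d2 : ω v₂ v = 0 := by rw [alternating_neg hω, ← h₂, c1, neg_zero]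
    fin_cases i
    exacts [c2, c3, d1, d2]
  · intro a b
    fin_cases a <;> fin_cases b <;>
      simp [hω, h12, h21, a1, a2, a3, a4, b1, b2, b3, b4, hc, hc', matK]
  · have : a = 2 ∨ a = 3 := by
      rcases a with ⟨a, ha'⟩
      simp [Fin.ext_iff] at ha ⊢
      omega
    rcases this with rfl | rfl
    exacts [hv₁, hv₂]

end NormalForm

/-! ### Isometries of the anisotropic plane -/

section Plane

variable {F : Type*} [Field F] {z : F}

/-- The quadratic form of the plane. It is the norm form of the quadratic extension by a square
root of `z`, where the vector `(x, y)` stands for `x + y √z`. -/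
def planeNorm (z : F) (w : Fin 2 → F) : F := w 0 * w 0 - z * (w 1 * w 1)

theorem planeNorm_eq_zero (hz : ¬ IsSquare z) {w : Fin 2 → F} (h : planeNorm z w = 0) : w = 0 := by
  have := eq_zero_of_sq_sub_mul_sq hz h
  ext j
  fin_cases j
  exacts [this.1, this.2]

theorem planeNorm_smul (t : F) (w : Fin 2 → F) :
    planeNorm z (t • w) = t * t * planeNorm z w := by
  simp [planeNorm]
  ring

theorem planeNorm_eq_dotProduct (w : Fin 2 → F) : planeNorm z w = w ⬝ᵥ (Delta z *ᵥ w) := by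
  simp [planeNorm, Delta, dotProduct, mulVec, Fin.sum_univ_two]
  ring

theorem planeNorm_vecMul {W : Matrix (Fin 2) (Fin 2) F} (hW : W * Delta z * Wᵀ = Delta z)
    (w : Fin 2 → F) : planeNorm z (w ᵥ* W) = planeNorm z w := by
  rw [planeNorm_eq_dotProduct, planeNorm_eq_dotProduct]
  conv_rhs => rw [← hW]
  rw [← dotProduct_mulVec]
  simp only [← Matrix.mulVec_mulVec, mulVec_transpose]

/-- Vectors of equal nonzero norm differ by an isometry, the multiplication by their quotient in
the quadratic extension. -/
theorem exists_isometry_of_planeNorm_eq {w u : Fin 2 → F} (h : planeNorm z w = planeNorm z u)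
    (h0 : planeNorm z w ≠ 0) :
    ∃ W : Matrix (Fin 2) (Fin 2) F, W * Delta z * Wᵀ = Delta z ∧ w ᵥ* W = u := by
  set n := planeNorm z w with hn
  have hu : u 0 * u 0 - z * (u 1 * u 1) = n := h.symm
  have hw : w 0 * w 0 - z * (w 1 * w 1) = n := rfl
  set p := (u 0 * w 0 - z * (u 1 * w 1)) / n with hp
  set q := (u 1 * w 0 - u 0 * w 1) / n with hq
  have hpq : p * p - z * (q * q) = 1 := by
    rw [hp, hq]
    field_simp
    linear_combination (w 0 * w 0 - z * (w 1 * w 1)) * hu + n * hw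
  refine ⟨!![p, q; z * q, p], ?_, ?_⟩
  · ext i j
    fin_cases i <;> fin_cases j <;> simp [Delta, Matrix.mul_apply, Fin.sum_univ_two]
    · linear_combination hpq
    · ring
    · ring
    · linear_combination -z * hpq
  · ext j
    fin_cases j
    · simp [vecMul, dotProduct, hp, hq]
      field_simp
      linear_combination u 0 * hw
    · simp [vecMul, dotProduct, hp, hq]
      field_simp
      linear_combination u 1 * hw

theorem isSquare_div_of_not_isSquare [Fintype F] {a b : F} (ha : ¬ IsSquare a)
    (hb : ¬ IsSquare b) : IsSquare (a / b) := by
  classical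
  have hb0 : b ≠ 0 := fun h => hb (h ▸ IsSquare.zero)
  have ha0 : a ≠ 0 := fun h => ha (h ▸ IsSquare.zero)
  have h1 := quadraticChar_neg_one_iff_not_isSquare.2 ha
  have h2 := quadraticChar_neg_one_iff_not_isSquare.2 hb
  have h3 : IsSquare (a * b) := by
    rw [← quadraticChar_one_iff_isSquare (mul_ne_zero ha0 hb0), map_mul, h1, h2]
    norm_num
  obtain ⟨c, hc⟩ := h3
  exact ⟨c / b, by field_simp; linear_combination hc⟩

/-- A line of the plane is spanned, up to an isometry, by `(1, 0)` or by `(1, ε)`, according to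
the class of its norms modulo squares. -/
theorem exists_isometry_line [Fintype F] (hz : ¬ IsSquare z) (hz' : ¬ IsSquare (1 - z))
    {ε : F} (hε : ε * ε = 1) {w : Fin 2 → F} (hw : w ≠ 0) :
    ∃ W : Matrix (Fin 2) (Fin 2) F, ∃ t a : F, W * Delta z * Wᵀ = Delta z ∧ t ≠ 0 ∧
      w ᵥ* W = t • ![1, a] ∧ (a = 0 ∨ a = ε) := by
  have hn : planeNorm z w ≠ 0 := fun h => hw (planeNorm_eq_zero hz h)
  by_cases hs : IsSquare (planeNorm z w)
  · obtain ⟨t, ht⟩ := hs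
    have ht0 : t ≠ 0 := by rintro rfl; simp [ht] at hn
    obtain ⟨W, hW, hwW⟩ := exists_isometry_of_planeNorm_eq (w := w) (u := t • ![1, 0])
      (by rw [ht, planeNorm_smul]; simp [planeNorm]) hn
    exact ⟨W, t, 0, hW, ht0, hwW, Or.inl rfl⟩
  · obtain ⟨t, ht⟩ := isSquare_div_of_not_isSquare hs hz'
    have h1z : 1 - z ≠ 0 := fun h => hz' (h ▸ IsSquare.zero)
    rw [div_eq_iff h1z] at ht
    have ht0 : t ≠ 0 := by rintro rfl; simp [ht] at hn
    obtain ⟨W, hW, hwW⟩ := exists_isometry_of_planeNorm_eq (w := w) (u := t • ![1, ε])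
      (by rw [ht, planeNorm_smul]; simp [planeNorm, hε]) hn
    exact ⟨W, t, ε, hW, ht0, hwW, Or.inr rfl⟩

theorem exists_right_inv_of_isometry (h0 : z ≠ 0) {W : Matrix (Fin 2) (Fin 2) F}
    (hW : W * Delta z * Wᵀ = Delta z) : ∃ W', W * W' = 1 ∧ W' * W = 1 := by
  have h1 : W * (Delta z * Wᵀ * Delta z⁻¹) = 1 := by
    rw [← Delta_mul_Delta_inv h0]
    conv_rhs => rw [← hW]
    simp only [Matrix.mul_assoc]
  exact ⟨_, h1, mul_eq_one_comm.1 h1⟩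

theorem submodule_plane_cases (L : Submodule F (Fin 2 → F)) :
    L = ⊥ ∨ L = ⊤ ∨ ∃ w ∈ L, w ≠ 0 ∧ ∀ u ∈ L, ∃ s : F, u = s • w := by
  have h1 : Module.finrank F L ≤ 2 := by simpa using Submodule.finrank_le L
  rcases Nat.lt_or_ge (Module.finrank F L) 1 with h | h
  · exact Or.inl (Submodule.finrank_eq_zero.1 (by omega))
  rcases Nat.lt_or_ge (Module.finrank F L) 2 with h' | h'
  · obtain ⟨⟨w, hw⟩, hw0, hws⟩ := finrank_eq_one_iff'.1 (by omega : Module.finrank F L = 1)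
    refine Or.inr (Or.inr ⟨w, hw, fun h => hw0 (Subtype.ext h), fun u hu => ?_⟩)
    obtain ⟨s, hs⟩ := hws ⟨u, hu⟩
    exact ⟨s, (congrArg Subtype.val hs).symm⟩
  · exact Or.inr (Or.inl (Submodule.eq_top_of_finrank_eq (by simp; omega)))

end Plane

/-! ### Every pair is congruent to a representative -/

/-- The skew-symmetric part of the matrix representing a label. -/
def labelK (ν : ℕ) {F : Type*} [Field F] : Label F → Matrix (Fin ν) (Fin ν) F
  | .phi1 r => place ν 0 (altA F r)
  | .phi2 r _ => place ν 1 (altA F r)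
  | .phi3 r _ => place ν 0 (altA F r)
  | .phi4 r => place ν 1 (altA F r)
  | .phi5 r => place ν 0 (matY F) + place ν 3 (altA F (r - 1))
  | .phi6 r => place ν 2 (altA F r)
  | .phi7 r b => place ν 0 (b • altA F 1) + place ν 2 (altA F (r - 1))
  | .phi8 r => place ν 0 (matK F) + place ν 4 (altA F (r - 2))

/-- The last block of the matrix representing a label. -/
def labelZ (ν : ℕ) {F : Type*} [Field F] : Label F → Matrix (Fin ν) (Fin 2) F
  | .phi1 _ => 0
  | .phi2 _ a => twoCols (colE F ν 1) (a • colE F ν 1)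
  | .phi3 _ a => twoCols (colE F ν 1) (a • colE F ν 1)
  | .phi4 _ => twoCols (colE F ν 1) (colE F ν 2)
  | .phi5 _ => twoCols (colE F ν 1) (colE F ν 2)
  | .phi6 _ => twoCols (colE F ν 1) (colE F ν 2)
  | .phi7 _ _ => twoCols (colE F ν 1) (colE F ν 2)
  | .phi8 _ => twoCols (colE F ν 1) (colE F ν 2)

section Existence

variable {F : Type*} [Field F] {ν : ℕ} {z : F}

theorem dotProduct_mulVec_self (h2 : (2 : F) ≠ 0) {K : Matrix (Fin ν) (Fin ν) F} (hK : Kᵀ = -K)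
    (v : Fin ν → F) : v ⬝ᵥ (K *ᵥ v) = 0 := by
  have h1 : v ⬝ᵥ (K *ᵥ v) = v ⬝ᵥ (Kᵀ *ᵥ v) := by
    rw [mulVec_transpose, dotProduct_mulVec, dotProduct_comm]
  rw [hK, neg_mulVec, dotProduct_neg] at h1
  have : 2 * (v ⬝ᵥ (K *ᵥ v)) = 0 := by linear_combination h1
  exact (mul_eq_zero.1 this).resolve_left h2

theorem pairEquiv_of_hasBasis {K K' : Matrix (Fin ν) (Fin ν) F} {Z Z' : Matrix (Fin ν) (Fin 2) F}
    {W : Matrix (Fin 2) (Fin 2) F} (hW : W * Delta z * Wᵀ = Delta z)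
    (h : HasBasis (Matrix.toLinearMap₂' F K) (Z * W).vecMulLinear K' Z') :
    PairEquiv z K Z K' Z' := by
  obtain ⟨x, hx, hK, hZ⟩ := h
  have hli : LinearIndependent F x :=
    linearIndependent_of_top_le_span_of_card_eq_finrank hx.ge (by simp)
  have hu : IsUnit (of x) := Matrix.linearIndependent_rows_iff_isUnit.1 hli
  obtain ⟨Y, hY⟩ := hu.exists_left_inv
  refine ⟨(of x)ᵀ, Yᵀ, W, ?_, hW, ?_, ?_⟩
  · rw [← transpose_mul, hY, transpose_one]
  · ext i j
    rw [← hK, Matrix.toLinearMap₂'_apply', transpose_transpose, Matrix.mul_assoc]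
    simp [Matrix.mul_apply, dotProduct, mulVec]
  · ext i j
    rw [← hZ, transpose_transpose, Matrix.mul_assoc]
    simp [Matrix.mul_apply, vecMul, dotProduct]

theorem exists_label_pairEquiv [Fintype F] (h2 : (2 : F) ≠ 0) (hz : ¬ IsSquare z)
    (hz' : ¬ IsSquare (1 - z)) {Ω : Set F} (hΩ : Ω ∪ -Ω = {0}ᶜ)
    {K : Matrix (Fin ν) (Fin ν) F} (hK : Kᵀ = -K) (Z : Matrix (Fin ν) (Fin 2) F) :
    ∃ l : Label F, (l.Valid ν Ω ∨ l = .phi1 0) ∧ PairEquiv z K Z (labelK ν l) (labelZ ν l) := by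
  have h0 : z ≠ 0 := fun h => hz (h ▸ IsSquare.zero)
  set ω : (Fin ν → F) →ₗ[F] (Fin ν → F) →ₗ[F] F := Matrix.toLinearMap₂' F K with hωdef
  have hω : ∀ v, ω v v = 0 := fun v => by
    rw [hωdef, Matrix.toLinearMap₂'_apply', dotProduct_mulVec_self h2 hK]
  have hn : Module.finrank F (Fin ν → F) = ν := by simp
  set ζ := Z.vecMulLinear with hζdef
  have hζW : ∀ (W : Matrix (Fin 2) (Fin 2) F) v, (Z * W).vecMulLinear v = ζ v ᵥ* W := fun W v => by
    simp [hζdef, vecMul_vecMul]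
  have h1 : (1 : Matrix (Fin 2) (Fin 2) F) * Delta z * 1ᵀ = Delta z := by simp
  have hζ1 : (Z * (1 : Matrix (Fin 2) (Fin 2) F)).vecMulLinear = ζ := by simp [hζdef]
  rcases submodule_plane_cases (LinearMap.range ζ) with hr | hr | ⟨w, hwr, hw0, hr⟩
  · obtain ⟨s, hs, h⟩ := hasBasis_of_zero (ζ := ζ) hω hn
      (fun v => by have : ζ v ∈ LinearMap.range ζ := ⟨v, rfl⟩; rwa [hr] at this)
    refine ⟨.phi1 s, ?_, pairEquiv_of_hasBasis h1 (by rw [hζ1]; exact h)⟩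
    rcases Nat.eq_zero_or_pos s with rfl | hs0
    · exact Or.inr rfl
    · exact Or.inl ⟨hs0, by omega⟩
  · have hsurj : ∀ u, ∃ v, ζ v = u := LinearMap.range_eq_top.1 hr
    rcases submodule_plane_cases ((LinearMap.ker ω).map ζ) with hR | hR | ⟨w, hwR, hw0, hR⟩
    · have hR0 : ∀ ρ, ω ρ = 0 → ζ ρ = 0 := fun ρ hρ => by
        have : ζ ρ ∈ (LinearMap.ker ω).map ζ := ⟨ρ, hρ, rfl⟩
        rwa [hR] at this
      obtain ⟨v₁, hv₁⟩ := exists_eq_apply (LinearMap.proj 0 ∘ₗ ζ)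
        (fun ρ hρ => by simp [hR0 ρ hρ])
      obtain ⟨v₂, hv₂⟩ := exists_eq_apply (LinearMap.proj 1 ∘ₗ ζ)
        (fun ρ hρ => by simp [hR0 ρ hρ])
      have hv₁ : ∀ u, ζ u 0 = ω u v₁ := hv₁
      have hv₂ : ∀ u, ζ u 1 = ω u v₂ := hv₂
      by_cases hc : ω v₁ v₂ = 0
      · obtain ⟨e, he⟩ := hsurj ![1, 0]
        obtain ⟨e₂, he₂⟩ := hsurj ![0, 1]
        obtain ⟨s, hs, h⟩ := hasBasis_eq_zero hω hn hv₁ hv₂ hc he he₂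
        exact ⟨.phi8 (s + 2), Or.inl ⟨by omega, by omega⟩,
          pairEquiv_of_hasBasis h1 (by rw [hζ1]; exact h)⟩
      · have hmem : (ω v₁ v₂)⁻¹ ∈ Ω ∪ -Ω := by rw [hΩ]; simpa using hc
        rcases hmem with hm | hm
        · obtain ⟨s, hs, h⟩ := hasBasis_ne_zero hω hn hv₁ hv₂ hc
          exact ⟨.phi7 (s + 1) _, Or.inl ⟨⟨by omega, by omega⟩, hm⟩,
            pairEquiv_of_hasBasis h1 (by rw [hζ1]; exact h)⟩
        · -- the reflection in the first coordinate changes the sign of `ω v₁ v₂`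
          have hW : (!![1, 0; 0, -1] : Matrix (Fin 2) (Fin 2) F) * Delta z * !![1, 0; 0, -1]ᵀ =
              Delta z := by
            ext i j
            fin_cases i <;> fin_cases j <;> simp [Delta, Matrix.mul_apply, Fin.sum_univ_two]
          obtain ⟨s, hs, h⟩ := hasBasis_ne_zero 
            (ζ := (Z * (!![1, 0; 0, -1] : Matrix (Fin 2) (Fin 2) F)).vecMulLinear)
            (v₁ := v₁) (v₂ := -v₂) hω hn
            (fun u => by rw [hζW, ← hv₁]; simp [vecMul, dotProduct])
            (fun u => by rw [hζW, map_neg, ← hv₂]; simp [vecMul, dotProduct])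
            (by simpa using hc)
          exact ⟨.phi7 (s + 1) _, Or.inl ⟨⟨by omega, by omega⟩, by simpa using hm⟩,
            pairEquiv_of_hasBasis hW h⟩
    · have hRs : ∀ u, ∃ ρ, ω ρ = 0 ∧ ζ ρ = u := fun u => by
        have : u ∈ (LinearMap.ker ω).map ζ := by rw [hR]; trivial
        obtain ⟨ρ, hρ, h⟩ := this
        exact ⟨ρ, hρ, h⟩
      obtain ⟨ρ, hρ, hρ1⟩ := hRs ![1, 0]
      obtain ⟨σ, hσ, hσ1⟩ := hRs ![0, 1]
      obtain ⟨s, hs, h⟩ := hasBasis_radical_onto hω hn hρ hσ hρ1 hσ1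
      rcases Nat.eq_zero_or_pos s with rfl | hs0
      · refine ⟨.phi4 0, Or.inl (Nat.zero_le _), pairEquiv_of_hasBasis h1 ?_⟩
        have : labelK ν (.phi4 0 : Label F) = place ν 2 (altA F 0) := by
          ext i j
          rw [labelK, place_altA_apply, place_altA_apply, if_neg (by omega), if_neg (by omega)]
        rw [hζ1, this]
        exact h
      · exact ⟨.phi6 s, Or.inl ⟨hs0, by omega⟩, pairEquiv_of_hasBasis h1 (by rw [hζ1]; exact h)⟩
    · obtain ⟨W, t, a, hW, ht, hwW, ha⟩ := exists_isometry_line hz hz' (ε := -1) (by ring) hw0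
      obtain ⟨W', -, hW'⟩ := exists_right_inv_of_isometry h0 hW
      set ζ' := (Z * W).vecMulLinear with hζ'
      have hsurj' : ∀ u, ∃ v, ζ' v = u := fun u => by
        obtain ⟨v, hv⟩ := hsurj (u ᵥ* W')
        exact ⟨v, by rw [hζW, hv, vecMul_vecMul, hW', vecMul_one]⟩
      obtain ⟨ρ, hρ, hρw⟩ := hwR
      have hρ : ω ρ = 0 := hρ
      have hρ' : ω (t⁻¹ • ρ) = 0 := by rw [map_smul, hρ, smul_zero]
      have hρ1 : ζ' (t⁻¹ • ρ) = ![1, a] := by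
        rw [map_smul, hζW, hρw, hwW, smul_smul, inv_mul_cancel₀ ht, one_smul]
      have hR' : ∀ σ, ω σ = 0 → ζ' σ 1 = a * ζ' σ 0 := by
        intro σ hσ
        obtain ⟨s, hs⟩ := hR (ζ σ) ⟨σ, hσ, rfl⟩
        rw [hζW, hs, smul_vecMul, hwW]
        simp
        ring
      rcases ha with rfl | rfl
      · obtain ⟨e, he⟩ := hsurj' ![0, 1]
        obtain ⟨s, hs, h⟩ := hasBasis_radical_line_one hω hn hρ' hρ1 he
          (fun σ hσ => by rw [hR' σ hσ, zero_mul])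
        exact ⟨.phi4 (s + 1), Or.inl (show s + 1 ≤ (ν - 1) / 2 by omega),
          pairEquiv_of_hasBasis hW h⟩
      · obtain ⟨e, he⟩ := hsurj' ![1, 0]
        obtain ⟨s, hs, h⟩ := hasBasis_radical_line_two hω hn hρ' hρ1 he
          (fun σ hσ => by rw [hR' σ hσ]; ring)
        exact ⟨.phi5 (s + 1), Or.inl ⟨by omega, by omega⟩, pairEquiv_of_hasBasis hW h⟩
  · obtain ⟨W, t, a, hW, ht, hwW, ha⟩ := exists_isometry_line hz hz' (ε := 1) (by ring) hw0
    set ζ' := (Z * W).vecMulLinear with hζ'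
    obtain ⟨e, he⟩ := hwr
    have he1 : ζ' (t⁻¹ • e) = ![1, a] := by
      rw [map_smul, hζW, he, hwW, smul_smul, inv_mul_cancel₀ ht, one_smul]
    have hr' : ∀ v, ζ' v 1 = a * ζ' v 0 := by
      intro v
      obtain ⟨s, hs⟩ := hr (ζ v) ⟨v, rfl⟩
      rw [hζW, hs, smul_vecMul, hwW]
      simp
      ring
    by_cases hR : ∀ ρ, ω ρ = 0 → ζ' ρ 0 = 0
    · obtain ⟨s, hs, h⟩ := hasBasis_line (a := a) hω hn hr' hR (e := t⁻¹ • e) (by rw [he1]; rfl)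
      exact ⟨.phi3 (s + 1) a, Or.inl ⟨⟨by omega, by omega⟩, ha⟩, pairEquiv_of_hasBasis hW h⟩
    · push Not at hR
      obtain ⟨ρ, hρ, hρ0⟩ := hR
      obtain ⟨s, hs, h⟩ := hasBasis_line_radical (a := a) hω hn hr' (ρ := (ζ' ρ 0)⁻¹ • ρ)
        (by rw [map_smul, hρ, smul_zero]) (by simp [hρ0])
      exact ⟨.phi2 s a, Or.inl ⟨by omega, ha⟩, pairEquiv_of_hasBasis hW h⟩

end Existence

/-! ### The representatives and their radicals -/

section LabelMatrices

variable {F : Type*} [Field F] {ν : ℕ} {z : F}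

theorem place_cornerOne (z a : F) : place ν 0 (cornerOne z a) =
    -(2 : F)⁻¹ • (twoCols (colE F ν 1) (a • colE F ν 1) * Delta z *
      (twoCols (colE F ν 1) (a • colE F ν 1))ᵀ) := by
  ext i j
  by_cases hi : (i : ℕ) = 0 <;> by_cases hj : (j : ℕ) = 0 <;>
    simp [place, cornerOne, Matrix.mul_apply, Fin.sum_univ_two, twoCols_apply_zero,
      twoCols_apply_one, colE, Delta, hi, hj]
  left
  ring

theorem place_cornerTwo (z : F) : place ν 0 (cornerTwo z) =
    -(2 : F)⁻¹ • (twoCols (colE F ν 1) (colE F ν 2) * Delta z *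
      (twoCols (colE F ν 1) (colE F ν 2))ᵀ) := by
  ext ⟨i, hi⟩ ⟨j, hj⟩
  rcases i with _ | _ | i <;> rcases j with _ | _ | j <;>
    simp [place, cornerTwo, Matrix.mul_apply, Fin.sum_univ_two, twoCols_apply_zero,
      twoCols_apply_one, colE, Delta]

theorem phi_eq_skewSub (z : F) (l : Label F) :
    phi ν z l = skewSub z (labelK ν l) (labelZ ν l) := by
  cases l <;> simp only [phi, skewSub, labelK, labelZ, place_cornerOne, place_cornerTwo, place_add]
  · simp
  all_goals
    congr 1
    abel

theorem matY_transpose : (matY F)ᵀ = -matY F := by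
  ext i j
  fin_cases i <;> fin_cases j <;> simp [matY]

theorem matK_transpose : (matK F)ᵀ = -matK F := by
  ext i j
  fin_cases i <;> fin_cases j <;> simp [matK]

theorem labelK_transpose (l : Label F) : (labelK ν l)ᵀ = -labelK ν l := by
  have h (b : F) : (b • altA F 1)ᵀ = -(b • altA F 1) := by
    rw [transpose_smul, altA_transpose, smul_neg]
  cases l <;> simp only [labelK, transpose_add, place_transpose, altA_transpose, matY_transpose,
    matK_transpose, h, place_neg, neg_add]

/-- The part of a vector on the positions `s, …, s + m - 1`. -/
def segment {n s m : ℕ} (h : s + m ≤ n) : (Fin n → F) →ₗ[F] (Fin m → F) :=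
  LinearMap.funLeft F F fun a => ⟨s + a, by omega⟩

theorem segment_apply {n s m : ℕ} (h : s + m ≤ n) (v : Fin n → F) (a : Fin m) :
    segment h v a = v ⟨s + a, by omega⟩ := rfl

theorem segment_eq_zero {n s m : ℕ} (h : s + m ≤ n) {v : Fin n → F} :
    segment h v = 0 ↔ ∀ i : Fin n, s ≤ (i : ℕ) → (i : ℕ) < s + m → v i = 0 := by
  constructor
  · intro hv i h1 h2
    have := congrFun hv ⟨i - s, by omega⟩
    rw [segment_apply] at this
    rw [← this.trans (Pi.zero_apply _)]
    congr 1
    exact Fin.ext (by simp; omega)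
  · intro hv
    ext a
    exact hv _ (by simp) (by simp)

theorem segment_surjective {n s m : ℕ} (h : s + m ≤ n) :
    Function.Surjective (segment h : (Fin n → F) →ₗ[F] (Fin m → F)) :=
  LinearMap.funLeft_surjective_of_injective F F _ fun a b hab => by
    simpa [Fin.ext_iff] using hab

theorem place_mulVec {n s m : ℕ} (h : s + m ≤ n) (M : Matrix (Fin m) (Fin m) F) (v : Fin n → F)
    (i : Fin n) : (place n s M *ᵥ v) i =
      if hi : s ≤ (i : ℕ) ∧ (i : ℕ) < s + m then (M *ᵥ segment h v) ⟨i - s, by omega⟩ else 0 := by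
  split_ifs with hi
  · simp only [mulVec, dotProduct]
    symm
    refine Finset.sum_of_injOn (fun a : Fin m => (⟨s + a, by omega⟩ : Fin n)) ?_ ?_ ?_ ?_
    · intro a _ b _ hab
      simpa [Fin.ext_iff] using hab
    · intro a _
      simp
    · intro j _ hj
      rw [place_apply_of_not, zero_mul]
      rintro ⟨-, h1, h2⟩
      exact hj ⟨⟨j - s, by omega⟩, by simp, Fin.ext (by simp; omega)⟩
    · intro a _
      rw [segment_apply, place_apply_of_lt M (a := ⟨i - s, by omega⟩) (b := a) (by simp; omega) rfl]
  · simp only [mulVec, dotProduct]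
    refine Finset.sum_eq_zero fun j _ => ?_
    rw [place_apply_of_not, zero_mul]
    exact fun h => hi h.1

theorem place_mulVec_eq_zero {n s m : ℕ} (h : s + m ≤ n) (M : Matrix (Fin m) (Fin m) F)
    (v : Fin n → F) : place n s M *ᵥ v = 0 ↔ M *ᵥ segment h v = 0 := by
  constructor
  · intro hv
    ext a
    have := congrFun hv ⟨s + a, by omega⟩
    rw [place_mulVec h, dif_pos (by simp)] at this
    simpa using this
  · intro hv
    ext i
    rw [place_mulVec h, hv]
    simp

theorem place_add_place_mulVec_eq_zero {n k m : ℕ} (h : k + m ≤ n) (h' : 0 + k ≤ n)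
    (M : Matrix (Fin k) (Fin k) F) (N : Matrix (Fin m) (Fin m) F) (v : Fin n → F) :
    (place n 0 M + place n k N) *ᵥ v = 0 ↔ M *ᵥ segment h' v = 0 ∧ N *ᵥ segment h v = 0 := by
  rw [← place_mulVec_eq_zero, ← place_mulVec_eq_zero, add_mulVec]
  constructor
  · intro hv
    have key : ∀ i, (place n 0 M *ᵥ v) i = 0 := by
      intro i
      by_cases hi : (i : ℕ) < k
      · have := congrFun hv i
        rw [Pi.add_apply, place_mulVec h, dif_neg (by omega), add_zero] at this
        exact this
      · rw [place_mulVec h', dif_neg (by omega)]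
    have key : place n 0 M *ᵥ v = 0 := funext key
    exact ⟨key, by rwa [key, zero_add] at hv⟩
  · rintro ⟨h1, h2⟩
    rw [h1, h2, add_zero]

theorem altA_mulVec_eq_zero {r : ℕ} (u : Fin (2 * r) → F) : altA F r *ᵥ u = 0 ↔ u = 0 := by
  refine ⟨fun hu => ?_, fun hu => by rw [hu, mulVec_zero]⟩
  ext b
  have key : ∀ a : Fin (2 * r), (∀ j, j ≠ b → altA F r a j = 0) → altA F r a b ≠ 0 →
      u b = 0 := by
    intro a h1 h2
    have := congrFun hu a
    rw [mulVec, dotProduct, Finset.sum_eq_single b (fun j _ hj => by rw [h1 j hj, zero_mul])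
      (by simp)] at this
    exact (mul_eq_zero.1 this).resolve_left h2
  rcases Nat.mod_two_eq_zero_or_one b with hb | hb
  · refine key ⟨b + 1, by omega⟩ (fun j hj => ?_) ?_
    · have : (j : ℕ) ≠ b := fun h => hj (Fin.ext h)
      simp only [altA, of_apply]
      rw [if_neg (by omega), if_neg (by omega)]
    · simp [altA, hb]
      split_ifs <;> simp
  · refine key ⟨b - 1, by omega⟩ (fun j hj => ?_) ?_
    · have : (j : ℕ) ≠ b := fun h => hj (Fin.ext h)
      simp only [altA, of_apply]
      rw [if_neg (by omega), if_neg (by omega)]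
    · simp only [altA, of_apply]
      rw [if_pos (by omega)]
      simp

theorem matY_mulVec_eq_zero (u : Fin 3 → F) : matY F *ᵥ u = 0 ↔ u 0 + u 1 = 0 ∧ u 2 = 0 := by
  constructor
  · intro h
    have h0 := congrFun h 0
    have h2 := congrFun h 2
    simp [matY, mulVec, dotProduct, Fin.sum_univ_three] at h0 h2
    exact ⟨by linear_combination -h2, h0⟩
  · rintro ⟨h0, h2⟩
    ext j
    fin_cases j <;> simp [matY, mulVec, dotProduct, Fin.sum_univ_three, h2]
    linear_combination -h0

theorem matK_mulVec_eq_zero (u : Fin 4 → F) : matK F *ᵥ u = 0 ↔ u = 0 := by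
  refine ⟨fun h => ?_, fun hu => by rw [hu, mulVec_zero]⟩
  have h0 := congrFun h 0
  have h1 := congrFun h 1
  have h2 := congrFun h 2
  have h3 := congrFun h 3
  simp [matK, mulVec, dotProduct, Fin.sum_univ_four] at h0 h1 h2 h3
  ext j
  fin_cases j
  exacts [h2, h3, h0, h1]

theorem place_altA_mulVec_eq_zero {s r : ℕ} (h : s + 2 * r ≤ ν) (v : Fin ν → F) :
    place ν s (altA F r) *ᵥ v = 0 ↔ segment h v = 0 := by
  rw [place_mulVec_eq_zero h, altA_mulVec_eq_zero]

theorem labelK_phi7_mulVec_eq_zero {r : ℕ} {b : F} (hb : b ≠ 0) (hr : 1 ≤ r)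
    (h : 0 + 2 * r ≤ ν) (v : Fin ν → F) :
    labelK ν (.phi7 r b) *ᵥ v = 0 ↔ segment h v = 0 := by
  rw [labelK, place_add_place_mulVec_eq_zero (by omega) (by omega), smul_mulVec,
    smul_eq_zero_iff_right hb, altA_mulVec_eq_zero, altA_mulVec_eq_zero, segment_eq_zero,
    segment_eq_zero, segment_eq_zero]
  constructor
  · rintro ⟨h1, h2⟩ i hi hi'
    rcases Nat.lt_or_ge i 2 with hlt | hge
    · exact h1 i hi (by omega)
    · exact h2 i hge (by omega)
  · intro h1
    exact ⟨fun i hi hi' => h1 i hi (by omega), fun i hi hi' => h1 i (by omega) (by omega)⟩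

theorem labelK_phi8_mulVec_eq_zero {r : ℕ} (hr : 2 ≤ r) (h : 0 + 2 * r ≤ ν) (v : Fin ν → F) :
    labelK ν (.phi8 r) *ᵥ v = 0 ↔ segment h v = 0 := by
  rw [labelK, place_add_place_mulVec_eq_zero (by omega) (by omega), matK_mulVec_eq_zero,
    altA_mulVec_eq_zero, segment_eq_zero, segment_eq_zero, segment_eq_zero]
  constructor
  · rintro ⟨h1, h2⟩ i hi hi'
    rcases Nat.lt_or_ge i 4 with hlt | hge
    · exact h1 i hi (by omega)
    · exact h2 i hge (by omega)
  · intro h1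
    exact ⟨fun i hi hi' => h1 i hi (by omega), fun i hi hi' => h1 i (by omega) (by omega)⟩

theorem labelK_phi5_mulVec_eq_zero {r : ℕ} (hr : 1 ≤ r) (h : 1 + 2 * r ≤ ν) (v : Fin ν → F) :
    labelK ν (.phi5 r) *ᵥ v = 0 ↔ v ⟨0, by omega⟩ + v ⟨1, by omega⟩ = 0 ∧
      ∀ i : Fin ν, 2 ≤ (i : ℕ) → (i : ℕ) < 1 + 2 * r → v i = 0 := by
  rw [labelK, place_add_place_mulVec_eq_zero (by omega) (by omega), matY_mulVec_eq_zero,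
    altA_mulVec_eq_zero, segment_eq_zero, and_assoc]
  refine and_congr Iff.rfl ?_
  constructor
  · rintro ⟨h1, h2⟩ i hi hi'
    rcases Nat.lt_or_ge i 3 with hlt | hge
    · have : i = ⟨0 + 2, by omega⟩ := Fin.ext (by simp; omega)
      rw [this]
      exact h1
    · exact h2 i hge (by omega)
  · intro h1
    exact ⟨h1 _ (by simp) (by simp; omega), fun i hi hi' => h1 i (by omega) (by omega)⟩

theorem finrank_ker_of_iff {m : ℕ} {K : Matrix (Fin ν) (Fin ν) F}
    (π : (Fin ν → F) →ₗ[F] (Fin m → F)) (hπ : Function.Surjective π)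
    (h : ∀ v, K *ᵥ v = 0 ↔ π v = 0) :
    m + Module.finrank F (LinearMap.ker K.mulVecLin) = ν := by
  have h1 : LinearMap.ker K.mulVecLin = LinearMap.ker π := by
    ext v
    exact h v
  have h2 := LinearMap.finrank_range_add_finrank_ker π
  rw [LinearMap.range_eq_top.2 hπ, finrank_top, Module.finrank_fin_fun,
    Module.finrank_fin_fun] at h2
  rw [h1, h2]

/-- Half the rank of the skew-symmetric part of a representative. -/
def labelRank {F : Type*} : Label F → ℕ
  | .phi1 r => r
  | .phi2 r _ => r
  | .phi3 r _ => r
  | .phi4 r => r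
  | .phi5 r => r
  | .phi6 r => r
  | .phi7 r _ => r
  | .phi8 r => r

theorem finrank_ker_labelK {Ω : Set F} (hν : 2 ≤ ν) (h0 : (0 : F) ∉ Ω) {l : Label F}
    (hl : l.Valid ν Ω) :
    2 * labelRank l + Module.finrank F (LinearMap.ker (labelK ν l).mulVecLin) = ν := by
  cases l with
  | phi1 r =>
    exact finrank_ker_of_iff _ (segment_surjective _)
      (place_altA_mulVec_eq_zero (by have := hl.2; omega))
  | phi2 r a =>
    exact finrank_ker_of_iff _ (segment_surjective _)
      (place_altA_mulVec_eq_zero (by have := hl.1; omega))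
  | phi3 r a =>
    exact finrank_ker_of_iff _ (segment_surjective _)
      (place_altA_mulVec_eq_zero (by have := hl.1.2; omega))
  | phi4 r =>
    have hl : r ≤ (ν - 1) / 2 := hl
    exact finrank_ker_of_iff _ (segment_surjective _) (place_altA_mulVec_eq_zero (by omega))
  | phi5 r =>
    have h1 := hl.1
    have h2 := hl.2
    have hr : 1 + 2 * r ≤ ν := by omega
    change 2 * r + _ = ν
    -- the entry in position `0` is added to the one in position `1`
    let π : (Fin ν → F) →ₗ[F] (Fin (2 * r) → F) := segment hr +
      LinearMap.pi fun a : Fin (2 * r) => if (a : ℕ) = 0 then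
        (LinearMap.proj (⟨0, by omega⟩ : Fin ν) : (Fin ν → F) →ₗ[F] F) else 0
    have hπ : ∀ v a, π v a = v ⟨1 + a, by omega⟩ + if (a : ℕ) = 0 then v ⟨0, by omega⟩ else 0 := by
      intro v a
      simp only [π, LinearMap.add_apply, Pi.add_apply, segment_apply, LinearMap.pi_apply]
      split_ifs <;> rfl
    refine finrank_ker_of_iff π (fun w => ?_) fun v => ?_
    · obtain ⟨v, hv⟩ := segment_surjective hr w
      refine ⟨fun i => if (i : ℕ) = 0 then 0 else v i, ?_⟩
      ext a
      rw [hπ, ← hv, segment_apply]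
      simp
    · rw [labelK_phi5_mulVec_eq_zero h1 hr]
      constructor
      · rintro ⟨e, h⟩
        ext a
        rw [hπ]
        split_ifs with ha
        · rw [Pi.zero_apply, ← e, add_comm]
          simp [ha]
        · rw [h _ (by simp; omega) (by simp), add_zero]
          rfl
      · intro h
        have h' : ∀ a, π v a = 0 := fun a => congrFun h a
        refine ⟨?_, fun i hi hi' => ?_⟩
        · have := h' ⟨0, by omega⟩
          rw [hπ, if_pos rfl] at this
          rw [add_comm]
          exact this
        · have := h' ⟨i - 1, by omega⟩
          rw [hπ, if_neg (by simp; omega), add_zero] at this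
          rw [← this]
          congr 1
          exact Fin.ext (by simp; omega)
  | phi6 r =>
    exact finrank_ker_of_iff _ (segment_surjective _)
      (place_altA_mulVec_eq_zero (by have := hl.2; have := hl.1; omega))
  | phi7 r b =>
    exact finrank_ker_of_iff _ (segment_surjective _)
      (labelK_phi7_mulVec_eq_zero (fun h => h0 (h ▸ hl.2)) hl.1.1 (by have := hl.1.2; omega))
  | phi8 r =>
    exact finrank_ker_of_iff _ (segment_surjective _)
      (labelK_phi8_mulVec_eq_zero hl.1 (by have := hl.2; omega))

end LabelMatrices

/-! ### Invariants of congruence -/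

section Invariants

variable {F : Type*} [Field F] {ν : ℕ} {z : F}

open Classical in
/-- The type of a subspace of the plane under isometries: `0` for the zero space, `1` and `2` for
lines that contain or do not contain a vector of nonzero square norm, and `3` for the plane. -/
noncomputable def planeType (z : F) (L : Submodule F (Fin 2 → F)) : ℕ :=
  if L = ⊥ then 0 else if L = ⊤ then 3 else
    if ∃ u ∈ L, u ≠ 0 ∧ IsSquare (planeNorm z u) then 1 else 2

theorem planeType_bot {L : Submodule F (Fin 2 → F)} (h : ∀ u ∈ L, u = 0) : planeType z L = 0 :=
  if_pos (L.eq_bot_iff.2 h)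

theorem planeType_top {L : Submodule F (Fin 2 → F)} (h0 : ![1, 0] ∈ L) (h1 : ![0, 1] ∈ L) :
    planeType z L = 3 := by
  have hL : L = ⊤ := by
    rw [eq_top_iff]
    intro u _
    have hu : u = u 0 • ![1, 0] + u 1 • ![0, 1] := by
      ext j
      fin_cases j <;> simp
    rw [hu]
    exact L.add_mem (L.smul_mem _ h0) (L.smul_mem _ h1)
  rw [planeType, if_neg, if_pos hL]
  rw [hL]
  exact top_ne_bot

open Classical in
theorem planeType_line (hz' : ¬ IsSquare (1 - z)) {L : Submodule F (Fin 2 → F)} {a : F}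
    (ha : a = 0 ∨ a * a = 1) (h1 : ![1, a] ∈ L) (h : ∀ u ∈ L, u 1 = a * u 0) :
    planeType z L = if a = 0 then 1 else 2 := by
  rw [planeType, if_neg, if_neg]
  · have hu : ∀ u ∈ L, planeNorm z u = u 0 * u 0 * (1 - z * (a * a)) := fun u hu => by
      rw [planeNorm, h u hu]
      ring
    by_cases ha0 : a = 0
    · rw [if_pos ha0, if_pos]
      exact ⟨_, h1, fun h => by simpa using congrFun h 0, 1, by rw [hu _ h1, ha0]; simp⟩
    · rw [if_neg ha0, if_neg]
      rintro ⟨u, huL, hu0, t, ht⟩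
      rw [hu u huL, ha.resolve_left ha0, mul_one] at ht
      have hu00 : u 0 ≠ 0 := by
        intro h0
        refine hu0 (funext fun j => ?_)
        fin_cases j
        · exact h0
        · exact (h u huL).trans (by rw [h0, mul_zero]; rfl)
      exact hz' ⟨t / u 0, by field_simp; linear_combination ht⟩
  · intro hL
    have : (![0, 1] : Fin 2 → F) ∈ L := by rw [hL]; trivial
    simpa using h _ this
  · intro hL
    rw [hL, Submodule.mem_bot] at h1
    simpa using congrFun h1 0

theorem planeType_map (h0 : z ≠ 0) {W : Matrix (Fin 2) (Fin 2) F}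
    (hW : W * Delta z * Wᵀ = Delta z) (L : Submodule F (Fin 2 → F)) :
    planeType z (L.map W.vecMulLinear) = planeType z L := by
  classical
  obtain ⟨W', hWW', hW'W⟩ := exists_right_inv_of_isometry h0 hW
  have hinj : Function.Injective W.vecMulLinear := fun u v h => by
    have := congrArg (· ᵥ* W') h
    simpa [vecMul_vecMul, hWW'] using this
  have hsurj : Function.Surjective W.vecMulLinear := fun u =>
    ⟨u ᵥ* W', by simp [vecMul_vecMul, hW'W]⟩
  have e1 : L.map W.vecMulLinear = ⊥ ↔ L = ⊥ := by
    constructor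
    · intro h
      rw [← Submodule.comap_map_eq_of_injective hinj L, h, Submodule.comap_bot,
        LinearMap.ker_eq_bot.2 hinj]
    · rintro rfl
      exact Submodule.map_bot _
  have e2 : L.map W.vecMulLinear = ⊤ ↔ L = ⊤ := by
    constructor
    · intro h
      rw [← Submodule.comap_map_eq_of_injective hinj L, h, Submodule.comap_top]
    · rintro rfl
      rw [Submodule.map_top, LinearMap.range_eq_top.2 hsurj]
  have e3 : (∃ u ∈ L.map W.vecMulLinear, u ≠ 0 ∧ IsSquare (planeNorm z u)) ↔
      ∃ u ∈ L, u ≠ 0 ∧ IsSquare (planeNorm z u) := by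
    constructor
    · rintro ⟨_, ⟨u, hu, rfl⟩, hu0, hs⟩
      refine ⟨u, hu, fun h => hu0 (by rw [h, map_zero]), ?_⟩
      rwa [Matrix.vecMulLinear_apply, planeNorm_vecMul hW] at hs
    · rintro ⟨u, hu, hu0, hs⟩
      refine ⟨_, ⟨u, hu, rfl⟩, fun h => hu0 (hinj (h.trans (map_zero _).symm)), ?_⟩
      rwa [Matrix.vecMulLinear_apply, planeNorm_vecMul hW]
  rw [planeType, planeType, if_congr e1 rfl (if_congr e2 rfl (if_congr e3 rfl rfl))]

/-- The values of the linear map given by `Z` on the radical of `K`. -/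
noncomputable def radicalImage (K : Matrix (Fin ν) (Fin ν) F) (Z : Matrix (Fin ν) (Fin 2) F) :
    Submodule F (Fin 2 → F) :=
  (LinearMap.ker K.mulVecLin).map Z.vecMulLinear

theorem mem_radicalImage {K : Matrix (Fin ν) (Fin ν) F} {Z : Matrix (Fin ν) (Fin 2) F}
    {u : Fin 2 → F} : u ∈ radicalImage K Z ↔ ∃ v, K *ᵥ v = 0 ∧ v ᵥ* Z = u := by
  simp [radicalImage]

theorem PairEquiv.invariants (h0 : z ≠ 0) {K K' : Matrix (Fin ν) (Fin ν) F}
    {Z Z' : Matrix (Fin ν) (Fin 2) F} (h : PairEquiv z K Z K' Z') :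
    Module.finrank F (LinearMap.ker K'.mulVecLin) =
      Module.finrank F (LinearMap.ker K.mulVecLin) ∧
    planeType z (LinearMap.range Z'.vecMulLinear) =
      planeType z (LinearMap.range Z.vecMulLinear) ∧
    planeType z (radicalImage K' Z') = planeType z (radicalImage K Z) := by
  obtain ⟨X, Y, W, hXY, hW, rfl, rfl⟩ := h
  have hYX : Y * X = 1 := mul_eq_one_comm.1 hXY
  have hYX' : Yᵀ * Xᵀ = 1 := by rw [← transpose_mul, hXY, transpose_one]
  have hker : ∀ v, (Xᵀ * K * X) *ᵥ v = 0 ↔ K *ᵥ (X *ᵥ v) = 0 := by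
    intro v
    rw [Matrix.mul_assoc, ← Matrix.mulVec_mulVec, ← Matrix.mulVec_mulVec]
    constructor
    · intro h
      have := congrArg (Yᵀ *ᵥ ·) h
      simpa [Matrix.mulVec_mulVec, ← Matrix.mul_assoc, hYX'] using this
    · intro h
      rw [h, mulVec_zero]
  have hval : ∀ v, v ᵥ* (Xᵀ * Z * W) = ((X *ᵥ v) ᵥ* Z) ᵥ* W := by
    intro v
    rw [← vecMul_vecMul, ← vecMul_vecMul, vecMul_transpose]
  have hX : ∀ v, X *ᵥ (Y *ᵥ v) = v := fun v => by rw [Matrix.mulVec_mulVec, hXY, one_mulVec]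
  have hY : ∀ v, Y *ᵥ (X *ᵥ v) = v := fun v => by rw [Matrix.mulVec_mulVec, hYX, one_mulVec]
  refine ⟨?_, ?_, ?_⟩
  · let e : (Fin ν → F) ≃ₗ[F] (Fin ν → F) :=
      LinearEquiv.ofLinearMap X.mulVecLin Y.mulVecLin (LinearMap.ext hX) (LinearMap.ext hY)
    have he : (LinearMap.ker (Xᵀ * K * X).mulVecLin).map (e : (Fin ν → F) →ₗ[F] (Fin ν → F)) =
        LinearMap.ker K.mulVecLin := by
      ext v
      constructor
      · rintro ⟨v, hv, rfl⟩
        exact (hker v).1 hv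
      · intro hv
        refine ⟨Y *ᵥ v, (hker _).2 ?_, hX v⟩
        rw [hX]
        exact hv
    rw [← LinearEquiv.finrank_map_eq e, he]
  · rw [← planeType_map h0 hW (LinearMap.range Z.vecMulLinear)]
    congr 1
    ext u
    constructor
    · rintro ⟨v, rfl⟩
      exact ⟨_, ⟨X *ᵥ v, rfl⟩, (hval v).symm⟩
    · rintro ⟨_, ⟨v, rfl⟩, rfl⟩
      exact ⟨Y *ᵥ v, (hval _).trans (by rw [hX]; rfl)⟩
  · rw [← planeType_map h0 hW (radicalImage K Z)]
    congr 1
    ext u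
    rw [mem_radicalImage]
    constructor
    · rintro ⟨v, hv, rfl⟩
      exact ⟨_, mem_radicalImage.2 ⟨X *ᵥ v, (hker v).1 hv, rfl⟩, (hval v).symm⟩
    · rintro ⟨_, hu, rfl⟩
      obtain ⟨v, hv, rfl⟩ := mem_radicalImage.1 hu
      exact ⟨Y *ᵥ v, (hker _).2 (by rw [hX]; exact hv), (hval _).trans (by rw [hX]; rfl)⟩

theorem det_sq_of_isometry (h0 : z ≠ 0) {W : Matrix (Fin 2) (Fin 2) F}
    (hW : W * Delta z * Wᵀ = Delta z) : W.det = 1 ∨ W.det = -1 := by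
  have h1 := congrArg Matrix.det hW
  have h2 : (Delta z).det ≠ 0 := by simp [Delta, h0]
  rw [det_mul, det_mul, det_transpose] at h1
  exact mul_self_eq_one_iff.1 (mul_right_cancel₀ h2 (by linear_combination h1))

/-- When the two coordinates of the linear map are represented by vectors through `K`, the value of
the form on these vectors is an invariant up to sign. -/
theorem PairEquiv.pairing_eq (h0 : z ≠ 0) (h2 : (2 : F) ≠ 0) {K K' : Matrix (Fin ν) (Fin ν) F}
    {Z Z' : Matrix (Fin ν) (Fin 2) F} (hK : Kᵀ = -K) (h : PairEquiv z K Z K' Z')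
    {v₁ v₂ w₁ w₂ : Fin ν → F} (hv₁ : K *ᵥ v₁ = fun i => Z i 0) (hv₂ : K *ᵥ v₂ = fun i => Z i 1)
    (hw₁ : K' *ᵥ w₁ = fun i => Z' i 0) (hw₂ : K' *ᵥ w₂ = fun i => Z' i 1) :
    w₁ ⬝ᵥ (K' *ᵥ w₂) = v₁ ⬝ᵥ (K *ᵥ v₂) ∨ w₁ ⬝ᵥ (K' *ᵥ w₂) = -(v₁ ⬝ᵥ (K *ᵥ v₂)) := by
  obtain ⟨X, Y, W, hXY, hW, rfl, rfl⟩ := h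
  have hYX' : Yᵀ * Xᵀ = 1 := by rw [← transpose_mul, hXY, transpose_one]
  have hcol : ∀ (j : Fin 2) (w : Fin ν → F),
      ((Xᵀ * K * X) *ᵥ w = fun i => (Xᵀ * Z * W) i j) →
      K *ᵥ (X *ᵥ w) = K *ᵥ (W 0 j • v₁ + W 1 j • v₂) := by
    intro j w hw
    have e1 : (fun i => (Xᵀ * Z * W) i j) = Xᵀ *ᵥ (K *ᵥ (W 0 j • v₁ + W 1 j • v₂)) := by
      rw [mulVec_add, mulVec_smul, mulVec_smul, hv₁, hv₂]
      ext i
      rw [Matrix.mul_assoc]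
      simp [Matrix.mul_apply, mulVec, dotProduct, Fin.sum_univ_two, mul_comm]
    rw [e1, Matrix.mul_assoc, ← Matrix.mulVec_mulVec, ← Matrix.mulVec_mulVec] at hw
    have := congrArg (Yᵀ *ᵥ ·) hw
    simpa only [Matrix.mulVec_mulVec, ← Matrix.mul_assoc, hYX', Matrix.one_mul] using this
  have hskew : ∀ u v, u ⬝ᵥ (K *ᵥ v) = -((K *ᵥ u) ⬝ᵥ v) := by
    intro u v
    rw [dotProduct_mulVec, ← mulVec_transpose, hK, neg_mulVec, neg_dotProduct]
  have hc1 := hcol 0 w₁ hw₁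
  have hc2 := hcol 1 w₂ hw₂
  have key : w₁ ⬝ᵥ ((Xᵀ * K * X) *ᵥ w₂) = W.det * (v₁ ⬝ᵥ (K *ᵥ v₂)) := by
    have e1 : w₁ ⬝ᵥ ((Xᵀ * K * X) *ᵥ w₂) = (X *ᵥ w₁) ⬝ᵥ (K *ᵥ (X *ᵥ w₂)) := by
      rw [Matrix.mul_assoc, ← Matrix.mulVec_mulVec, ← Matrix.mulVec_mulVec, dotProduct_mulVec,
        vecMul_transpose]
    have e2 : v₂ ⬝ᵥ (K *ᵥ v₁) = -(v₁ ⬝ᵥ (K *ᵥ v₂)) := by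
      rw [hskew, dotProduct_comm]
    rw [e1, hc2, hskew, hc1, ← hskew, Matrix.det_fin_two]
    simp only [mulVec_add, mulVec_smul, dotProduct_add, add_dotProduct, smul_dotProduct,
      dotProduct_smul, smul_eq_mul, dotProduct_mulVec_self h2 hK, e2]
    ring
  rw [key]
  rcases det_sq_of_isometry h0 hW with h | h <;> rw [h]
  · exact Or.inl (one_mul _)
  · exact Or.inr (by ring)

/-! ### Invariants of the representatives -/

theorem vecMul_twoCols_line (hν : 2 ≤ ν) (a : F) (v : Fin ν → F) :
    v ᵥ* twoCols (colE F ν 1) (a • colE F ν 1) =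
      ![v ⟨0, by omega⟩, a * v ⟨0, by omega⟩] := by
  have e : ∀ i : Fin ν, (i : ℕ) = 0 ↔ i = ⟨0, by omega⟩ := fun i => by simp [Fin.ext_iff]
  ext j
  fin_cases j <;> simp [vecMul, dotProduct, twoCols, colE, e, mul_comm]

theorem vecMul_twoCols_plane (hν : 2 ≤ ν) (v : Fin ν → F) :
    v ᵥ* twoCols (colE F ν 1) (colE F ν 2) = ![v ⟨0, by omega⟩, v ⟨1, by omega⟩] := by
  have e : ∀ i : Fin ν, (i : ℕ) = 0 ↔ i = ⟨0, by omega⟩ := fun i => by simp [Fin.ext_iff]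
  have e' : ∀ i : Fin ν, (i : ℕ) = 1 ↔ i = ⟨1, by omega⟩ := fun i => by simp [Fin.ext_iff]
  ext j
  fin_cases j <;> simp [vecMul, dotProduct, twoCols, colE, e, e']

open Classical in
/-- The type of the image of the linear map of a representative. -/
noncomputable def labelType {F : Type*} [Field F] : Label F → ℕ
  | .phi1 _ => 0
  | .phi2 _ a => if a = 0 then 1 else 2
  | .phi3 _ a => if a = 0 then 1 else 2
  | .phi4 _ => 3
  | .phi5 _ => 3
  | .phi6 _ => 3
  | .phi7 _ _ => 3
  | .phi8 _ => 3

open Classical in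
/-- The type of the image of the radical under the linear map of a representative. -/
noncomputable def labelRadicalType {F : Type*} [Field F] : Label F → ℕ
  | .phi1 _ => 0
  | .phi2 _ a => if a = 0 then 1 else 2
  | .phi3 _ _ => 0
  | .phi4 r => if r = 0 then 3 else 1
  | .phi5 _ => 2
  | .phi6 _ => 3
  | .phi7 _ _ => 0
  | .phi8 _ => 0

theorem planeType_range_line (hν : 2 ≤ ν) (hz' : ¬ IsSquare (1 - z)) {a : F}
    (ha : a = 0 ∨ a = 1) [Decidable (a = 0)] :
    planeType z (LinearMap.range (twoCols (colE F ν 1) (a • colE F ν 1)).vecMulLinear) =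
      if a = 0 then 1 else 2 := by
  rw [planeType_line (a := a) hz']
  · congr
  · rcases ha with rfl | rfl <;> simp
  · exact ⟨Pi.single ⟨0, by omega⟩ 1, by
      rw [Matrix.vecMulLinear_apply, vecMul_twoCols_line hν]; simp⟩
  · rintro _ ⟨v, rfl⟩
    rw [Matrix.vecMulLinear_apply, vecMul_twoCols_line hν]
    simp

theorem planeType_range_plane (hν : 2 ≤ ν) :
    planeType z (LinearMap.range (twoCols (colE F ν 1) (colE F ν 2)).vecMulLinear) = 3 := by
  apply planeType_top
  · exact ⟨Pi.single ⟨0, by omega⟩ 1, by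
      rw [Matrix.vecMulLinear_apply, vecMul_twoCols_plane hν]; simp⟩
  · exact ⟨Pi.single ⟨1, by omega⟩ 1, by
      rw [Matrix.vecMulLinear_apply, vecMul_twoCols_plane hν]; simp⟩

theorem planeType_range_labelZ {Ω : Set F} (hν : 2 ≤ ν) (hz' : ¬ IsSquare (1 - z)) {l : Label F}
    (hl : l.Valid ν Ω) :
    planeType z (LinearMap.range (labelZ ν l).vecMulLinear) = labelType l := by
  classical
  cases l with
  | phi1 r =>
    apply planeType_bot
    rintro _ ⟨v, rfl⟩
    simp [labelZ]
  | phi2 r a => exact planeType_range_line hν hz' hl.2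
  | phi3 r a => exact planeType_range_line hν hz' hl.2
  | _ => exact planeType_range_plane hν

theorem planeType_radicalImage_label {Ω : Set F} (hν : 2 ≤ ν) (hz' : ¬ IsSquare (1 - z))
    (h0 : (0 : F) ∉ Ω) {l : Label F} (hl : l.Valid ν Ω) :
    planeType z (radicalImage (labelK ν l) (labelZ ν l)) = labelRadicalType l := by
  classical
  cases l with
  | phi1 r =>
    apply planeType_bot
    intro u hu
    obtain ⟨v, -, rfl⟩ := mem_radicalImage.1 hu
    simp [labelZ]
  | phi2 r a =>
    have h := hl.1
    have hr : 1 + 2 * r ≤ ν := by omega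
    simp only [labelK, labelZ, labelRadicalType]
    rw [planeType_line (a := a) hz']
    · rcases hl.2 with rfl | rfl <;> simp
    · refine mem_radicalImage.2 ⟨Pi.single ⟨0, by omega⟩ 1, ?_, ?_⟩
      · rw [place_altA_mulVec_eq_zero hr, segment_eq_zero]
        intro i hi _
        exact Pi.single_eq_of_ne (by simp [Fin.ext_iff]; omega) _
      · rw [vecMul_twoCols_line hν]; simp
    · intro u hu
      obtain ⟨v, -, rfl⟩ := mem_radicalImage.1 hu
      rw [vecMul_twoCols_line hν]
      simp
  | phi3 r a =>
    have h := hl.1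
    have hr : 0 + 2 * r ≤ ν := by omega
    apply planeType_bot
    intro u hu
    obtain ⟨v, hv, rfl⟩ := mem_radicalImage.1 hu
    simp only [labelK, labelZ] at hv ⊢
    rw [place_altA_mulVec_eq_zero hr, segment_eq_zero] at hv
    rw [vecMul_twoCols_line hν, hv ⟨0, by omega⟩ (by simp) (by simp; omega)]
    simp
  | phi4 r =>
    have hl : r ≤ (ν - 1) / 2 := hl
    have hr : 1 + 2 * r ≤ ν := by omega
    simp only [labelK, labelZ, labelRadicalType]
    have h1 : (![1, 0] : Fin 2 → F) ∈ radicalImage (place ν 1 (altA F r))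
        (twoCols (colE F ν 1) (colE F ν 2)) := by
      refine mem_radicalImage.2 ⟨Pi.single ⟨0, by omega⟩ 1, ?_, ?_⟩
      · rw [place_altA_mulVec_eq_zero hr, segment_eq_zero]
        intro i hi _
        exact Pi.single_eq_of_ne (by simp [Fin.ext_iff]; omega) _
      · rw [vecMul_twoCols_plane hν]; simp
    split_ifs with h
    · subst h
      refine planeType_top h1 (mem_radicalImage.2 ⟨Pi.single ⟨1, by omega⟩ 1, ?_, ?_⟩)
      · rw [place_altA_mulVec_eq_zero hr, segment_eq_zero]
        intro i hi hi'
        omega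
      · rw [vecMul_twoCols_plane hν]; simp
    · rw [planeType_line (a := 0) hz' (Or.inl rfl) h1, if_pos rfl]
      intro u hu
      obtain ⟨v, hv, rfl⟩ := mem_radicalImage.1 hu
      rw [place_altA_mulVec_eq_zero hr, segment_eq_zero] at hv
      rw [vecMul_twoCols_plane hν, hv ⟨1, by omega⟩ (by simp) (by simp; omega)]
      simp
  | phi5 r =>
    have h1 := hl.1
    have h2 := hl.2
    have hr : 1 + 2 * r ≤ ν := by omega
    have hn : (-1 : F) ≠ 0 := by simp
    simp only [labelZ, labelRadicalType]
    rw [planeType_line (a := -1) hz', if_neg hn]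
    · exact Or.inr (by ring)
    · refine mem_radicalImage.2
        ⟨Pi.single ⟨0, by omega⟩ 1 - Pi.single ⟨1, by omega⟩ 1, ?_, ?_⟩
      · rw [labelK_phi5_mulVec_eq_zero h1 hr]
        refine ⟨by simp, fun i hi _ => ?_⟩
        rw [Pi.sub_apply, Pi.single_eq_of_ne (by simp [Fin.ext_iff]; omega),
          Pi.single_eq_of_ne (by simp [Fin.ext_iff]; omega), sub_zero]
      · rw [vecMul_twoCols_plane hν]; simp
    · intro u hu
      obtain ⟨v, hv, rfl⟩ := mem_radicalImage.1 hu
      rw [labelK_phi5_mulVec_eq_zero h1 hr] at hv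
      rw [vecMul_twoCols_plane hν]
      simp
      linear_combination hv.1
  | phi6 r =>
    have h := hl.2
    have h' := hl.1
    have hr : 2 + 2 * r ≤ ν := by omega
    simp only [labelK, labelZ, labelRadicalType]
    refine planeType_top (mem_radicalImage.2 ⟨Pi.single ⟨0, by omega⟩ 1, ?_, ?_⟩)
      (mem_radicalImage.2 ⟨Pi.single ⟨1, by omega⟩ 1, ?_, ?_⟩)
    · rw [place_altA_mulVec_eq_zero hr, segment_eq_zero]
      intro i hi _
      exact Pi.single_eq_of_ne (by simp [Fin.ext_iff]; omega) _
    · rw [vecMul_twoCols_plane hν]; simp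
    · rw [place_altA_mulVec_eq_zero hr, segment_eq_zero]
      intro i hi _
      exact Pi.single_eq_of_ne (by simp [Fin.ext_iff]; omega) _
    · rw [vecMul_twoCols_plane hν]; simp
  | phi7 r b =>
    have h := hl.1
    have hr : 0 + 2 * r ≤ ν := by omega
    apply planeType_bot
    intro u hu
    obtain ⟨v, hv, rfl⟩ := mem_radicalImage.1 hu
    rw [labelK_phi7_mulVec_eq_zero (fun h => h0 (h ▸ hl.2)) h.1 hr, segment_eq_zero] at hv
    simp only [labelZ]
    rw [vecMul_twoCols_plane hν, hv ⟨0, by omega⟩ (by simp) (by simp; omega),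
      hv ⟨1, by omega⟩ (by simp) (by simp; omega)]
    simp
  | phi8 r =>
    have h1 := hl.1
    have h2 := hl.2
    have hr : 0 + 2 * r ≤ ν := by omega
    apply planeType_bot
    intro u hu
    obtain ⟨v, hv, rfl⟩ := mem_radicalImage.1 hu
    rw [labelK_phi8_mulVec_eq_zero h1 hr, segment_eq_zero] at hv
    simp only [labelZ]
    rw [vecMul_twoCols_plane hν, hv ⟨0, by omega⟩ (by simp) (by simp; omega),
      hv ⟨1, by omega⟩ (by simp) (by simp; omega)]
    simp

theorem labelK_phi7_pairing {r : ℕ} {b : F} (hb : b ≠ 0) (hr : 1 ≤ r) (h : 2 * r ≤ ν) :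
    ∃ v₁ v₂, labelK ν (.phi7 r b) *ᵥ v₁ = (fun i => labelZ ν (.phi7 r b) i 0) ∧
      labelK ν (.phi7 r b) *ᵥ v₂ = (fun i => labelZ ν (.phi7 r b) i 1) ∧
      v₁ ⬝ᵥ (labelK ν (.phi7 r b) *ᵥ v₂) = b⁻¹ := by
  have e2 : labelK ν (.phi7 r b) *ᵥ Pi.single ⟨0, by omega⟩ (-b⁻¹) =
      fun i => labelZ ν (.phi7 r b) i 1 := by
    ext ⟨i, hi⟩
    rcases i with _ | _ | i <;>
      simp [labelK, labelZ, twoCols, colE, place, altA, hb]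
  refine ⟨Pi.single ⟨1, by omega⟩ b⁻¹, Pi.single ⟨0, by omega⟩ (-b⁻¹), ?_, e2, ?_⟩
  · ext ⟨i, hi⟩
    rcases i with _ | _ | i <;>
      simp [labelK, labelZ, twoCols, colE, place, altA, hb]
  · rw [e2]
    simp [labelZ, twoCols, colE]

theorem labelK_phi8_pairing {r : ℕ} (hr : 2 ≤ r) (h : 2 * r ≤ ν) :
    ∃ v₁ v₂, labelK ν (.phi8 r : Label F) *ᵥ v₁ = (fun i => labelZ ν (.phi8 r) i 0) ∧
      labelK ν (.phi8 r) *ᵥ v₂ = (fun i => labelZ ν (.phi8 r) i 1) ∧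
      v₁ ⬝ᵥ (labelK ν (.phi8 r) *ᵥ v₂) = 0 := by
  have e2 : labelK ν (.phi8 r : Label F) *ᵥ Pi.single ⟨3, by omega⟩ 1 =
      fun i => labelZ ν (.phi8 r) i 1 := by
    ext ⟨i, hi⟩
    rcases i with _ | _ | _ | _ | i <;>
      simp [labelK, labelZ, twoCols, colE, place, altA, matK]
  refine ⟨Pi.single ⟨2, by omega⟩ 1, Pi.single ⟨3, by omega⟩ 1, ?_, e2, ?_⟩
  · ext ⟨i, hi⟩
    rcases i with _ | _ | _ | _ | i <;>
      simp [labelK, labelZ, twoCols, colE, place, altA, matK]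
  · rw [e2]
    simp [labelZ, twoCols, colE]

/-- Representatives with different labels are not congruent. -/
theorem label_injective (h2 : (2 : F) ≠ 0) (hν : 2 ≤ ν) (hz : ¬ IsSquare z)
    (hz' : ¬ IsSquare (1 - z)) {Ω : Set F} (h0 : (0 : F) ∉ Ω) (hΩ : Disjoint Ω (-Ω))
    {l l' : Label F} (hl : l.Valid ν Ω) (hl' : l'.Valid ν Ω)
    (h : PairEquiv z (labelK ν l) (labelZ ν l) (labelK ν l') (labelZ ν l')) : l = l' := by
  have hz0 : z ≠ 0 := fun h => hz (h ▸ IsSquare.zero)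
  obtain ⟨i1, i2, i3⟩ := h.invariants hz0
  rw [planeType_range_labelZ hν hz' hl, planeType_range_labelZ hν hz' hl'] at i2
  rw [planeType_radicalImage_label hν hz' h0 hl, planeType_radicalImage_label hν hz' h0 hl'] at i3
  have r1 := finrank_ker_labelK hν h0 hl
  have r2 := finrank_ker_labelK hν h0 hl'
  have i4 : labelRank l = labelRank l' := by omega
  clear r1 r2 i1
  have hp := fun v₁ v₂ w₁ w₂ => h.pairing_eq (v₁ := v₁) (v₂ := v₂) (w₁ := w₁) (w₂ := w₂) hz0 h2
    (labelK_transpose l)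
  have hne : ∀ b ∈ Ω, b ≠ 0 := fun b hb h => h0 (h ▸ hb)
  clear h
  -- rank and types separate all families but the last two, which have the pairing as well
  cases l <;> cases l' <;>
    simp only [labelRank, labelType, labelRadicalType] at i4 i2 i3 <;>
    simp only [Label.Valid] at hl hl' <;>
    first
    | grind
    | skip
  · rename_i r b r' b'
    obtain ⟨v₁, v₂, e1, e2, e3⟩ := labelK_phi7_pairing (ν := ν) (hne b hl.2) hl.1.1 (by omega)
    obtain ⟨w₁, w₂, e4, e5, e6⟩ := labelK_phi7_pairing (ν := ν) (hne b' hl'.2) hl'.1.1 (by omega)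
    rcases hp _ _ _ _ e1 e2 e4 e5 with h | h <;> rw [e3, e6] at h
    · rw [i4, inv_injective h]
    · rw [← inv_neg] at h
      exact absurd (show b ∈ -Ω by rw [Set.mem_neg, ← inv_injective h]; exact hl'.2)
        (Set.disjoint_left.1 hΩ hl.2)
  · rename_i r b r'
    obtain ⟨v₁, v₂, e1, e2, e3⟩ := labelK_phi7_pairing (ν := ν) (hne b hl.2) hl.1.1 (by omega)
    obtain ⟨w₁, w₂, e4, e5, e6⟩ := labelK_phi8_pairing (F := F) (ν := ν) hl'.1 (by omega)
    have hb := inv_ne_zero (hne b hl.2)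
    rcases hp _ _ _ _ e1 e2 e4 e5 with h | h <;> rw [e3, e6] at h
    · exact absurd h.symm hb
    · exact absurd (neg_eq_zero.1 h.symm) hb
  · rename_i r r' b'
    obtain ⟨v₁, v₂, e1, e2, e3⟩ := labelK_phi8_pairing (F := F) (ν := ν) hl.1 (by omega)
    obtain ⟨w₁, w₂, e4, e5, e6⟩ := labelK_phi7_pairing (ν := ν) (hne b' hl'.2) hl'.1.1 (by omega)
    have hb := inv_ne_zero (hne b' hl'.2)
    rcases hp _ _ _ _ e1 e2 e4 e5 with h | h <;> rw [e3, e6] at h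
    · exact absurd h hb
    · exact absurd (h.trans neg_zero) hb

end Invariants

/-! ### Counting the representatives -/

section Count

variable {F : Type*} [Field F]

/-- The labels, with their parameters shifted to start from `0`. -/
def labelOfIndex (ν : ℕ) (Ω : Set F) :
    (Fin (ν / 2) ⊕ Fin ((ν - 1) / 2 + 1) × Bool ⊕ Fin (ν / 2) × Bool ⊕ Fin ((ν - 1) / 2 + 1)) ⊕
      (Fin ((ν - 1) / 2) ⊕ Fin ((ν - 2) / 2) ⊕ Fin (ν / 2) × Ω ⊕ Fin (ν / 2 - 1)) → Label F
  | .inl (.inl r) => .phi1 (r + 1)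
  | .inl (.inr (.inl (r, a))) => .phi2 r (if a then 1 else 0)
  | .inl (.inr (.inr (.inl (r, a)))) => .phi3 (r + 1) (if a then 1 else 0)
  | .inl (.inr (.inr (.inr r))) => .phi4 r
  | .inr (.inl r) => .phi5 (r + 1)
  | .inr (.inr (.inl r)) => .phi6 (r + 1)
  | .inr (.inr (.inr (.inl (r, b)))) => .phi7 (r + 1) b
  | .inr (.inr (.inr (.inr r))) => .phi8 (r + 2)

theorem labelOfIndex_injective (ν : ℕ) (Ω : Set F) :
    Function.Injective (labelOfIndex ν Ω) := by
  have hab : ∀ a b : Bool, (if a then (1 : F) else 0) = (if b then 1 else 0) → a = b := by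
    rintro (_ | _) (_ | _) <;> simp
  rintro ((r | ⟨r, a⟩ | ⟨r, a⟩ | r) | (r | r | ⟨r, b⟩ | r))
    ((r' | ⟨r', a'⟩ | ⟨r', a'⟩ | r') | (r' | r' | ⟨r', b'⟩ | r')) h <;>
    simp only [labelOfIndex, Label.phi1.injEq, Label.phi2.injEq, Label.phi3.injEq,
      Label.phi4.injEq, Label.phi5.injEq, Label.phi6.injEq, Label.phi7.injEq, Label.phi8.injEq,
      reduceCtorEq, add_left_inj, ← Fin.ext_iff, ← Subtype.ext_iff] at h
  all_goals first
    | rw [h]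
    | rw [h.1, hab _ _ h.2]
    | rw [h.1, h.2]

theorem range_labelOfIndex {ν : ℕ} (hν : 2 ≤ ν) (Ω : Set F) :
    Set.range (labelOfIndex ν Ω) = {l | l.Valid ν Ω} := by
  ext l
  constructor
  · rintro ⟨(r | ⟨r, a⟩ | ⟨r, a⟩ | r) | (r | r | ⟨r, b⟩ | r), rfl⟩
    · exact ⟨by omega, by omega⟩
    · exact ⟨by omega, by cases a <;> simp⟩
    · exact ⟨⟨by omega, by omega⟩, by cases a <;> simp⟩
    · exact Nat.lt_succ_iff.1 r.2
    · exact ⟨by omega, by omega⟩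
    · exact ⟨by omega, by omega⟩
    · exact ⟨⟨by omega, by omega⟩, b.2⟩
    · exact ⟨by omega, by omega⟩
  · intro hl
    cases l with
    | phi1 r =>
      obtain ⟨h1, h2⟩ := hl
      exact ⟨.inl (.inl ⟨r - 1, by omega⟩), by simp [labelOfIndex]; omega⟩
    | phi2 r a =>
      obtain ⟨h1, rfl | rfl⟩ := hl
      · exact ⟨.inl (.inr (.inl (⟨r, by omega⟩, false))), by simp [labelOfIndex]⟩
      · exact ⟨.inl (.inr (.inl (⟨r, by omega⟩, true))), by simp [labelOfIndex]⟩
    | phi3 r a =>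
      obtain ⟨⟨h1, h2⟩, rfl | rfl⟩ := hl
      · exact ⟨.inl (.inr (.inr (.inl (⟨r - 1, by omega⟩, false)))),
          by simp [labelOfIndex]; omega⟩
      · exact ⟨.inl (.inr (.inr (.inl (⟨r - 1, by omega⟩, true)))),
          by simp [labelOfIndex]; omega⟩
    | phi4 r =>
      have hl : r ≤ (ν - 1) / 2 := hl
      exact ⟨.inl (.inr (.inr (.inr ⟨r, by omega⟩))), by simp [labelOfIndex]⟩
    | phi5 r =>
      obtain ⟨h1, h2⟩ := hl
      exact ⟨.inr (.inl ⟨r - 1, by omega⟩), by simp [labelOfIndex]; omega⟩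
    | phi6 r =>
      obtain ⟨h1, h2⟩ := hl
      exact ⟨.inr (.inr (.inl ⟨r - 1, by omega⟩)), by simp [labelOfIndex]; omega⟩
    | phi7 r b =>
      obtain ⟨⟨h1, h2⟩, hb⟩ := hl
      exact ⟨.inr (.inr (.inr (.inl (⟨r - 1, by omega⟩, ⟨b, hb⟩)))),
        by simp [labelOfIndex]; omega⟩
    | phi8 r =>
      obtain ⟨h1, h2⟩ := hl
      exact ⟨.inr (.inr (.inr (.inr ⟨r - 2, by omega⟩))), by simp [labelOfIndex]; omega⟩

theorem two_mul_ncard_add_one [Fintype F] {Ω : Set F} (hΩ : Ω ∪ -Ω = {0}ᶜ)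
    (hΩ' : Disjoint Ω (-Ω)) : 2 * Ω.ncard + 1 = Fintype.card F := by
  have h1 : (-Ω).ncard = Ω.ncard := by
    rw [← Set.image_neg_eq_neg]
    exact Set.ncard_image_of_injective _ neg_injective
  have h2 := Set.ncard_union_eq hΩ'
  have h3 := Set.ncard_add_ncard_compl ({0} : Set F)
  rw [← hΩ, h2, h1, Set.ncard_singleton, Nat.card_eq_fintype_card] at h3
  omega

theorem ncard_valid [Fintype F] {ν : ℕ} (hν : 2 ≤ ν) {Ω : Set F} (hΩ : Ω ∪ -Ω = {0}ᶜ)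
    (hΩ' : Disjoint Ω (-Ω)) : {l : Label F | l.Valid ν Ω}.Finite ∧
    {l : Label F | l.Valid ν Ω}.ncard + 1 =
      (Fintype.card F + 7) / 2 * (ν / 2) + 4 * ((ν - 1) / 2) + (ν - 2) / 2 + 3 := by
  rw [← range_labelOfIndex hν]
  refine ⟨Set.finite_range _, ?_⟩
  rw [Set.ncard_range_of_injective (labelOfIndex_injective ν Ω)]
  simp only [Nat.card_sum, Nat.card_prod, Nat.card_fin]
  have h1 := two_mul_ncard_add_one hΩ hΩ'
  have h2 : (Fintype.card F + 7) / 2 = Ω.ncard + 4 := by omega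
  rw [h2, Nat.card_coe_set_eq]
  obtain ⟨m, hm⟩ : ∃ m, ν / 2 = m + 1 := ⟨ν / 2 - 1, by omega⟩
  simp only [hm, Nat.add_sub_cancel, Nat.card_eq_fintype_card, Fintype.card_bool]
  ring

end Count

end OrthDualPolar

open OrthDualPolar in
theorem theorem2p4 {F : Type*} [Field F] [Fintype F] (hq : Odd (Fintype.card F))
    (ν : ℕ) (hν : 2 ≤ ν)
    (z : F) (hz : ¬ IsSquare z) (hz' : ¬ IsSquare (1 - z))
    (Ω : Set F) (hΩ : Ω ∪ -Ω = {0}ᶜ) (hΩ' : Disjoint Ω (-Ω)) :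
    OrthDualPolar.P1 F ν ∈ OrthDualPolar.Lam ν z ∧
    (∀ l : OrthDualPolar.Label F, l.Valid ν Ω →
      OrthDualPolar.phi ν z l ∈ OrthDualPolar.Lam ν z) ∧
    Set.BijOn
      (fun l : OrthDualPolar.Label F =>
        OrthDualPolar.orbit (OrthDualPolar.G01 ν z) (OrthDualPolar.phi ν z l))
      {l | l.Valid ν Ω}
      (OrthDualPolar.orbitsOn (OrthDualPolar.G01 ν z) (OrthDualPolar.Lam ν z) \
        {{OrthDualPolar.P1 F ν}}) ∧
    OrthDualPolar.HasRank (OrthDualPolar.G0 ν z) (OrthDualPolar.Lam ν z)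
      ((Fintype.card F + 7) / 2 * (ν / 2) + 4 * ((ν - 1) / 2) + (ν - 2) / 2 + 3) := by
  have hν0 : ν ≠ 0 := by omega
  have hz0 : z ≠ 0 := fun h => hz (h ▸ IsSquare.zero)
  have h2 : (2 : F) ≠ 0 := by
    refine Ring.two_ne_zero fun h => ?_
    have := FiniteField.even_card_of_char_two h
    rw [Nat.odd_iff] at hq
    omega
  have h0 : (0 : F) ∉ Ω := fun h => by
    have : (0 : F) ∈ Ω ∪ -Ω := Or.inl h
    rw [hΩ] at this
    exact this rfl
  have hphi : ∀ l : Label F, phi ν z l ∈ Lam ν z := fun l => by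
    rw [phi_eq_skewSub]
    exact skewSub_mem_Lam h2 hz hν0 (labelK_transpose l) _
  have hP1 : P1 F ν ∈ Lam ν z := P1_mem_Lam hz hν0
  have horb1 : orbit (G01 ν z) (P1 F ν) = {P1 F ν} := by
    ext Q
    constructor
    · rintro ⟨T, hT, rfl⟩
      exact hT.2
    · rintro rfl
      exact self_mem_orbit _ _
  have hP1eq : P1 F ν = skewSub z (labelK ν (.phi1 0)) (labelZ ν (.phi1 0)) := by
    have : labelK ν (.phi1 0 : Label F) = 0 := by
      ext i j
      rw [labelK, place_altA_apply, if_neg (by omega)]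
      rfl
    simp [P1, skewSub, labelZ, this]
  have hbij : Set.BijOn (fun l : Label F => orbit (G01 ν z) (phi ν z l)) {l | l.Valid ν Ω}
      (orbitsOn (G01 ν z) (Lam ν z) \ {{P1 F ν}}) := by
    refine ⟨fun l hl => ⟨⟨_, hphi l, rfl⟩, fun h => ?_⟩, fun l hl l' hl' h => ?_, ?_⟩
    · -- the zero pair has a larger radical or a smaller image than a representative
      have h : orbit (G01 ν z) (phi ν z l) = {P1 F ν} := h
      rw [← horb1, phi_eq_skewSub, hP1eq, orbit_skewSub_eq_iff hz0] at h
      obtain ⟨i1, i2, -⟩ := h.invariants hz0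
      have r1 := finrank_ker_labelK hν h0 hl
      have r2 : 2 * 0 + Module.finrank F
          (LinearMap.ker (labelK ν (.phi1 0 : Label F)).mulVecLin) = ν :=
        finrank_ker_of_iff _ (segment_surjective _)
          (place_altA_mulVec_eq_zero (s := 0) (r := 0) (by omega))
      rw [planeType_range_labelZ hν hz' hl, planeType_bot (by rintro _ ⟨v, rfl⟩; simp [labelZ])]
        at i2
      have hl : l.Valid ν Ω := hl
      have i1 : labelRank l = 0 := by omega
      clear r1 r2 h
      cases l <;> simp only [labelRank, labelType, Label.Valid] at i1 i2 hl <;> grind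
    · simp only [phi_eq_skewSub] at h
      rw [orbit_skewSub_eq_iff hz0] at h
      exact label_injective h2 hν hz hz' h0 hΩ' hl hl' h
    · rintro _ ⟨⟨Q, hQ, rfl⟩, hne⟩
      obtain ⟨K, Z, hK, rfl⟩ := exists_eq_skewSub h2 hz hν0 hQ
      obtain ⟨l, hl, h⟩ := exists_label_pairEquiv h2 hz hz' hΩ hK Z
      rw [← orbit_skewSub_eq_iff hz0] at h
      rcases hl with hl | rfl
      · refine ⟨l, hl, ?_⟩
        simp only [phi_eq_skewSub]
        exact h.symm
      · rw [← hP1eq, horb1] at h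
        exact absurd h hne
  obtain ⟨hfin, hcard⟩ := ncard_valid hν hΩ hΩ'
  have hmem : {P1 F ν} ∈ orbitsOn (G01 ν z) (Lam ν z) := ⟨_, hP1, horb1⟩
  have hdfin : (orbitsOn (G01 ν z) (Lam ν z) \ {{P1 F ν}}).Finite := by
    rw [← hbij.image_eq]
    exact hfin.image _
  have hofin : (orbitsOn (G01 ν z) (Lam ν z)).Finite := by
    exact Set.Finite.of_sdiff hdfin (Set.finite_singleton _)
  refine ⟨hP1, fun l _ => hphi l, hbij, hasRank_G0 hz hν0 hofin ?_⟩
  rw [← Set.ncard_sdiff_singleton_add_one hmem hofin, ← hcard, ← hbij.image_eq,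
    Set.InjOn.ncard_image hbij.injOn]
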